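/- **Setting.** Let $n\ge 0$, $M=\mathbb Z^{n+1}$, $N=\operatorname{Hom}(M,\mathbb Z)$, and let $K$ be the field of convergent Laurent series $k=\sum_j c_jt^j$ over $\mathbb C$, with $\operatorname{val}(k)=-\min\{j: c_j\ne 0\}$. Let $\Delta\subset M_{\mathbb R}$ be a non-empty convex lattice polytope, $A=\Delta\cap M$, and $F=\sum_{m\in A}k_mx^m\in K[x_1^{\pm},\dots,x_{n+1}^{\pm}]$ with $k_m\neq 0$ for all $m\in A$. Put $v_m=\operatorname{val}(k_m)$, $\ell_m(X)=v_m+m\cdot X$ and $\operatorname{trop}(F)(X)=\max_{m\in A}\ell_m(X)$ for $X\in\mathbb R^{n+1}$. Let $\mathcal D_v$ be the subdivision of $\Delta$ whose elements are the projections to $M_{\mathbb R}$ of the bounded faces of $\operatorname{conv}\{(m,r): m\in A,\ r\le v_m\}$. Assume that $V(\operatorname{trop}(F))$ is smooth, i.e. all maximal elements of $\mathcal D_v$ are simplices of volume $1/(n+1)!$. Let $\mathcal F'$ be a unimodular fan subdividing the (inner) normal fan of $\Delta$. Let $\mathbb T=\mathbb R\cup\{-\infty\}$, a monoid under addition. For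 $S=\mathbb C$ (under multiplication) or $S=\mathbb T$, let $X_{\mathcal F'}(S)$ be the toric variety glued from the monoid-homomorphism spaces $U_\sigma(S)=\operatorname{Hom}(\sigma^\vee\cap M,S)$, $\sigma\in\mathcal F'$, with torus orbits $O_\sigma(S)$ and orbit closures $X_{\mathcal F',\sigma}(S)$; thus $O_{\{0\}}(\mathbb C)=(\mathbb C^*)^{n+1}$ and $O_{\{0\}}(\mathbb T)=\mathbb R^{n+1}$. Let $\operatorname{Log}_R\colon X_{\mathcal F'}(\mathbb C)\to X_{\mathcal F'}(\mathbb T)$ be induced by $c\mapsto\log_R|c|$, $0\mapsto-\infty$. *Cells.* Let $V(\operatorname{trop}(F))\subset X_{\mathcal F'}(\mathbb T)$ be the closure of the non-differentiable locus $V_{\{0\}}\subset\mathbb R^{n+1}$ of $\operatorname{trop}(F)$. It is a polyhedral complex $P$, whose cells are the closures of the sets $\{Y\in\mathbb R^{n+1}: \ell_m(Y)=\operatorname{trop}(F)(Y)$ for all $m\in A$ with $\ell_m(X)=\operatorname{trop}(F)(X)\}$, $X\in V_{\{0\}}$, together with the non-empty intersections of these closures with the $X_{\mathcal F',\sigma}(\mathbb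 T)$. Let $P_\sigma$ be the set of cells whose relative interior lies in $O_\sigma(\mathbb T)$. *Regions.* Let $C_0>0$. For $\mu\in P_{\{0\}}$ let $A_\mu=\{m\in A: \ell_m=\operatorname{trop}(F)\text{ on }\mu\cap\mathbb R^{n+1}\}$, and let $\widehat D_\mu$ be the closure in $X_{\mathcal F'}(\mathbb T)$ of the set of $X\in\mathbb R^{n+1}$ such that $|\ell_{m'}(X)-\ell_m(X)|<C_0$ for all $m,m'\in A_\mu$, and for every $m\in A\setminus A_\mu$ there is $m'\in A_\mu$ with $\ell_{m'}(X)-\ell_m(X)\ge C_0$. For $\mu\in P_\sigma$ with $\sigma\neq\{0\}$, let $\widehat D_\mu=\widehat D_{\mu'}\cap X_{\mathcal F',\sigma}(\mathbb T)$, where $\mu'\in P_{\{0\}}$ is the cell with $\mu=\mu'\cap X_{\mathcal F',\sigma}(\mathbb T)$. *Tropical localization.* Let $0<C_1<C_0$ and let $b\colon\mathbb R\to\mathbb R$ be a monotone (non-increasing) $C^\infty$ function with $b(t)=1\iff t\le C_1$ and $b(t)=0\iff t\ge C_0$. For $R>1$ and $x\in(\mathbb C^*)^{n+1}$ put $b_m(x)=\prod_{i\in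 A}b\big(\log_R|R^{v_i}x^i|-\log_R|R^{v_m}x^m|\big)$, and let $W_R$ be the closure in $X_{\mathcal F'}(\mathbb C)$ of the zero set of $\sum_{m\in A}b_m(x)R^{v_m}x^m$ in $(\mathbb C^*)^{n+1}$. **Proposition.** If $C_0$ is sufficiently small, then for all $C_1$ and $b$ as above and all sufficiently large $R$ (with $1/R$ smaller than the radii of convergence of all $k_m$), there exists a continuous map $\phi\colon\operatorname{Log}_R(W_R)\to V(\operatorname{trop}(F))$ such that $$(\ast)\qquad \phi\big(\operatorname{Log}_R(W_R)\cap\widehat D_\rho\cap O_\sigma(\mathbb T)\big)\subset\rho\cap O_\sigma(\mathbb T)\quad\text{for all }\sigma\in\mathcal F'\text{ and }\rho\in P_\sigma .$$ Moreover, any two continuous maps $\operatorname{Log}_R(W_R)\to V(\operatorname{trop}(F))$ satisfying $(\ast)$ are homotopic. -/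

import Mathlib

open scoped ContDiff

noncomputable section

namespace TropLoc

/-! ### Lattices, cones and fans -/

/-- The lattice `M = ℤ^(n+1)` (also used for the dual lattice `N`). -/
abbrev Lat (n : ℕ) : Type := Fin (n + 1) → ℤ

/-- The real vector space `M_ℝ = ℝ^(n+1)` (also used for `N_ℝ`). -/
abbrev RSp (n : ℕ) : Type := Fin (n + 1) → ℝ

/-- The inclusion of the lattice in the real vector space. -/
def toReal {n : ℕ} (m : Lat n) : RSp n := fun i => (m i : ℝ)

/-- The pairing of `M_ℝ` with `N_ℝ`. -/
def pair {n : ℕ} (y w : RSp n) : ℝ := ∑ i, y i * w i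

/-- A fan in `N_ℝ`: a finite non-empty collection of strongly convex rational polyhedral cones,
closed under taking faces, any two of which meet in a common face. -/
structure Fan (n : ℕ) where
  cones : Set (PointedCone ℝ (RSp n))
  finite : cones.Finite
  nonempty : cones.Nonempty
  rational : ∀ σ ∈ cones, ∃ G : Finset (Lat n), σ = PointedCone.hull ℝ (toReal '' (G : Set (Lat n)))
  salient : ∀ σ ∈ cones, ∀ w ∈ σ, -w ∈ σ → w = 0
  face_mem : ∀ σ ∈ cones, ∀ τ : PointedCone ℝ (RSp n), τ.IsFaceOf σ → τ ∈ cones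
  inter_face : ∀ σ ∈ cones, ∀ τ ∈ cones, (σ ⊓ τ).IsFaceOf σ ∧ (σ ⊓ τ).IsFaceOf τ

/-- A fan is unimodular if each of its cones is generated by a part of a basis of the lattice. -/
def Fan.IsUnimodular {n : ℕ} (𝓕 : Fan n) : Prop :=
  ∀ σ ∈ 𝓕.cones, ∃ (B : Module.Basis (Fin (n + 1)) ℤ (Lat n)) (s : Set (Fin (n + 1))),
    σ = PointedCone.hull ℝ ((fun i => toReal (B i)) '' s)

theorem Fan.bot_mem {n : ℕ} (𝓕 : Fan n) : (⊥ : PointedCone ℝ (RSp n)) ∈ 𝓕.cones := by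
  obtain ⟨σ, hσ⟩ := 𝓕.nonempty
  refine 𝓕.face_mem σ hσ ⊥ ⟨bot_le, ?_⟩
  intro x y a hx hy ha h
  have h0 : a • x + y = 0 := by simpa using h
  have hax : a • x ∈ σ := PointedCone.smul_mem σ ha.le hx
  have hneg : -(a • x) ∈ σ := by
    rw [← eq_neg_of_add_eq_zero_right h0]; exact hy
  have := 𝓕.salient σ hσ _ hax hneg
  rcases smul_eq_zero.1 this with h1 | h1
  · exact absurd h1 ha.ne'
  · simp [h1]

/-- The zero cone as an element of the fan. -/
def Fan.zeroCone {n : ℕ} (𝓕 : Fan n) : 𝓕.cones := ⟨⊥, 𝓕.bot_mem⟩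

/-- A (non-empty) convex lattice polytope. -/
def IsLatticePolytope {n : ℕ} (Δ : Set (RSp n)) : Prop :=
  ∃ V : Finset (Lat n), V.Nonempty ∧ Δ = convexHull ℝ (toReal '' (V : Set (Lat n)))

/-- The (inner) normal cone of `Δ` at `y`: the `w` for which `⟨·, w⟩` attains its minimum over `Δ`
at `y`. -/
def normalCone {n : ℕ} (Δ : Set (RSp n)) (y : RSp n) : PointedCone ℝ (RSp n) where
  carrier := {w | ∀ z ∈ Δ, pair y w ≤ pair z w}
  add_mem' := by
    intro a b ha hb z hz
    have h1 := ha z hz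
    have h2 := hb z hz
    simp only [pair, Pi.add_apply, mul_add, Finset.sum_add_distrib] at *
    linarith
  zero_mem' := by intro z _; simp [pair]
  smul_mem' := by
    intro c a ha z hz
    have h1 := ha z hz
    have key : ∀ u : RSp n, pair u (c • a) = (c : ℝ) * pair u a := by
      intro u
      simp only [pair, Finset.mul_sum]
      refine Finset.sum_congr rfl fun i _ => ?_
      have : (c • a) i = (c : ℝ) * a i := rfl
      rw [this]; ring
    rw [key, key]
    exact mul_le_mul_of_nonneg_left h1 c.2

/-- The cones of the normal fan of `Δ`. (The normal cone at `y` depends only on the face of `Δ`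
having `y` in its relative interior.) -/
def normalFan {n : ℕ} (Δ : Set (RSp n)) : Set (PointedCone ℝ (RSp n)) :=
  {τ | ∃ y ∈ Δ, τ = normalCone Δ y}

/-- `𝓕` is a subdivision of the collection of cones `𝒢`: each cone of `𝓕` lies in a cone of `𝒢`,
and each cone of `𝒢` is a union of cones of `𝓕`. -/
def Fan.Subdivides {n : ℕ} (𝓕 : Fan n) (𝒢 : Set (PointedCone ℝ (RSp n))) : Prop :=
  (∀ σ ∈ 𝓕.cones, ∃ τ ∈ 𝒢, σ ≤ τ) ∧
    ∀ τ ∈ 𝒢, ∀ w ∈ τ, ∃ σ ∈ 𝓕.cones, σ ≤ τ ∧ w ∈ σ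

/-! ### Toric varieties over a topological monoid -/

/-- The monoid `σ^∨ ∩ M`. -/
def dualMonoid {n : ℕ} (σ : PointedCone ℝ (RSp n)) : AddSubmonoid (Lat n) where
  carrier := {m | ∀ w ∈ σ, 0 ≤ pair (toReal m) w}
  zero_mem' := by intro w _; simp [pair, toReal]
  add_mem' := by
    intro a b ha hb w hw
    have h1 := ha w hw
    have h2 := hb w hw
    simp only [pair, toReal, Pi.add_apply, Int.cast_add, add_mul, Finset.sum_add_distrib] at *
    linarith

/-- The set `σ^⊥ ∩ M`. -/
def perp {n : ℕ} (σ : PointedCone ℝ (RSp n)) : Set (Lat n) :=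
  {m | ∀ w ∈ σ, pair (toReal m) w = 0}

/-- The affine toric variety `U_σ(S) = Hom(σ^∨ ∩ M, S)` of monoid homomorphisms, for a commutative
monoid `S` written multiplicatively. As a subspace of a space of functions it carries the topology
of pointwise convergence, i.e. the compact open topology for the discrete topology on
`σ^∨ ∩ M`. -/
abbrev Chart {n : ℕ} (σ : PointedCone ℝ (RSp n)) (S : Type) [CommMonoid S] : Type :=
  {u : dualMonoid σ → S // u 0 = 1 ∧ ∀ a b, u (a + b) = u a * u b}

theorem dualMonoid_anti {n : ℕ} {σ τ : PointedCone ℝ (RSp n)} (h : σ ≤ τ) :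
    dualMonoid τ ≤ dualMonoid σ := fun _ hm w hw => hm w (h hw)

/-- The restriction map `U_σ(S) → U_τ(S)` along `τ^∨ ∩ M ⊆ σ^∨ ∩ M`, for `σ ⊆ τ`. -/
def Chart.restrict {n : ℕ} {σ τ : PointedCone ℝ (RSp n)} {S : Type} [CommMonoid S] (h : σ ≤ τ)
    (u : Chart σ S) : Chart τ S :=
  ⟨fun m => u.1 ⟨m, dualMonoid_anti h m.2⟩, u.2.1, fun a b =>
    u.2.2 ⟨a, dualMonoid_anti h a.2⟩ ⟨b, dualMonoid_anti h b.2⟩⟩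

/-- The gluing relation: a point of `U_σ(S)` is glued to its image in `U_τ(S)`, for `σ` a face
of `τ`. -/
def glue {n : ℕ} (𝓕 : Fan n) (S : Type) [CommMonoid S]
    (a b : Σ σ : 𝓕.cones, Chart (σ : PointedCone ℝ (RSp n)) S) : Prop :=
  ∃ h : (a.1 : PointedCone ℝ (RSp n)).IsFaceOf b.1, Chart.restrict h.le a.2 = b.2

/-- The toric variety `X_𝓕(S)`: the disjoint union of the charts `U_σ(S)`, `σ ∈ 𝓕`, modulo the
equivalence relation generated by the gluing. -/
def ToricVar {n : ℕ} (𝓕 : Fan n) (S : Type) [CommMonoid S] : Type := Quot (glue 𝓕 S)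

/-- The quotient topology on the toric variety. -/
instance {n : ℕ} (𝓕 : Fan n) (S : Type) [CommMonoid S] [TopologicalSpace S] :
    TopologicalSpace (ToricVar 𝓕 S) :=
  inferInstanceAs (TopologicalSpace (Quot (glue 𝓕 S)))

/-- The map `U_σ(S) → X_𝓕(S)`. -/
def ToricVar.mk {n : ℕ} {𝓕 : Fan n} {S : Type} [CommMonoid S] (σ : 𝓕.cones)
    (u : Chart (σ : PointedCone ℝ (RSp n)) S) : ToricVar 𝓕 S := Quot.mk _ ⟨σ, u⟩

/-- The torus orbit `O_σ(S) = Hom(σ^⊥ ∩ M, S^×)` as a subset of `X_𝓕(S)`: it consists of the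
points of `U_σ(S)` that are invertible on `σ^⊥ ∩ M` and not invertible (that is, `0` for `S = ℂ`
and `-∞` for `S = 𝕋`) elsewhere on `σ^∨ ∩ M`. -/
def orbit {n : ℕ} (𝓕 : Fan n) (S : Type) [CommMonoid S] (σ : 𝓕.cones) : Set (ToricVar 𝓕 S) :=
  {x | ∃ u : Chart (σ : PointedCone ℝ (RSp n)) S,
    (∀ m, IsUnit (u.1 m) ↔ (m : Lat n) ∈ perp (σ : PointedCone ℝ (RSp n))) ∧
      x = ToricVar.mk σ u}

/-- The orbit closure `X_{𝓕,σ}(S)`. -/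
def orbitClosure {n : ℕ} (𝓕 : Fan n) (S : Type) [CommMonoid S] [TopologicalSpace S]
    (σ : 𝓕.cones) : Set (ToricVar 𝓕 S) := closure (orbit 𝓕 S σ)

/-- The tropical semiring `ℝ ∪ {-∞}` as a monoid under `⊙ = +` (written multiplicatively, with
`a ⊙ (-∞) = -∞`), with its order topology. -/
abbrev TT : Type := Multiplicative (WithBot ℝ)

/-- `Log_R : ℂ → 𝕋`. -/
def logT (R : ℝ) (c : ℂ) : TT :=
  if c = 0 then Multiplicative.ofAdd ⊥
  else Multiplicative.ofAdd ((Real.logb R ‖c‖ : ℝ) : WithBot ℝ)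

theorem logT_one (R : ℝ) : logT R 1 = 1 := by
  rw [logT, if_neg one_ne_zero, norm_one, Real.logb_one]; rfl

theorem logT_mul (R : ℝ) (a b : ℂ) : logT R (a * b) = logT R a * logT R b := by
  unfold logT
  by_cases ha : a = 0
  · rw [if_pos ha, if_pos (by rw [ha, zero_mul]), ← ofAdd_toAdd (ite (b = 0) _ _), ← ofAdd_add,
      WithBot.bot_add]
  by_cases hb : b = 0
  · rw [if_pos hb, if_pos (by rw [hb, mul_zero]), ← ofAdd_toAdd (ite (a = 0) _ _), ← ofAdd_add,
      WithBot.add_bot]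
  rw [if_neg ha, if_neg hb, if_neg (mul_ne_zero ha hb), norm_mul,
    Real.logb_mul (norm_ne_zero_iff.2 ha) (norm_ne_zero_iff.2 hb), WithBot.coe_add, ofAdd_add]

/-- `Log_R : U_σ(ℂ) → U_σ(𝕋)`, by composition. -/
def Chart.log {n : ℕ} {σ : PointedCone ℝ (RSp n)} (R : ℝ) (u : Chart σ ℂ) : Chart σ TT :=
  ⟨fun m => logT R (u.1 m), by
    refine ⟨?_, fun a b => ?_⟩
    · exact (congrArg (logT R) u.2.1).trans (logT_one R)
    · exact (congrArg (logT R) (u.2.2 a b)).trans (logT_mul R _ _)⟩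

/-- `Log_R : X_𝓕(ℂ) → X_𝓕(𝕋)`. -/
def Log {n : ℕ} (𝓕 : Fan n) (R : ℝ) : ToricVar 𝓕 ℂ → ToricVar 𝓕 TT :=
  Quot.map (fun a => ⟨a.1, Chart.log R a.2⟩) (by
    rintro ⟨σ, u⟩ ⟨τ, v⟩ ⟨h, e⟩
    refine ⟨h, ?_⟩
    exact congrArg (Chart.log R) e)

/-- The monomial `x^m` at a point of the complex torus. -/
def monomial {n : ℕ} (m : Lat n) (x : Fin (n + 1) → ℂˣ) : ℂ := ((∏ i, x i ^ m i : ℂˣ) : ℂ)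

/-- The point of `O_{0}(ℂ) ⊆ X_𝓕(ℂ)` with coordinates `x ∈ (ℂ^*)^(n+1)`. -/
def complexPoint {n : ℕ} (𝓕 : Fan n) (x : Fin (n + 1) → ℂˣ) : ToricVar 𝓕 ℂ :=
  ToricVar.mk 𝓕.zeroCone ⟨fun m => monomial (m : Lat n) x, by
    refine ⟨by simp [monomial], fun a b => ?_⟩
    simp [monomial, zpow_add, Finset.prod_mul_distrib]⟩

/-- The point of `O_{0}(𝕋) ⊆ X_𝓕(𝕋)` with coordinates `X ∈ ℝ^(n+1)`. -/
def realPoint {n : ℕ} (𝓕 : Fan n) (X : RSp n) : ToricVar 𝓕 TT :=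
  ToricVar.mk 𝓕.zeroCone
    ⟨fun m => Multiplicative.ofAdd ((pair (toReal (m : Lat n)) X : ℝ) : WithBot ℝ), by
      refine ⟨?_, fun a b => ?_⟩
      · have : pair (toReal (0 : Lat n)) X = 0 := by simp [pair, toReal]
        simp only [ZeroMemClass.coe_zero, this]; rfl
      · have : pair (toReal ((a : Lat n) + (b : Lat n))) X
            = pair (toReal (a : Lat n)) X + pair (toReal (b : Lat n)) X := by
          simp [pair, toReal, add_mul, Finset.sum_add_distrib]
        rw [← ofAdd_add, ← WithBot.coe_add, ← this]; rfl⟩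

/-! ### Laurent polynomials over the field of convergent Laurent series -/

/-- Absolute convergence of the formal Laurent series `k` on the circle of radius `r`. -/
def ConvergesAt (k : LaurentSeries ℂ) (r : ℝ) : Prop :=
  Summable fun j : ℤ => ‖k.coeff j‖ * r ^ j

/-- `k` is a convergent Laurent series: its radius of convergence is positive. -/
def IsConvergent (k : LaurentSeries ℂ) : Prop := ∃ r > 0, ConvergesAt k r

/-- The valuation `val(k) = -min {j | c_j ≠ 0}` of a non-zero Laurent series `k = ∑ c_j t^j`. -/
def val (k : LaurentSeries ℂ) : ℤ := -k.order

/-- Laurent polynomials in `n + 1` variables with Laurent series as coefficients;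
`F.coeff m` is the coefficient `k_m` of `x^m`. -/
abbrev LPoly (n : ℕ) : Type := AddMonoidAlgebra (LaurentSeries ℂ) (Lat n)

/-- The set of exponents of `F`. -/
def expts {n : ℕ} (F : LPoly n) : Finset (Lat n) := F.coeff.support

/-- The exponent `v_m = val(k_m)`. -/
def vv {n : ℕ} (F : LPoly n) (m : Lat n) : ℤ := val (F.coeff m)

/-- The tropical monomial `v_m + m · X`. -/
def tmon {n : ℕ} (F : LPoly n) (m : Lat n) (X : RSp n) : ℝ := (vv F m : ℝ) + pair (toReal m) X

/-- The tropicalization `trop(F)(X) = max_{m ∈ A} (v_m + m · X)`. -/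
def trop {n : ℕ} (F : LPoly n) (X : RSp n) : ℝ := ⨆ m : expts F, tmon F (m : Lat n) X

/-! ### The subdivision dual to the tropical hypersurface, smoothness -/

/-- The set `Γ_v = {(m, r) | m ∈ A, r ≤ v(m)}`. -/
def hypograph {n : ℕ} (F : LPoly n) : Set (RSp n × ℝ) :=
  {p | ∃ m ∈ expts F, p.1 = toReal m ∧ p.2 ≤ (vv F m : ℝ)}

/-- The subdivision `𝒟_v`: the projections of the bounded (non-empty) faces of `conv(Γ_v)`. -/
def subdivision {n : ℕ} (F : LPoly n) : Set (Set (RSp n)) :=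
  {τ | ∃ G, IsExposed ℝ (convexHull ℝ (hypograph F)) G ∧ G.Nonempty ∧ Bornology.IsBounded G ∧
    τ = Prod.fst '' G}

/-- The tropical hypersurface is smooth: the (maximal) elements of `𝒟_v` are
simplices of volume `1 / (n+1)!`. -/
def IsSmooth {n : ℕ} (F : LPoly n) : Prop :=
  ∀ τ, Maximal (· ∈ subdivision F) τ →
    (∃ p : Fin (n + 2) → RSp n, AffineIndependent ℝ p ∧ τ = convexHull ℝ (Set.range p)) ∧
      MeasureTheory.volume τ = ENNReal.ofReal (1 / ((n + 1).factorial : ℝ))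

/-! ### The tropical hypersurface and its cells -/

/-- The non-differentiable locus `V_{0}(trop(F)) ⊆ ℝ^(n+1)`. -/
def tropV0 {n : ℕ} (F : LPoly n) : Set (RSp n) := {X | ¬ DifferentiableAt ℝ (trop F) X}

/-- The tropical hypersurface `V(trop(F)) ⊆ X_𝓕(𝕋)`. -/
def tropV {n : ℕ} (𝓕 : Fan n) (F : LPoly n) : Set (ToricVar 𝓕 TT) :=
  closure (realPoint 𝓕 '' tropV0 F)

/-- The cell of `ℝ^(n+1)` through `X`: the points at which all tropical monomials that are
dominant at `X` are dominant. -/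
def cellThrough {n : ℕ} (F : LPoly n) (X : RSp n) : Set (RSp n) :=
  {Y | ∀ m ∈ expts F, tmon F m X = trop F X → tmon F m Y = trop F Y}

/-- The closures in `X_𝓕(𝕋)` of the cells of `V_{0}(trop(F))`. -/
def torusCells {n : ℕ} (𝓕 : Fan n) (F : LPoly n) : Set (Set (ToricVar 𝓕 TT)) :=
  {ρ | ∃ X ∈ tropV0 F, ρ = closure (realPoint 𝓕 '' cellThrough F X)}

/-- The polyhedral complex `P` given by `V(trop(F))`: its cells are the closures of the cells of
`V_{0}(trop(F))` and their non-empty intersections with the orbit closures (which are their faces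
at infinity). -/
def cells {n : ℕ} (𝓕 : Fan n) (F : LPoly n) : Set (Set (ToricVar 𝓕 TT)) :=
  {μ | μ.Nonempty ∧ (μ ∈ torusCells 𝓕 F ∨
    ∃ ρ ∈ torusCells 𝓕 F, ∃ σ : 𝓕.cones, μ = ρ ∩ orbitClosure 𝓕 TT σ)}

/-- The relative interior of a cell: the complement in it of its proper faces, i.e. of the
cells properly contained in it. -/
def relint {n : ℕ} (𝓕 : Fan n) (F : LPoly n) (μ : Set (ToricVar 𝓕 TT)) : Set (ToricVar 𝓕 TT) :=
  {x | x ∈ μ ∧ ∀ ν ∈ cells 𝓕 F, ν ⊂ μ → x ∉ ν}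

/-- The cells `P_σ` whose relative interior lies in the orbit `O_σ(𝕋)`. -/
def cellsAt {n : ℕ} (𝓕 : Fan n) (F : LPoly n) (σ : 𝓕.cones) : Set (Set (ToricVar 𝓕 TT)) :=
  {μ | μ ∈ cells 𝓕 F ∧ relint 𝓕 F μ ⊆ orbit 𝓕 TT σ}

/-- The set `A_μ` of exponents of the terms of `F` that are dominant on `μ`. -/
def domExpts {n : ℕ} (𝓕 : Fan n) (F : LPoly n) (μ : Set (ToricVar 𝓕 TT)) : Set (Lat n) :=
  {m | m ∈ expts F ∧ ∀ X, realPoint 𝓕 X ∈ μ → tmon F m X = trop F X}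

/-- The region `D̂_μ` for `μ ∈ P_{0}`. -/
def DhatZero {n : ℕ} (𝓕 : Fan n) (F : LPoly n) (C₀ : ℝ) (μ : Set (ToricVar 𝓕 TT)) :
    Set (ToricVar 𝓕 TT) :=
  closure (realPoint 𝓕 '' {X |
    (∀ m ∈ domExpts 𝓕 F μ, ∀ m' ∈ domExpts 𝓕 F μ, |tmon F m' X - tmon F m X| < C₀) ∧
      ∀ m ∈ expts F, m ∉ domExpts 𝓕 F μ →
        ∃ m' ∈ domExpts 𝓕 F μ, C₀ ≤ tmon F m' X - tmon F m X})

/-- The region `D̂_μ = D̂_μ' ∩ X_{𝓕,σ}(𝕋)` for `μ ∈ P_σ`, where `μ'` is the (unique) cell in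
`P_{0}` with `μ = μ' ∩ X_{𝓕,σ}(𝕋)`. For `σ = {0}` this is `DhatZero`, as `X_{𝓕,{0}}(𝕋)` is the
whole of `X_𝓕(𝕋)`. -/
def Dhat {n : ℕ} (𝓕 : Fan n) (F : LPoly n) (C₀ : ℝ) (σ : 𝓕.cones) (μ : Set (ToricVar 𝓕 TT)) :
    Set (ToricVar 𝓕 TT) :=
  {x | ∃ μ' ∈ cellsAt 𝓕 F 𝓕.zeroCone, μ = μ' ∩ orbitClosure 𝓕 TT σ ∧
    x ∈ DhatZero 𝓕 F C₀ μ' ∩ orbitClosure 𝓕 TT σ}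

/-! ### The tropical localization -/

/-- The monotone smooth cut-off functions with `b = 1` exactly on `(-∞, C₁]` and `b = 0` exactly
on `[C₀, ∞)`. -/
structure IsCutoff (C₀ C₁ : ℝ) (b : ℝ → ℝ) : Prop where
  smooth : ContDiff ℝ ∞ b
  anti : Antitone b
  eq_one_iff : ∀ t, b t = 1 ↔ t ≤ C₁
  eq_zero_iff : ∀ t, b t = 0 ↔ C₀ ≤ t

/-- The function `b_m` on the complex torus. -/
def bFun {n : ℕ} (F : LPoly n) (b : ℝ → ℝ) (R : ℝ) (q : ℂ) (m : Lat n) (x : Fin (n + 1) → ℂˣ) : ℝ :=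
  ∏ i ∈ expts F, b (Real.logb R ‖q ^ vv F i * monomial i x‖ - Real.logb R ‖q ^ vv F m * monomial m x‖)

/-- The function `f̃_q = ∑_m b_m(x) q^(v_m) x^m` on the complex torus. -/
def fTilde {n : ℕ} (F : LPoly n) (b : ℝ → ℝ) (R : ℝ) (q : ℂ) (x : Fin (n + 1) → ℂˣ) : ℂ :=
  ∑ m ∈ expts F, (bFun F b R q m x : ℂ) * (q ^ vv F m * monomial m x)

/-- The tropical localization `W_q ⊆ X_𝓕(ℂ)`, for `|q| = R`. -/
def tropLocalization {n : ℕ} (𝓕 : Fan n) (F : LPoly n) (b : ℝ → ℝ) (R : ℝ) (q : ℂ) :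
    Set (ToricVar 𝓕 ℂ) :=
  closure (complexPoint 𝓕 '' {x | fTilde F b R q x = 0})

/-- The set `Log_R(W_R) ⊆ X_𝓕(𝕋)`. -/
def logW {n : ℕ} (𝓕 : Fan n) (F : LPoly n) (b : ℝ → ℝ) (R : ℝ) : Set (ToricVar 𝓕 TT) :=
  Log 𝓕 R '' tropLocalization 𝓕 F b R (R : ℂ)

/-- The condition `φ(Log_R(W_R) ∩ D̂_ρ ∩ O_σ(𝕋)) ⊆ ρ ∩ O_σ(𝕋)` for all `σ ∈ 𝓕` and `ρ ∈ P_σ`. -/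
def PreservesCells {n : ℕ} (𝓕 : Fan n) (F : LPoly n) (C₀ : ℝ) (b : ℝ → ℝ) (R : ℝ)
    (φ : logW 𝓕 F b R → tropV 𝓕 F) : Prop :=
  ∀ σ : 𝓕.cones, ∀ ρ ∈ cellsAt 𝓕 F σ, ∀ x : logW 𝓕 F b R,
    (x : ToricVar 𝓕 TT) ∈ Dhat 𝓕 F C₀ σ ρ → (x : ToricVar 𝓕 TT) ∈ orbit 𝓕 TT σ →
      (φ x : ToricVar 𝓕 TT) ∈ ρ ∩ orbit 𝓕 TT σ

end TropLoc

end

/-!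
The tropical toric variety `X_𝓕(𝕋)` is studied through two invariants of a point `x`: the cone
`typ x` of its orbit, and its values `ev x m` on the lattice. They determine the point
(`ToricVar.ext`) and the topology (`tendsto_of_tendsto_ev`). Every orbit `O_σ(𝕋)` is a quotient of
`ℝ^(n+1)`, so that points can be translated by real vectors (`act`) and joined by segments inside
their orbits (`comb`); both operations are continuous on the whole toric variety. As the fan refines
the normal fan of the Newton polytope, the differences `ℓ_m - max_i ℓ_i` extend, after
exponentiation, to continuous functions on `X_𝓕(𝕋)`, the heights `hgt F x m`. The exponents of
height one are called dominant; a point with two dominant exponents lies on the tropical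
hypersurface, and the cells of the hypersurface are the loci in the orbit closures at which a given
set of exponents is dominant (`mem_cells_iff`).

Two facts on the polyhedral geometry of `trop(F)` enter. By smoothness the exponents that are
dominant at a point are affinely independent (`IsSmooth.isSimplicial`): they are vertices of a
unimodular simplex. Hence every non-empty subset of them is the set of dominant exponents of some
other point. And there is an `ε > 0` such that exponents which are within `ε` of being dominant at
some point are simultaneously dominant at another one (`exists_uniform_gap`): for a set of exponents
that are nowhere simultaneously dominant, Farkas' lemma bounds the largest defect from below. This
`ε` is the bound for `C₀`.

A single non-zero term of the localized polynomial cannot vanish. So at the logarithm of a zero at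
least two monomials are within `C₀` of the maximum, and one set `S` of such exponents occurs at real
points arbitrarily close to a given point of `Log_R(W_R)` (`exists_mem_closure_nearDom_eq`). For the
existence of `φ` one translates each point so that its nearly dominant monomials become dominant.
For a fixed vector of heights the translations that achieve this form a convex set, which by affine
independence is non-empty and can be followed continuously near that vector
(`exists_local_translation`); a partition of unity gives a continuous choice for all vectors of
heights at once. The translated point stays in its orbit and lies on the hypersurface, in every cell
`ρ` for which the original point was in `D̂_ρ`. For the uniqueness, each point of `Log_R(W_R)` lies
in a region `D̂_ρ`, where `ρ` is the cell of the set `S` in the orbit of the point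
(`exists_common_dom`); two maps that preserve cells therefore send it to two points of one convex
piece `ρ ∩ O_σ(𝕋)`, and the segments between them are a homotopy.
-/

noncomputable section

namespace TropLoc

/-! ### Pairings and unimodular cones -/

section

variable {n : ℕ}

theorem toReal_add (a b : Lat n) : toReal (a + b) = toReal a + toReal b := by
  ext i; simp [toReal]

theorem toReal_sub (a b : Lat n) : toReal (a - b) = toReal a - toReal b := by
  ext i; simp [toReal]

@[simp] theorem toReal_zero : toReal (0 : Lat n) = 0 := by
  ext i; simp [toReal]

theorem toReal_nsmul (k : ℕ) (m : Lat n) : toReal (k • m) = (k : ℝ) • toReal m := by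
  ext i; simp [toReal]

theorem toReal_sum {ι : Type*} (t : Finset ι) (f : ι → Lat n) :
    toReal (∑ j ∈ t, f j) = ∑ j ∈ t, toReal (f j) := by
  ext i; simp [toReal]

theorem toReal_injective : Function.Injective (toReal : Lat n → RSp n) := by
  intro a b h
  ext i
  have := congrFun h i
  simpa [toReal] using this

theorem pair_add_left (a b w : RSp n) : pair (a + b) w = pair a w + pair b w := by
  simp [pair, add_mul, Finset.sum_add_distrib]

theorem pair_sub_left (a b w : RSp n) : pair (a - b) w = pair a w - pair b w := by
  simp [pair, sub_mul, Finset.sum_sub_distrib]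

theorem pair_add_right (a b w : RSp n) : pair w (a + b) = pair w a + pair w b := by
  simp [pair, mul_add, Finset.sum_add_distrib]

theorem pair_sub_right (a b w : RSp n) : pair w (a - b) = pair w a - pair w b := by
  simp [pair, mul_sub, Finset.sum_sub_distrib]

theorem pair_smul_left (c : ℝ) (a w : RSp n) : pair (c • a) w = c * pair a w := by
  simp [pair, Finset.mul_sum, mul_assoc]

theorem pair_smul_right (c : ℝ) (a w : RSp n) : pair w (c • a) = c * pair w a := by
  simp only [pair, Finset.mul_sum, Pi.smul_apply, smul_eq_mul]
  exact Finset.sum_congr rfl fun i _ => by ring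

@[simp] theorem pair_zero_left (w : RSp n) : pair 0 w = 0 := by simp [pair]

@[simp] theorem pair_zero_right (w : RSp n) : pair w 0 = 0 := by simp [pair]

theorem pair_sum_right {ι : Type*} (t : Finset ι) (f : ι → RSp n) (w : RSp n) :
    pair w (∑ i ∈ t, f i) = ∑ i ∈ t, pair w (f i) := by
  classical
  induction t using Finset.induction_on with
  | empty => simp
  | insert a t ha ih => rw [Finset.sum_insert ha, Finset.sum_insert ha, pair_add_right, ih]

theorem pair_sum_left {ι : Type*} (t : Finset ι) (f : ι → RSp n) (w : RSp n) :
    pair (∑ i ∈ t, f i) w = ∑ i ∈ t, pair (f i) w := by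
  classical
  induction t using Finset.induction_on with
  | empty => simp
  | insert a t ha ih => rw [Finset.sum_insert ha, Finset.sum_insert ha, pair_add_left, ih]

theorem continuous_pair (w : RSp n) : Continuous fun X : RSp n => pair w X := by
  unfold pair; fun_prop

theorem pair_toReal_toReal (a b : Lat n) :
    pair (toReal a) (toReal b) = ((∑ i, a i * b i : ℤ) : ℝ) := by
  simp [pair, toReal]

theorem mem_hull_basis_iff {B : Module.Basis (Fin (n + 1)) ℤ (Lat n)} {s : Set (Fin (n + 1))}
    {w : RSp n} : w ∈ PointedCone.hull ℝ ((fun i => toReal (B i)) '' s) ↔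
      ∃ a : Fin (n + 1) → ℝ, (∀ i, 0 ≤ a i) ∧ (∀ i, i ∉ s → a i = 0) ∧
        w = ∑ i, a i • toReal (B i) := by
  classical
  constructor
  · intro h
    induction h using Submodule.span_induction with
    | mem x hx =>
      obtain ⟨i, hi, rfl⟩ := hx
      refine ⟨Pi.single i 1, fun j => ?_, fun j hj => ?_, ?_⟩
      · by_cases h : j = i
        · subst h; simp
        · simp [h]
      · have : j ≠ i := fun h => hj (h ▸ hi)
        simp [this]
      · simp [Pi.single_apply]
    | zero => exact ⟨0, by simp, by simp, by simp⟩
    | add x y _ _ hx hy =>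
      obtain ⟨a, ha, ha', rfl⟩ := hx
      obtain ⟨b, hb, hb', rfl⟩ := hy
      refine ⟨a + b, fun i => add_nonneg (ha i) (hb i), fun i hi => ?_, ?_⟩
      · simp [ha' i hi, hb' i hi]
      · simp [add_smul, Finset.sum_add_distrib]
    | smul c x _ hx =>
      obtain ⟨a, ha, ha', rfl⟩ := hx
      refine ⟨fun i => (c : ℝ) * a i, fun i => mul_nonneg c.2 (ha i), fun i hi => ?_, ?_⟩
      · simp [ha' i hi]
      · rw [Finset.smul_sum]
        refine Finset.sum_congr rfl fun i _ => ?_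
        rw [mul_smul]; rfl
  · rintro ⟨a, ha, ha', rfl⟩
    refine Submodule.sum_mem _ fun i _ => ?_
    by_cases hi : i ∈ s
    · exact PointedCone.smul_mem _ (ha i) (Submodule.subset_span ⟨i, hi, rfl⟩)
    · rw [ha' i hi, zero_smul]; exact Submodule.zero_mem _

theorem exists_pair_basis_eq (B : Module.Basis (Fin (n + 1)) ℤ (Lat n)) (f : Fin (n + 1) → ℤ) :
    ∃ m : Lat n, ∀ i, pair (toReal m) (toReal (B i)) = f i := by
  classical
  let L : Lat n →ₗ[ℤ] ℤ := B.constr ℤ f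
  refine ⟨fun j => L (Pi.single j 1), fun i => ?_⟩
  rw [pair_toReal_toReal]
  congr 1
  have h1 : L (B i) = f i := by simp [L]
  rw [← h1]
  conv_rhs => rw [← Finset.univ_sum_single (B i)]
  rw [map_sum]
  refine Finset.sum_congr rfl fun j _ => ?_
  have : (Pi.single j (B i j) : Lat n) = (B i j) • Pi.single j 1 := by
    ext k; simp [Pi.single_apply]
  rw [this, map_smul, smul_eq_mul, mul_comm]

theorem perp_subset_dualMonoid {σ : PointedCone ℝ (RSp n)} {m : Lat n} (h : m ∈ perp σ) :
    m ∈ dualMonoid σ := fun w hw => (h w hw).ge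

theorem perp_anti {σ τ : PointedCone ℝ (RSp n)} (h : σ ≤ τ) {m : Lat n} (hm : m ∈ perp τ) :
    m ∈ perp σ := fun w hw => hm w (h hw)

theorem zero_mem_perp (σ : PointedCone ℝ (RSp n)) : (0 : Lat n) ∈ perp σ := by
  intro w _; simp

theorem add_mem_perp {σ : PointedCone ℝ (RSp n)} {a b : Lat n} (ha : a ∈ perp σ)
    (hb : b ∈ perp σ) : a + b ∈ perp σ := by
  intro w hw; rw [toReal_add, pair_add_left, ha w hw, hb w hw, add_zero]

theorem sub_mem_perp {σ : PointedCone ℝ (RSp n)} {a b : Lat n} (ha : a ∈ perp σ)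
    (hb : b ∈ perp σ) : a - b ∈ perp σ := by
  intro w hw; rw [toReal_sub, pair_sub_left, ha w hw, hb w hw, sub_zero]

theorem nsmul_mem_perp {σ : PointedCone ℝ (RSp n)} (k : ℕ) {a : Lat n} (ha : a ∈ perp σ) :
    k • a ∈ perp σ := by
  intro w hw; rw [toReal_nsmul, pair_smul_left, ha w hw, mul_zero]

/-- An element of the dual monoid that is orthogonal to `σ` after adding another element of the
dual monoid is itself orthogonal to `σ`. -/
theorem add_mem_perp_iff {σ : PointedCone ℝ (RSp n)} {a b : Lat n} (ha : a ∈ dualMonoid σ)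
    (hb : b ∈ dualMonoid σ) : a + b ∈ perp σ ↔ a ∈ perp σ ∧ b ∈ perp σ := by
  refine ⟨fun h => ⟨fun w hw => ?_, fun w hw => ?_⟩, fun h => add_mem_perp h.1 h.2⟩ <;>
  · have h1 := h w hw
    have h2 := ha w hw
    have h3 := hb w hw
    rw [toReal_add, pair_add_left] at h1
    linarith

theorem mem_dualMonoid_hull {B : Module.Basis (Fin (n + 1)) ℤ (Lat n)} {s : Set (Fin (n + 1))}
    {m : Lat n} : m ∈ dualMonoid (PointedCone.hull ℝ ((fun i => toReal (B i)) '' s)) ↔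
      ∀ i ∈ s, 0 ≤ pair (toReal m) (toReal (B i)) := by
  refine ⟨fun h i hi => h _ (Submodule.subset_span ⟨i, hi, rfl⟩), fun h w hw => ?_⟩
  obtain ⟨a, ha, ha', rfl⟩ := mem_hull_basis_iff.1 hw
  rw [pair_sum_right]
  refine Finset.sum_nonneg fun i _ => ?_
  rw [pair_smul_right]
  by_cases hi : i ∈ s
  · exact mul_nonneg (ha i) (h i hi)
  · simp [ha' i hi]

theorem mem_perp_hull {B : Module.Basis (Fin (n + 1)) ℤ (Lat n)} {s : Set (Fin (n + 1))}
    {m : Lat n} : m ∈ perp (PointedCone.hull ℝ ((fun i => toReal (B i)) '' s)) ↔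
      ∀ i ∈ s, pair (toReal m) (toReal (B i)) = 0 := by
  refine ⟨fun h i hi => h _ (Submodule.subset_span ⟨i, hi, rfl⟩), fun h w hw => ?_⟩
  obtain ⟨a, ha, ha', rfl⟩ := mem_hull_basis_iff.1 hw
  rw [pair_sum_right]
  refine Finset.sum_eq_zero fun i _ => ?_
  rw [pair_smul_right]
  by_cases hi : i ∈ s
  · rw [h i hi, mul_zero]
  · simp [ha' i hi]

/-- A face of a unimodular cone is cut out by an element `p` of the dual monoid, and inverting `p`
turns the dual monoid of the cone into that of the face. -/
theorem exists_separator {𝓕 : Fan n} (hunim : 𝓕.IsUnimodular) {σ τ : PointedCone ℝ (RSp n)}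
    (hσ : σ ∈ 𝓕.cones) (h : τ.IsFaceOf σ) :
    ∃ p ∈ dualMonoid σ, p ∈ perp τ ∧ (∀ w ∈ σ, pair (toReal p) w = 0 → w ∈ τ) ∧
      ∀ m ∈ dualMonoid τ, ∃ k : ℕ, m + k • p ∈ dualMonoid σ := by
  classical
  obtain ⟨B, s, rfl⟩ := hunim σ hσ
  obtain ⟨p, hp⟩ := exists_pair_basis_eq B (fun i => if toReal (B i) ∈ τ then 0 else 1)
  have hB : ∀ i ∈ s, toReal (B i) ∈ PointedCone.hull ℝ ((fun i => toReal (B i)) '' s) :=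
    fun i hi => Submodule.subset_span ⟨i, hi, rfl⟩
  have hp0 : ∀ i, 0 ≤ pair (toReal p) (toReal (B i)) := by
    intro i; rw [hp i]; split_ifs <;> simp
  -- a generator that occurs with positive coefficient in an element of the face lies in the face
  have key : ∀ a : Fin (n + 1) → ℝ, (∀ i, 0 ≤ a i) → (∀ i, i ∉ s → a i = 0) →
      ∑ i, a i • toReal (B i) ∈ τ → ∀ i, a i ≠ 0 → toReal (B i) ∈ τ := by
    intro a ha ha' hw i hi
    have his : i ∈ s := by by_contra hc; exact hi (ha' i hc)
    rw [← Finset.add_sum_erase _ _ (Finset.mem_univ i)] at hw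
    refine h.mem_of_smul_add_mem (hB i his) ?_ (lt_of_le_of_ne (ha i) (Ne.symm hi)) hw
    refine Submodule.sum_mem _ fun j _ => ?_
    by_cases hj : j ∈ s
    · exact PointedCone.smul_mem _ (ha j) (hB j hj)
    · rw [ha' j hj, zero_smul]; exact Submodule.zero_mem _
  refine ⟨p, mem_dualMonoid_hull.2 fun i _ => hp0 i, ?_, ?_, ?_⟩
  · intro w hw
    obtain ⟨a, ha, ha', rfl⟩ := mem_hull_basis_iff.1 (h.le hw)
    rw [pair_sum_right]
    refine Finset.sum_eq_zero fun i _ => ?_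
    rw [pair_smul_right, hp i]
    by_cases h0 : a i = 0
    · simp [h0]
    · simp [key a ha ha' hw i h0]
  · intro w hw hpw
    obtain ⟨a, ha, ha', rfl⟩ := mem_hull_basis_iff.1 hw
    rw [pair_sum_right, Finset.sum_eq_zero_iff_of_nonneg
      (fun i _ => by rw [pair_smul_right]; exact mul_nonneg (ha i) (hp0 i))] at hpw
    refine Submodule.sum_mem _ fun i _ => ?_
    have h1 := hpw i (Finset.mem_univ i)
    rw [pair_smul_right, hp i] at h1
    by_cases hi : toReal (B i) ∈ τ
    · exact PointedCone.smul_mem _ (ha i) hi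
    · have : a i = 0 := by simpa [hi] using h1
      rw [this, zero_smul]; exact Submodule.zero_mem _
  · intro m hm
    obtain ⟨k, hk⟩ := exists_nat_ge (∑ i, |pair (toReal m) (toReal (B i))|)
    refine ⟨k, mem_dualMonoid_hull.2 fun i _ => ?_⟩
    rw [toReal_add, pair_add_left, toReal_nsmul, pair_smul_left]
    by_cases hi : toReal (B i) ∈ τ
    · exact add_nonneg (hm _ hi) (mul_nonneg (Nat.cast_nonneg k) (hp0 i))
    · have h1 : |pair (toReal m) (toReal (B i))| ≤ k :=
        (Finset.single_le_sum (f := fun i => |pair (toReal m) (toReal (B i))|)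
          (fun j _ => abs_nonneg _) (Finset.mem_univ i)).trans hk
      rw [hp i, if_neg hi, Int.cast_one, mul_one]
      linarith [(abs_le.1 h1).1]

/-- A vector in the relative interior of a unimodular cone. -/
theorem exists_interior_vector {𝓕 : Fan n} (hunim : 𝓕.IsUnimodular) {σ : PointedCone ℝ (RSp n)}
    (hσ : σ ∈ 𝓕.cones) :
    ∃ w ∈ σ, ∀ m ∈ dualMonoid σ, m ∉ perp σ → 0 < pair (toReal m) w := by
  classical
  obtain ⟨B, s, rfl⟩ := hunim σ hσ
  refine ⟨∑ i, if i ∈ s then toReal (B i) else 0, Submodule.sum_mem _ fun i _ => ?_, ?_⟩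
  · split_ifs with hi
    · exact Submodule.subset_span ⟨i, hi, rfl⟩
    · exact Submodule.zero_mem _
  · intro m hm hmp
    rw [mem_dualMonoid_hull] at hm
    rw [mem_perp_hull] at hmp
    push Not at hmp
    obtain ⟨i, hi, hne⟩ := hmp
    rw [pair_sum_right]
    refine Finset.sum_pos' (fun j _ => ?_) ⟨i, Finset.mem_univ i, ?_⟩
    · split_ifs with hj
      · exact hm j hj
      · simp
    · rw [if_pos hi]; exact lt_of_le_of_ne (hm i hi) (Ne.symm hne)

/-- The lattice `σ^⊥ ∩ M` of a unimodular cone is a direct summand of `M`. -/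
theorem exists_projection_perp {𝓕 : Fan n} (hunim : 𝓕.IsUnimodular) {σ : PointedCone ℝ (RSp n)}
    (hσ : σ ∈ 𝓕.cones) :
    ∃ f : Lat n →+ Lat n, (∀ m, f m ∈ perp σ) ∧ ∀ m ∈ perp σ, f m = m := by
  classical
  obtain ⟨B, s, rfl⟩ := hunim σ hσ
  -- subtract the components along the dual basis of the generators of the cone
  choose d hd using fun j : Fin (n + 1) => exists_pair_basis_eq B (fun i => if i = j then 1 else 0)
  let g : Lat n → Lat n := fun m =>
    m - ∑ j, (if j ∈ s then ∑ i, m i * B j i else 0) • d j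
  have hg : ∀ a b, g (a + b) = g a + g b := by
    intro a b
    have : ∀ j, (if j ∈ s then ∑ i, (a + b) i * B j i else 0) =
        (if j ∈ s then ∑ i, a i * B j i else 0) + (if j ∈ s then ∑ i, b i * B j i else 0) := by
      intro j
      split_ifs
      · simp [add_mul, Finset.sum_add_distrib]
      · simp
    simp only [g, this, add_smul, Finset.sum_add_distrib]
    abel
  refine ⟨AddMonoidHom.mk' g hg, fun m => ?_, fun m hm => ?_⟩
  · rw [mem_perp_hull]
    intro i hi
    have hz : ∀ (z : ℤ) (a : Lat n), toReal (z • a) = (z : ℝ) • toReal a := by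
      intro z a; ext i; simp [toReal]
    change pair (toReal (m - _)) _ = 0
    rw [toReal_sub, pair_sub_left, toReal_sum, pair_sum_left, Finset.sum_eq_single i]
    · rw [hz, pair_smul_left, hd i i, if_pos hi, if_pos rfl, pair_toReal_toReal]
      simp
    · intro j _ hji
      rw [hz, pair_smul_left, hd j i, if_neg (Ne.symm hji)]
      simp
    · simp
  · rw [mem_perp_hull] at hm
    have : ∀ j, (if j ∈ s then ∑ i, m i * B j i else 0) = 0 := by
      intro j
      split_ifs with hj
      · have := hm j hj
        rw [pair_toReal_toReal] at this
        exact_mod_cast this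
      · rfl
    change m - _ = m
    simp [this]

/-- Any additive function on `σ^⊥ ∩ M` is the pairing with a real vector. -/
theorem exists_pair_eq_on_perp {𝓕 : Fan n} (hunim : 𝓕.IsUnimodular) {σ : PointedCone ℝ (RSp n)}
    (hσ : σ ∈ 𝓕.cones) (g : Lat n → ℝ)
    (hg : ∀ a ∈ perp σ, ∀ b ∈ perp σ, g (a + b) = g a + g b) :
    ∃ X : RSp n, ∀ m ∈ perp σ, pair (toReal m) X = g m := by
  classical
  obtain ⟨f, hf, hf'⟩ := exists_projection_perp hunim hσ
  let G : Lat n →+ ℝ := AddMonoidHom.mk' (fun m => g (f m)) fun a b => by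
    rw [map_add, hg _ (hf a) _ (hf b)]
  refine ⟨fun j => G (Pi.single j 1), fun m hm => ?_⟩
  have h1 : G m = g m := by simp [G, hf' m hm]
  rw [← h1]
  conv_rhs => rw [← Finset.univ_sum_single m]
  rw [map_sum]
  refine Finset.sum_congr rfl fun j _ => ?_
  have : (Pi.single j (m j) : Lat n) = (m j) • Pi.single j 1 := by
    ext k; simp [Pi.single_apply]
  rw [this, map_zsmul, zsmul_eq_mul]
  rfl

/-- The face of a unimodular cone on which a submonoid `U` of the dual monoid vanishes: some element
of `U` dominates every element of the dual monoid that vanishes on this face. -/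
theorem exists_dominating {𝓕 : Fan n} (hunim : 𝓕.IsUnimodular) {σ : PointedCone ℝ (RSp n)}
    (hσ : σ ∈ 𝓕.cones) (U : AddSubmonoid (Lat n)) (hU : U ≤ dualMonoid σ) :
    ∃ b ∈ U, ∀ m : Lat n, (∀ w ∈ σ, (∀ a ∈ U, pair (toReal a) w = 0) → pair (toReal m) w = 0) →
      ∃ k : ℕ, k • b - m ∈ dualMonoid σ := by
  classical
  obtain ⟨B, s, rfl⟩ := hunim σ hσ
  have hB : ∀ i ∈ s, toReal (B i) ∈ PointedCone.hull ℝ ((fun i => toReal (B i)) '' s) :=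
    fun i hi => Submodule.subset_span ⟨i, hi, rfl⟩
  -- add up elements of `U`, one for each generator on which `U` does not vanish
  have h1 : ∀ i, ∃ a ∈ U, (i ∈ s → (∃ a ∈ U, pair (toReal a) (toReal (B i)) ≠ 0) →
      pair (toReal a) (toReal (B i)) ≠ 0) := by
    intro i
    by_cases h : ∃ a ∈ U, pair (toReal a) (toReal (B i)) ≠ 0
    · obtain ⟨a, ha, ha'⟩ := h
      exact ⟨a, ha, fun _ _ => ha'⟩
    · exact ⟨0, U.zero_mem, fun _ h' => absurd h' h⟩
  choose a haU ha using h1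
  refine ⟨∑ i, a i, sum_mem fun i _ => haU i, fun m hm => ?_⟩
  obtain ⟨k, hk⟩ := exists_nat_ge (∑ i, |pair (toReal m) (toReal (B i))|)
  refine ⟨k, mem_dualMonoid_hull.2 fun i hi => ?_⟩
  have h1 : |pair (toReal m) (toReal (B i))| ≤ k :=
    (Finset.single_le_sum (f := fun i => |pair (toReal m) (toReal (B i))|)
      (fun j _ => abs_nonneg _) (Finset.mem_univ i)).trans hk
  rw [toReal_sub, pair_sub_left, toReal_nsmul, pair_smul_left, toReal_sum, pair_sum_left]
  have hnn : ∀ j, 0 ≤ pair (toReal (a j)) (toReal (B i)) := fun j => hU (haU j) _ (hB i hi)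
  by_cases h : ∃ a ∈ U, pair (toReal a) (toReal (B i)) ≠ 0
  · have hne := ha i hi h
    have hge : (1 : ℝ) ≤ pair (toReal (a i)) (toReal (B i)) := by
      have hpos := lt_of_le_of_ne (hnn i) (Ne.symm hne)
      rw [pair_toReal_toReal] at hpos ⊢
      exact_mod_cast (by exact_mod_cast hpos : (0 : ℤ) < _)
    have h2 : (1 : ℝ) ≤ ∑ j, pair (toReal (a j)) (toReal (B i)) :=
      hge.trans (Finset.single_le_sum (fun j _ => hnn j) (Finset.mem_univ i))
    have h3 : (k : ℝ) * 1 ≤ k * ∑ j, pair (toReal (a j)) (toReal (B i)) :=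
      mul_le_mul_of_nonneg_left h2 (Nat.cast_nonneg k)
    linarith [(abs_le.1 h1).2]
  · push Not at h
    rw [hm _ (hB i hi) h, sub_zero]
    exact mul_nonneg (Nat.cast_nonneg k) (Finset.sum_nonneg fun j _ => hnn j)

end

/-! ### The tropical numbers as non-negative reals -/

section

/-- The exponential `𝕋 → [0, ∞)`, `-∞ ↦ 0`, an isomorphism of topological monoids onto the
multiplicative monoid `[0, ∞)`. -/
def texp (a : TT) : ℝ := WithBot.recBotCoe (C := fun _ => ℝ) 0 Real.exp (Multiplicative.toAdd a)

@[simp] theorem texp_bot : texp (Multiplicative.ofAdd ⊥) = 0 := rfl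

@[simp] theorem texp_coe (r : ℝ) : texp (Multiplicative.ofAdd (r : WithBot ℝ)) = Real.exp r := rfl

@[simp] theorem texp_one : texp 1 = 1 := by
  change texp (Multiplicative.ofAdd ((0 : ℝ) : WithBot ℝ)) = 1
  rw [texp_coe, Real.exp_zero]

theorem TT.cases (a : TT) :
    a = Multiplicative.ofAdd ⊥ ∨ ∃ r : ℝ, a = Multiplicative.ofAdd (r : WithBot ℝ) := by
  induction a using Multiplicative.rec with
  | ofAdd a =>
  induction a using WithBot.recBotCoe with
  | bot => exact Or.inl rfl
  | coe r => exact Or.inr ⟨r, rfl⟩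

theorem texp_nonneg (a : TT) : 0 ≤ texp a := by
  rcases TT.cases a with rfl | ⟨r, rfl⟩
  · exact le_rfl
  · exact (Real.exp_pos r).le

theorem texp_mul (a b : TT) : texp (a * b) = texp a * texp b := by
  rcases TT.cases a with rfl | ⟨r, rfl⟩
  · rw [← ofAdd_toAdd b, ← ofAdd_add, WithBot.bot_add, texp_bot, zero_mul]
  rcases TT.cases b with rfl | ⟨s, rfl⟩
  · rw [← ofAdd_add, WithBot.add_bot, texp_bot, mul_zero]
  · rw [← ofAdd_add, ← WithBot.coe_add, texp_coe, texp_coe, texp_coe, Real.exp_add]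

theorem isUnit_iff_texp_ne_zero (a : TT) : IsUnit a ↔ texp a ≠ 0 := by
  constructor
  · rintro h h0
    obtain ⟨b, hb⟩ := h.exists_right_inv
    have := congrArg texp hb
    rw [texp_mul, h0, texp_one] at this
    simp at this
  · intro h
    rcases TT.cases a with rfl | ⟨r, rfl⟩
    · exact absurd rfl h
    · refine IsUnit.of_mul_eq_one (Multiplicative.ofAdd ((-r : ℝ) : WithBot ℝ)) ?_
      rw [← ofAdd_add, ← WithBot.coe_add, add_neg_cancel]; rfl

theorem texp_isEmbedding : Topology.IsEmbedding texp := by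
  have h : Topology.IsEmbedding (WithBot.recBotCoe (C := fun _ => ℝ) 0 Real.exp) := by
    refine StrictMono.isEmbedding_of_ordConnected ?_ ?_
    · intro a b hab
      induction b using WithBot.recBotCoe with
      | bot => exact absurd hab not_lt_bot
      | coe s =>
        induction a using WithBot.recBotCoe with
        | bot => exact Real.exp_pos s
        | coe r => exact Real.exp_lt_exp.2 (WithBot.coe_lt_coe.1 hab)
    · have : Set.range (WithBot.recBotCoe (C := fun _ => ℝ) 0 Real.exp) = Set.Ici 0 := by
        ext y
        constructor
        · rintro ⟨a, rfl⟩
          exact texp_nonneg (Multiplicative.ofAdd a)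
        · intro hy
          rcases (Set.mem_Ici.1 hy).eq_or_lt with rfl | hy
          · exact ⟨⊥, rfl⟩
          · exact ⟨((Real.log y : ℝ) : WithBot ℝ), Real.exp_log hy⟩
      rw [this]
      exact Set.ordConnected_Ici
  exact h

theorem texp_injective : Function.Injective texp := texp_isEmbedding.injective

theorem continuous_texp : Continuous texp := texp_isEmbedding.continuous

/-- The inverse of `texp` on `[0, ∞)`. -/
def tlog (r : ℝ) : TT :=
  if r = 0 then Multiplicative.ofAdd ⊥ else Multiplicative.ofAdd ((Real.log r : ℝ) : WithBot ℝ)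

theorem texp_tlog {r : ℝ} (hr : 0 ≤ r) : texp (tlog r) = r := by
  unfold tlog
  split_ifs with h
  · rw [h]; rfl
  · rw [texp_coe, Real.exp_log (lt_of_le_of_ne hr (Ne.symm h))]

/-! ### Values of a point of an affine tropical toric variety -/

variable {n : ℕ} {𝓕 : Fan n} {σ τ : PointedCone ℝ (RSp n)}

theorem Fan.isFaceOf_of_le (hσ : σ ∈ 𝓕.cones) (hτ : τ ∈ 𝓕.cones) (h : σ ≤ τ) :
    σ.IsFaceOf τ := by
  have := (𝓕.inter_face σ hσ τ hτ).2
  rwa [inf_eq_left.2 h] at this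

/-- The value of `u ∈ U_σ(𝕋)` at `m`, as a non-negative real number. -/
def tval (u : Chart σ TT) (m : dualMonoid σ) : ℝ := texp (u.1 m)

theorem tval_nonneg (u : Chart σ TT) (m : dualMonoid σ) : 0 ≤ tval u m := texp_nonneg _

theorem tval_zero (u : Chart σ TT) : tval u 0 = 1 := by
  rw [tval, u.2.1, texp_one]

theorem tval_add (u : Chart σ TT) (a b : dualMonoid σ) :
    tval u (a + b) = tval u a * tval u b := by
  rw [tval, u.2.2, texp_mul]; rfl

theorem tval_nsmul (u : Chart σ TT) (k : ℕ) (a : dualMonoid σ) :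
    tval u (k • a) = tval u a ^ k := by
  induction k with
  | zero => rw [zero_smul, tval_zero, pow_zero]
  | succ k ih => rw [succ_nsmul, tval_add, ih, pow_succ]

theorem continuous_tval (m : dualMonoid σ) : Continuous fun u : Chart σ TT => tval u m :=
  continuous_texp.comp ((continuous_apply m).comp continuous_subtype_val)

theorem tval_ne_zero_of_mem_perp (u : Chart σ TT) (m : dualMonoid σ)
    (h : (m : Lat n) ∈ perp σ) : tval u m ≠ 0 := by
  have hneg : -(m : Lat n) ∈ dualMonoid σ := by
    have := sub_mem_perp (zero_mem_perp σ) h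
    rw [zero_sub] at this
    exact perp_subset_dualMonoid this
  intro h0
  have h1 : m + ⟨-(m : Lat n), hneg⟩ = 0 := Subtype.ext (by simp)
  have h2 := tval_add u m ⟨-(m : Lat n), hneg⟩
  rw [h1, tval_zero, h0, zero_mul] at h2
  exact one_ne_zero h2

/-- The elements of `σ^∨ ∩ M` at which `u` does not take the value `-∞`. -/
def finiteSubmonoid (u : Chart σ TT) : AddSubmonoid (Lat n) where
  carrier := {m | ∃ h : m ∈ dualMonoid σ, tval u ⟨m, h⟩ ≠ 0}
  zero_mem' := ⟨(dualMonoid σ).zero_mem, tval_ne_zero_of_mem_perp u _ (zero_mem_perp σ)⟩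
  add_mem' := by
    rintro a b ⟨ha, ha'⟩ ⟨hb, hb'⟩
    refine ⟨(dualMonoid σ).add_mem ha hb, ?_⟩
    have := tval_add u ⟨a, ha⟩ ⟨b, hb⟩
    rw [AddMemClass.mk_add_mk] at this
    rw [this]
    exact mul_ne_zero ha' hb'

/-- The face `τ` of `σ` for which `u ∈ U_σ(𝕋)` lies in the orbit `O_τ(𝕋)`. -/
def typCone (u : Chart σ TT) : PointedCone ℝ (RSp n) where
  carrier := {w | w ∈ σ ∧ ∀ m : dualMonoid σ, tval u m ≠ 0 → pair (toReal m) w = 0}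
  add_mem' := by
    rintro a b ⟨ha, ha'⟩ ⟨hb, hb'⟩
    refine ⟨σ.add_mem ha hb, fun m hm => ?_⟩
    rw [pair_add_right, ha' m hm, hb' m hm, add_zero]
  zero_mem' := ⟨σ.zero_mem, fun m _ => by simp⟩
  smul_mem' := by
    rintro c a ⟨ha, ha'⟩
    refine ⟨Submodule.smul_mem σ c ha, fun m hm => ?_⟩
    have : pair (toReal (m : Lat n)) (c • a) = c * pair (toReal (m : Lat n)) a :=
      pair_smul_right _ _ _
    rw [this, ha' m hm, mul_zero]

theorem typCone_isFaceOf (u : Chart σ TT) : (typCone u).IsFaceOf σ := by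
  refine ⟨fun w hw => hw.1, ?_⟩
  rintro x y a hx hy ha ⟨h, h'⟩
  refine ⟨hx, fun m hm => ?_⟩
  have h1 := h' m hm
  rw [pair_add_right, pair_smul_right] at h1
  have h2 := m.2 x hx
  have h3 := m.2 y hy
  have h4 : 0 ≤ a * pair (toReal (m : Lat n)) x := mul_nonneg ha.le h2
  have h5 : a * pair (toReal (m : Lat n)) x = 0 := by linarith
  exact (mul_eq_zero.1 h5).resolve_left ha.ne'

variable [hU : Fact 𝓕.IsUnimodular]

/-- The finiteness locus of `u` is all of `τ^⊥ ∩ σ^∨ ∩ M`, not just a submonoid of it: an element of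
`τ^⊥` is a summand of a multiple of an element at which `u` is finite. -/
theorem tval_ne_zero_iff (hσ : σ ∈ 𝓕.cones) (u : Chart σ TT) (m : dualMonoid σ) :
    tval u m ≠ 0 ↔ (m : Lat n) ∈ perp (typCone u) := by
  refine ⟨fun h w hw => hw.2 m h, fun h => ?_⟩
  obtain ⟨b, ⟨hb, hb'⟩, hk⟩ := exists_dominating hU.out hσ (finiteSubmonoid u) fun _ h => h.1
  obtain ⟨k, hk⟩ := hk m fun w hw hw' => h w ⟨hw, fun a ha => hw' a ⟨a.2, ha⟩⟩
  have h1 : k • (⟨b, hb⟩ : dualMonoid σ) = ⟨_, hk⟩ + m := Subtype.ext (by simp)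
  have h2 := tval_nsmul u k ⟨b, hb⟩
  rw [h1, tval_add] at h2
  intro h0
  rw [h0, mul_zero] at h2
  exact pow_ne_zero k hb' h2.symm

open Classical in
/-- The extension of the values of `u ∈ U_σ(𝕋)` to all of `M`: it is multiplicative on the lattice
`τ^⊥ ∩ M` for the face `τ` with `u ∈ O_τ(𝕋)`, and zero elsewhere. -/
def evChart (u : Chart σ TT) (m : Lat n) : ℝ :=
  if h : ∃ a b : dualMonoid σ, m = a - b ∧ tval u a ≠ 0 ∧ tval u b ≠ 0 then
    tval u h.choose / tval u h.choose_spec.choose else 0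

omit hU in
theorem evChart_sub (u : Chart σ TT) (a b : dualMonoid σ) (ha : tval u a ≠ 0)
    (hb : tval u b ≠ 0) : evChart u ((a : Lat n) - b) = tval u a / tval u b := by
  have h : ∃ a' b' : dualMonoid σ, (a : Lat n) - b = a' - b' ∧ tval u a' ≠ 0 ∧ tval u b' ≠ 0 :=
    ⟨a, b, rfl, ha, hb⟩
  rw [evChart, dif_pos h]
  obtain ⟨h1, h2, h3⟩ := h.choose_spec.choose_spec
  rw [div_eq_div_iff h3 hb, ← tval_add, ← tval_add]
  congr 1
  apply Subtype.ext
  change (h.choose : Lat n) + b = a + h.choose_spec.choose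
  have h4 := h1
  rw [sub_eq_sub_iff_add_eq_add] at h4
  rw [h4]

omit hU in
theorem evChart_coe (u : Chart σ TT) (m : dualMonoid σ) : evChart u m = tval u m := by
  by_cases h : tval u m = 0
  · rw [h, evChart, dif_neg]
    rintro ⟨a, b, h1, h2, -⟩
    have h3 : a = m + b := Subtype.ext (by rw [AddSubmonoid.coe_add, h1]; simp)
    rw [h3, tval_add, h, zero_mul] at h2
    exact h2 rfl
  · have := evChart_sub u m 0 h (by rw [tval_zero]; exact one_ne_zero)
    rwa [tval_zero, div_one, ZeroMemClass.coe_zero, sub_zero] at this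

/-- The elements of `σ^∨ ∩ M` at which `u` is finite generate the lattice `τ^⊥ ∩ M`, for the face
`τ` with `u ∈ O_τ(𝕋)`. -/
theorem exists_sub_of_mem_perp (hσ : σ ∈ 𝓕.cones) (u : Chart σ TT) {m : Lat n}
    (hm : m ∈ perp (typCone u)) :
    ∃ a b : dualMonoid σ, m = a - b ∧ tval u a ≠ 0 ∧ tval u b ≠ 0 := by
  obtain ⟨p, hp, hp', -, hpk⟩ := exists_separator hU.out hσ (typCone_isFaceOf u)
  obtain ⟨k, hk⟩ := hpk m (perp_subset_dualMonoid hm)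
  refine ⟨⟨_, hk⟩, ⟨k • p, (dualMonoid σ).nsmul_mem hp k⟩, by simp, ?_, ?_⟩
  · exact (tval_ne_zero_iff hσ u _).2 (add_mem_perp hm (nsmul_mem_perp k hp'))
  · exact (tval_ne_zero_iff hσ u _).2 (nsmul_mem_perp k hp')

theorem evChart_ne_zero_iff (hσ : σ ∈ 𝓕.cones) (u : Chart σ TT) (m : Lat n) :
    evChart u m ≠ 0 ↔ m ∈ perp (typCone u) := by
  constructor
  · intro h
    by_cases h' : ∃ a b : dualMonoid σ, m = a - b ∧ tval u a ≠ 0 ∧ tval u b ≠ 0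
    · obtain ⟨a, b, rfl, ha, hb⟩ := h'
      exact sub_mem_perp ((tval_ne_zero_iff hσ u a).1 ha) ((tval_ne_zero_iff hσ u b).1 hb)
    · rw [evChart, dif_neg h'] at h
      exact absurd rfl h
  · intro h
    obtain ⟨a, b, rfl, ha, hb⟩ := exists_sub_of_mem_perp hσ u h
    rw [evChart_sub u a b ha hb]
    exact div_ne_zero ha hb

omit hU in
theorem evChart_nonneg (u : Chart σ TT) (m : Lat n) : 0 ≤ evChart u m := by
  unfold evChart
  split_ifs
  · exact div_nonneg (tval_nonneg _ _) (tval_nonneg _ _)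
  · exact le_rfl

theorem evChart_add (hσ : σ ∈ 𝓕.cones) (u : Chart σ TT) {m m' : Lat n}
    (hm : m ∈ perp (typCone u)) (hm' : m' ∈ perp (typCone u)) :
    evChart u (m + m') = evChart u m * evChart u m' := by
  obtain ⟨a, b, rfl, ha, hb⟩ := exists_sub_of_mem_perp hσ u hm
  obtain ⟨a', b', rfl, ha', hb'⟩ := exists_sub_of_mem_perp hσ u hm'
  have h1 : ((a : Lat n) - b) + (a' - b') = ((a + a' : dualMonoid σ) : Lat n) -
      ((b + b' : dualMonoid σ) : Lat n) := by
    rw [AddSubmonoid.coe_add, AddSubmonoid.coe_add]; abel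
  rw [h1, evChart_sub u a b ha hb, evChart_sub u a' b' ha' hb', evChart_sub, tval_add, tval_add,
    div_mul_div_comm]
  · rw [tval_add]; exact mul_ne_zero ha ha'
  · rw [tval_add]; exact mul_ne_zero hb hb'

/-- The extended values do not depend on the chart, as both numerator and denominator can be moved
to the larger chart by adding a multiple of a separating element. -/
theorem evChart_restrict (hσ : σ ∈ 𝓕.cones) (h : τ.IsFaceOf σ) (u : Chart τ TT) :
    evChart (Chart.restrict h.le u) = evChart u := by
  funext m
  obtain ⟨p, hp, hp', -, hpk⟩ := exists_separator hU.out hσ h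
  by_cases h' : ∃ a b : dualMonoid τ, m = a - b ∧ tval u a ≠ 0 ∧ tval u b ≠ 0
  · obtain ⟨a, b, rfl, ha, hb⟩ := h'
    obtain ⟨k, hk⟩ := hpk a a.2
    obtain ⟨l, hl⟩ := hpk b b.2
    have hpt : p ∈ dualMonoid τ := perp_subset_dualMonoid hp'
    have ha2 : (a : Lat n) + (k + l) • p ∈ dualMonoid σ := by
      rw [add_smul, ← add_assoc]
      exact (dualMonoid σ).add_mem hk ((dualMonoid σ).nsmul_mem hp l)
    have hb2 : (b : Lat n) + (k + l) • p ∈ dualMonoid σ := by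
      rw [add_comm k l, add_smul, ← add_assoc]
      exact (dualMonoid σ).add_mem hl ((dualMonoid σ).nsmul_mem hp k)
    have hpu : tval u ((k + l) • ⟨p, hpt⟩) ≠ 0 := by
      rw [tval_nsmul]; exact pow_ne_zero _ (tval_ne_zero_of_mem_perp u _ hp')
    have ha3 : tval (Chart.restrict h.le u) ⟨_, ha2⟩ = tval u a * tval u ((k + l) • ⟨p, hpt⟩) := by
      rw [← tval_add]; rfl
    have hb3 : tval (Chart.restrict h.le u) ⟨_, hb2⟩ = tval u b * tval u ((k + l) • ⟨p, hpt⟩) := by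
      rw [← tval_add]; rfl
    have h1 : (a : Lat n) - b = (⟨_, ha2⟩ : dualMonoid σ) - (⟨_, hb2⟩ : dualMonoid σ) := by simp
    conv_lhs => rw [h1]
    rw [evChart_sub u a b ha hb, evChart_sub, ha3, hb3, mul_div_mul_right _ _ hpu]
    · rw [ha3]; exact mul_ne_zero ha hpu
    · rw [hb3]; exact mul_ne_zero hb hpu
  · have h2 : ¬ ∃ a b : dualMonoid σ, m = a - b ∧ tval (Chart.restrict h.le u) a ≠ 0 ∧
        tval (Chart.restrict h.le u) b ≠ 0 := by
      rintro ⟨a, b, h1, ha, hb⟩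
      exact h' ⟨⟨a, dualMonoid_anti h.le a.2⟩, ⟨b, dualMonoid_anti h.le b.2⟩, h1, ha, hb⟩
    rw [evChart, evChart, dif_neg h', dif_neg h2]

theorem typCone_restrict (hσ : σ ∈ 𝓕.cones) (h : τ.IsFaceOf σ) (u : Chart τ TT) :
    typCone (Chart.restrict h.le u) = typCone u := by
  obtain ⟨p, hp, hp', hpτ, hpk⟩ := exists_separator hU.out hσ h
  have hpt : p ∈ dualMonoid τ := perp_subset_dualMonoid hp'
  have hpu : tval u ⟨p, hpt⟩ ≠ 0 := tval_ne_zero_of_mem_perp u _ hp'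
  ext w
  constructor
  · rintro ⟨hw, hw'⟩
    have hpw : pair (toReal p) w = 0 := hw' ⟨p, hp⟩ hpu
    refine ⟨hpτ w hw hpw, fun m hm => ?_⟩
    obtain ⟨k, hk⟩ := hpk m m.2
    have h1 : tval (Chart.restrict h.le u) ⟨_, hk⟩ ≠ 0 := by
      have : tval (Chart.restrict h.le u) ⟨_, hk⟩ = tval u (m + k • ⟨p, hpt⟩) := rfl
      rw [this, tval_add, tval_nsmul]
      exact mul_ne_zero hm (pow_ne_zero _ hpu)
    have h2 := hw' ⟨_, hk⟩ h1
    change pair (toReal ((m : Lat n) + k • p)) w = 0 at h2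
    rwa [toReal_add, pair_add_left, toReal_nsmul, pair_smul_left, hpw, mul_zero, add_zero] at h2
  · rintro ⟨hw, hw'⟩
    exact ⟨h.le hw, fun m hm => hw' ⟨m, dualMonoid_anti h.le m.2⟩ hm⟩

/-! ### Orbit type and values of a point of the tropical toric variety -/

/-- The cone `σ` of the orbit `O_σ(𝕋)` in which a point lies. -/
def typ : ToricVar 𝓕 TT → 𝓕.cones :=
  Quot.lift (fun a => ⟨typCone a.2, 𝓕.face_mem _ a.1.2 _ (typCone_isFaceOf a.2)⟩) (by
    rintro ⟨σ, u⟩ ⟨τ, v⟩ ⟨h₀, e₀⟩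
    have h : (σ : PointedCone ℝ (RSp n)).IsFaceOf τ := h₀
    have e : Chart.restrict h.le u = v := e₀
    clear e₀ h₀
    subst e
    exact Subtype.ext (typCone_restrict τ.2 h u).symm)

/-- The value of a point at an exponent `m`, as a non-negative real number; it is zero for `m`
outside `σ^⊥`, where `σ = typ x`. -/
def ev : ToricVar 𝓕 TT → Lat n → ℝ :=
  Quot.lift (fun a => evChart a.2) (by
    rintro ⟨σ, u⟩ ⟨τ, v⟩ ⟨h₀, e₀⟩
    have h : (σ : PointedCone ℝ (RSp n)).IsFaceOf τ := h₀
    have e : Chart.restrict h.le u = v := e₀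
    clear e₀ h₀
    subst e
    exact (evChart_restrict τ.2 h u).symm)

omit hU in
theorem ToricVar.exists_mk (x : ToricVar 𝓕 TT) : ∃ σ u, x = ToricVar.mk σ u := by
  induction x using Quot.ind with
  | mk a => exact ⟨a.1, a.2, rfl⟩

theorem typ_mk_le (σ : 𝓕.cones) (u : Chart (σ : PointedCone ℝ (RSp n)) TT) :
    typ (ToricVar.mk σ u) ≤ σ := (typCone_isFaceOf u).le

theorem ev_mk (σ : 𝓕.cones) (u : Chart (σ : PointedCone ℝ (RSp n)) TT)
    (m : dualMonoid (σ : PointedCone ℝ (RSp n))) : ev (ToricVar.mk σ u) m = tval u m :=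
  evChart_coe u m

theorem ev_nonneg (x : ToricVar 𝓕 TT) (m : Lat n) : 0 ≤ ev x m := by
  obtain ⟨σ, u, rfl⟩ := x.exists_mk
  exact evChart_nonneg u m

theorem ev_ne_zero_iff (x : ToricVar 𝓕 TT) (m : Lat n) :
    ev x m ≠ 0 ↔ m ∈ perp (typ x : PointedCone ℝ (RSp n)) := by
  obtain ⟨σ, u, rfl⟩ := x.exists_mk
  exact evChart_ne_zero_iff σ.2 u m

theorem ev_pos_iff (x : ToricVar 𝓕 TT) (m : Lat n) :
    0 < ev x m ↔ m ∈ perp (typ x : PointedCone ℝ (RSp n)) := by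
  rw [← ev_ne_zero_iff]
  exact ⟨ne_of_gt, fun h => lt_of_le_of_ne (ev_nonneg x m) (Ne.symm h)⟩

theorem ev_eq_zero (x : ToricVar 𝓕 TT) {m : Lat n}
    (h : m ∉ perp (typ x : PointedCone ℝ (RSp n))) : ev x m = 0 := by
  by_contra h'
  exact h ((ev_ne_zero_iff x m).1 h')

theorem ev_add_of_mem_perp (x : ToricVar 𝓕 TT) {m m' : Lat n}
    (hm : m ∈ perp (typ x : PointedCone ℝ (RSp n)))
    (hm' : m' ∈ perp (typ x : PointedCone ℝ (RSp n))) : ev x (m + m') = ev x m * ev x m' := by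
  obtain ⟨σ, u, rfl⟩ := x.exists_mk
  exact evChart_add σ.2 u hm hm'

theorem ev_add (x : ToricVar 𝓕 TT) {m m' : Lat n}
    (hm : m ∈ dualMonoid (typ x : PointedCone ℝ (RSp n)))
    (hm' : m' ∈ dualMonoid (typ x : PointedCone ℝ (RSp n))) :
    ev x (m + m') = ev x m * ev x m' := by
  by_cases h : m + m' ∈ perp (typ x : PointedCone ℝ (RSp n))
  · obtain ⟨h1, h2⟩ := (add_mem_perp_iff hm hm').1 h
    exact ev_add_of_mem_perp x h1 h2
  · rw [ev_eq_zero x h]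
    rw [add_mem_perp_iff hm hm', not_and_or] at h
    rcases h with h | h <;> simp [ev_eq_zero x h]

theorem ev_zero (x : ToricVar 𝓕 TT) : ev x 0 = 1 := by
  obtain ⟨σ, u, rfl⟩ := x.exists_mk
  have := ev_mk σ u 0
  rwa [tval_zero] at this

/-- A point lies in the chart `U_σ(𝕋)` for every `σ` that contains its type. -/
theorem exists_mk_of_typ_le {x : ToricVar 𝓕 TT} {σ : 𝓕.cones} (h : typ x ≤ σ) :
    ∃ u : Chart (σ : PointedCone ℝ (RSp n)) TT, x = ToricVar.mk σ u := by
  let u₀ : Chart (typ x : PointedCone ℝ (RSp n)) TT :=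
    ⟨fun m => tlog (ev x m), texp_injective (by
      rw [texp_tlog (ev_nonneg _ _), ZeroMemClass.coe_zero, ev_zero, texp_one]), fun a b =>
      texp_injective (by
        rw [texp_mul, texp_tlog (ev_nonneg _ _), texp_tlog (ev_nonneg _ _),
          texp_tlog (ev_nonneg _ _), AddSubmonoid.coe_add, ev_add x a.2 b.2])⟩
  have hx : x = ToricVar.mk (typ x) u₀ := by
    obtain ⟨τ, v, hv⟩ := x.exists_mk
    have hle : typ x ≤ τ := by rw [hv]; exact typ_mk_le τ v
    refine hv.trans (Eq.symm ?_)
    refine (Quot.sound ⟨Fan.isFaceOf_of_le (typ x).2 τ.2 hle, ?_⟩ :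
      ToricVar.mk (typ x) u₀ = ToricVar.mk τ v)
    refine Subtype.ext (funext fun m => texp_injective ?_)
    change texp (tlog (ev x m)) = texp (v.1 m)
    rw [texp_tlog (ev_nonneg _ _), hv, ev_mk]; rfl
  refine ⟨Chart.restrict h u₀, ?_⟩
  refine hx.trans ?_
  exact Quot.sound ⟨Fan.isFaceOf_of_le (typ x).2 σ.2 h, rfl⟩

/-- A point is determined by its orbit and its values. The charts are in particular glued
injectively. -/
theorem ToricVar.ext {x y : ToricVar 𝓕 TT} (h : typ x = typ y)
    (h' : ∀ m ∈ dualMonoid (typ x : PointedCone ℝ (RSp n)), ev x m = ev y m) : x = y := by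
  obtain ⟨u, hu⟩ := exists_mk_of_typ_le (le_refl (typ x))
  obtain ⟨v, hv⟩ := exists_mk_of_typ_le h.ge
  rw [hu, hv]
  congr 1
  refine Subtype.ext (funext fun m => texp_injective ?_)
  change tval u m = tval v m
  rw [← ev_mk, ← ev_mk, ← hu, ← hv]
  exact h' m m.2

theorem mem_orbit_iff {σ : 𝓕.cones} {x : ToricVar 𝓕 TT} : x ∈ orbit 𝓕 TT σ ↔ typ x = σ := by
  constructor
  · rintro ⟨u, hu, rfl⟩
    refine le_antisymm (typ_mk_le σ u) fun w hw => ⟨hw, fun m hm => ?_⟩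
    exact (hu m).1 ((isUnit_iff_texp_ne_zero _).2 hm) w hw
  · rintro rfl
    obtain ⟨u, hu⟩ := exists_mk_of_typ_le (le_refl (typ x))
    refine ⟨u, fun m => ?_, hu⟩
    have h1 : ev x m = texp (u.1 m) := (congrArg (fun y => ev y (m : Lat n)) hu).trans (ev_mk _ u m)
    rw [isUnit_iff_texp_ne_zero, ← ev_ne_zero_iff, h1]

/-! ### Topology of the tropical toric variety -/

omit hU in
theorem continuous_mk (σ : 𝓕.cones) :
    Continuous (ToricVar.mk σ : Chart (σ : PointedCone ℝ (RSp n)) TT → ToricVar 𝓕 TT) :=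
  continuous_quot_mk.comp continuous_sigmaMk

omit hU in
theorem ToricVar.isOpen_iff {s : Set (ToricVar 𝓕 TT)} :
    IsOpen s ↔ ∀ σ : 𝓕.cones, IsOpen (ToricVar.mk σ ⁻¹' s) := by
  refine ⟨fun h σ => h.preimage (continuous_mk σ), fun h => ?_⟩
  have h1 : IsOpen (Quot.mk (glue 𝓕 TT) ⁻¹' s) := isOpen_sigma_iff.2 h
  exact isQuotientMap_quot_mk.isOpen_preimage.1 h1

/-- The intersection of the charts `U_σ(𝕋)` and `U_τ(𝕋)` is the locus in `U_τ(𝕋)` at which a single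
element `p` has a finite value. -/
theorem exists_typ_mk_le_iff (σ τ : 𝓕.cones) :
    ∃ p : dualMonoid (τ : PointedCone ℝ (RSp n)),
      (∀ v : Chart (τ : PointedCone ℝ (RSp n)) TT, typ (ToricVar.mk τ v) ≤ σ ↔ tval v p ≠ 0) ∧
      ∀ m ∈ dualMonoid (σ : PointedCone ℝ (RSp n)), ∃ k : ℕ,
        m + k • (p : Lat n) ∈ dualMonoid (τ : PointedCone ℝ (RSp n)) := by
  obtain ⟨p, hp, hp', hpτ, hpk⟩ :=
    exists_separator hU.out τ.2 (𝓕.inter_face σ σ.2 τ τ.2).2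
  refine ⟨⟨p, hp⟩, fun v => ?_, fun m hm => hpk m (dualMonoid_anti inf_le_left hm)⟩
  rw [tval_ne_zero_iff τ.2]
  constructor
  · intro h
    exact perp_anti (le_inf h (typ_mk_le τ v)) hp'
  · intro h w hw
    exact (hpτ w hw.1 (h w hw)).1

theorem isOpen_typ_le (σ : 𝓕.cones) : IsOpen {x : ToricVar 𝓕 TT | typ x ≤ σ} := by
  rw [ToricVar.isOpen_iff]
  intro τ
  obtain ⟨p, hp, -⟩ := exists_typ_mk_le_iff σ τ
  have : ToricVar.mk τ ⁻¹' {x : ToricVar 𝓕 TT | typ x ≤ σ} = {v | tval v p ≠ 0} := by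
    ext v; exact hp v
  rw [this]
  exact isOpen_ne_fun (continuous_tval p) continuous_const

/-- On each chart `U_τ(𝕋)` the value at `m` is a quotient of two coordinates, by a power of the `p`
of `exists_typ_mk_le_iff`. -/
theorem continuousOn_ev {σ : 𝓕.cones} {m : Lat n}
    (hm : m ∈ dualMonoid (σ : PointedCone ℝ (RSp n))) :
    ContinuousOn (fun x : ToricVar 𝓕 TT => ev x m) {x | typ x ≤ σ} := by
  rw [continuousOn_open_iff (isOpen_typ_le σ)]
  intro W hW
  rw [ToricVar.isOpen_iff]
  intro τ
  obtain ⟨p, hp, hpk⟩ := exists_typ_mk_le_iff σ τ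
  obtain ⟨k, hk⟩ := hpk m hm
  have hcont : ContinuousOn (fun v : Chart (τ : PointedCone ℝ (RSp n)) TT =>
      tval v ⟨_, hk⟩ / tval v p ^ k) {v | tval v p ≠ 0} :=
    (continuous_tval _).continuousOn.div ((continuous_tval p).pow k).continuousOn
      fun v hv => pow_ne_zero k hv
  have := hcont.isOpen_inter_preimage (isOpen_ne_fun (continuous_tval p) continuous_const) hW
  convert this using 1
  ext v
  simp only [Set.mem_preimage, Set.mem_inter_iff, Set.mem_ofPred_eq, hp v]
  refine and_congr_right fun hv => ?_
  have hmd : m ∈ dualMonoid (typ (ToricVar.mk τ v) : PointedCone ℝ (RSp n)) :=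
    dualMonoid_anti ((hp v).2 hv) hm
  have h1 : ev (ToricVar.mk τ v) (m + k • (p : Lat n)) = ev (ToricVar.mk τ v) m *
      ev (ToricVar.mk τ v) (k • (p : Lat n)) := ev_add _ hmd
    (dualMonoid_anti (typ_mk_le τ v) ((dualMonoid (τ : PointedCone ℝ (RSp n))).nsmul_mem p.2 k))
  have h2 : ev (ToricVar.mk τ v) (m + k • (p : Lat n)) = tval v ⟨_, hk⟩ := ev_mk τ v ⟨_, hk⟩
  have h3 : ev (ToricVar.mk τ v) (k • (p : Lat n)) = tval v p ^ k := by
    rw [← tval_nsmul]; exact ev_mk τ v (k • p)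
  rw [h2, h3] at h1
  rw [h1, mul_div_cancel_right₀ _ (pow_ne_zero k hv)]

/-- Convergence in the toric variety is convergence of the values on one chart around the limit. -/
theorem tendsto_of_tendsto_ev {ι : Type*} {l : Filter ι} {g : ι → ToricVar 𝓕 TT}
    {x : ToricVar 𝓕 TT} {σ : 𝓕.cones} (hx : typ x ≤ σ) (hg : ∀ᶠ i in l, typ (g i) ≤ σ)
    (h : ∀ m ∈ dualMonoid (σ : PointedCone ℝ (RSp n)),
      Filter.Tendsto (fun i => ev (g i) m) l (nhds (ev x m))) :
    Filter.Tendsto g l (nhds x) := by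
  classical
  obtain ⟨u, hu⟩ := exists_mk_of_typ_le hx
  let f : ι → Chart (σ : PointedCone ℝ (RSp n)) TT := fun i =>
    if hi : typ (g i) ≤ σ then (exists_mk_of_typ_le hi).choose else u
  have hf : ∀ i, typ (g i) ≤ σ → g i = ToricVar.mk σ (f i) := by
    intro i hi
    have := (exists_mk_of_typ_le hi).choose_spec
    simp only [f, dif_pos hi]
    exact this
  have h1 : Filter.Tendsto f l (nhds u) := by
    rw [tendsto_subtype_rng, tendsto_pi_nhds]
    intro m
    rw [texp_isEmbedding.tendsto_nhds_iff]
    have h2 := h m m.2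
    have h3 : ev x m = texp (u.1 m) := by
      conv_lhs => rw [hu]
      exact ev_mk σ u m
    rw [h3] at h2
    refine h2.congr' (hg.mono fun i hi => ?_)
    change ev (g i) m = texp ((f i).1 m)
    conv_lhs => rw [hf i hi]
    exact ev_mk σ (f i) m
  rw [hu]
  exact (((continuous_mk σ).tendsto u).comp h1).congr' (hg.mono fun i hi => (hf i hi).symm)

theorem tendsto_ev {ι : Type*} {l : Filter ι} {g : ι → ToricVar 𝓕 TT}
    {x : ToricVar 𝓕 TT} {σ : 𝓕.cones} (hx : typ x ≤ σ) (h : Filter.Tendsto g l (nhds x))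
    {m : Lat n} (hm : m ∈ dualMonoid (σ : PointedCone ℝ (RSp n))) :
    Filter.Tendsto (fun i => ev (g i) m) l (nhds (ev x m)) :=
  ((continuousOn_ev hm).continuousAt ((isOpen_typ_le σ).mem_nhds hx)).tendsto.comp h

theorem eventually_typ_le {ι : Type*} {l : Filter ι} {g : ι → ToricVar 𝓕 TT}
    {x : ToricVar 𝓕 TT} {σ : 𝓕.cones} (hx : typ x ≤ σ) (h : Filter.Tendsto g l (nhds x)) :
    ∀ᶠ i in l, typ (g i) ≤ σ :=
  h.eventually ((isOpen_typ_le σ).mem_nhds hx)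

/-! ### Points with given real coordinates -/

open Classical in
/-- The projection of `X ∈ ℝ^(n+1)` to the orbit `O_σ(𝕋)`, the quotient of `ℝ^(n+1)` by the span
of `σ`. -/
def pt (σ : 𝓕.cones) (X : RSp n) : ToricVar 𝓕 TT :=
  ToricVar.mk σ ⟨fun m => if (m : Lat n) ∈ perp (σ : PointedCone ℝ (RSp n)) then
    Multiplicative.ofAdd ((pair (toReal (m : Lat n)) X : ℝ) : WithBot ℝ)
      else Multiplicative.ofAdd ⊥, by
    refine ⟨texp_injective ?_, fun a b => texp_injective ?_⟩
    · dsimp only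
      rw [ZeroMemClass.coe_zero, if_pos (zero_mem_perp _), texp_coe]
      simp
    · dsimp only
      rw [texp_mul, AddSubmonoid.coe_add]
      have := add_mem_perp_iff a.2 b.2
      by_cases ha : (a : Lat n) ∈ perp (σ : PointedCone ℝ (RSp n))
      · by_cases hb : (b : Lat n) ∈ perp (σ : PointedCone ℝ (RSp n))
        · rw [if_pos ha, if_pos hb, if_pos (this.2 ⟨ha, hb⟩), texp_coe, texp_coe, texp_coe,
            toReal_add, pair_add_left, Real.exp_add]
        · rw [if_neg hb, if_neg fun h => hb (this.1 h).2, texp_bot, mul_zero]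
      · rw [if_neg ha, if_neg fun h => ha (this.1 h).1, texp_bot, zero_mul]⟩

@[simp] theorem typ_pt (σ : 𝓕.cones) (X : RSp n) : typ (pt σ X) = σ := by
  rw [← mem_orbit_iff]
  refine ⟨_, fun m => ?_, rfl⟩
  rw [isUnit_iff_texp_ne_zero]
  dsimp only
  split_ifs with h
  · simp only [h, iff_true, texp_coe]; exact (Real.exp_pos _).ne'
  · simp only [h, iff_false, not_not]; rfl

theorem ev_pt_of_mem {σ : 𝓕.cones} (X : RSp n) {m : Lat n}
    (hm : m ∈ perp (σ : PointedCone ℝ (RSp n))) :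
    ev (pt σ X) m = Real.exp (pair (toReal m) X) := by
  refine (ev_mk σ _ ⟨m, perp_subset_dualMonoid hm⟩).trans ?_
  rw [tval]
  dsimp only
  rw [if_pos hm, texp_coe]

theorem ev_pt_of_notMem {σ : 𝓕.cones} (X : RSp n) {m : Lat n}
    (hm : m ∉ perp (σ : PointedCone ℝ (RSp n))) : ev (pt σ X) m = 0 :=
  ev_eq_zero _ (by rwa [typ_pt])

theorem exists_eq_pt (x : ToricVar 𝓕 TT) : ∃ X, x = pt (typ x) X := by
  obtain ⟨X, hX⟩ := exists_pair_eq_on_perp hU.out (typ x).2 (fun m => Real.log (ev x m)) (by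
    intro a ha b hb
    rw [ev_add_of_mem_perp x ha hb, Real.log_mul ((ev_ne_zero_iff x a).2 ha)
      ((ev_ne_zero_iff x b).2 hb)])
  refine ⟨X, ToricVar.ext (typ_pt _ _).symm fun m _ => ?_⟩
  by_cases h : m ∈ perp (typ x : PointedCone ℝ (RSp n))
  · rw [ev_pt_of_mem X h, hX m h, Real.exp_log ((ev_pos_iff x m).2 h)]
  · rw [ev_pt_of_notMem X h, ev_eq_zero x h]

omit hU in
theorem mem_perp_zeroCone (m : Lat n) :
    m ∈ perp ((𝓕.zeroCone : 𝓕.cones) : PointedCone ℝ (RSp n)) := by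
  intro w hw
  have : w = 0 := by simpa [Fan.zeroCone] using hw
  rw [this, pair_zero_right]

omit hU in
theorem zeroCone_le (σ : 𝓕.cones) : 𝓕.zeroCone ≤ σ := by
  change (⊥ : PointedCone ℝ (RSp n)) ≤ σ
  exact bot_le

omit hU in
theorem realPoint_eq_pt (X : RSp n) : realPoint 𝓕 X = pt 𝓕.zeroCone X := by
  unfold realPoint pt
  congr 1
  refine Subtype.ext (funext fun m => ?_)
  dsimp only
  rw [if_pos (mem_perp_zeroCone _)]

/-- Translating by large negative multiples of a vector in the relative interior of `σ` moves a
point of a larger orbit to its projection to `O_σ(𝕋)`. -/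
theorem tendsto_pt {σ τ : 𝓕.cones} (h : τ ≤ σ) (X : RSp n) {w : RSp n}
    (hw : w ∈ (σ : PointedCone ℝ (RSp n)))
    (hw' : ∀ m ∈ dualMonoid (σ : PointedCone ℝ (RSp n)),
      m ∉ perp (σ : PointedCone ℝ (RSp n)) → 0 < pair (toReal m) w) :
    Filter.Tendsto (fun k : ℕ => pt τ (X - (k : ℝ) • w)) Filter.atTop (nhds (pt σ X)) := by
  refine tendsto_of_tendsto_ev (σ := σ) (by rw [typ_pt]) (by simp [h]) fun m hm => ?_
  by_cases hσ : m ∈ perp (σ : PointedCone ℝ (RSp n))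
  · rw [ev_pt_of_mem X hσ]
    refine tendsto_const_nhds.congr fun k => ?_
    rw [ev_pt_of_mem _ (perp_anti h hσ), pair_sub_right, pair_smul_right, hσ w hw]
    simp
  · rw [ev_pt_of_notMem X hσ]
    by_cases hτ : m ∈ perp (τ : PointedCone ℝ (RSp n))
    · have h1 : Filter.Tendsto (fun k : ℕ => pair (toReal m) X - (k : ℝ) * pair (toReal m) w)
          Filter.atTop Filter.atBot := by
        have := (tendsto_natCast_atTop_atTop (R := ℝ)).atTop_mul_const (hw' m hm hσ)
        simpa [sub_eq_add_neg] using
          Filter.tendsto_atBot_add_const_left _ (pair (toReal m) X)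
            (Filter.tendsto_neg_atTop_atBot.comp this)
      refine (Real.tendsto_exp_atBot.comp h1).congr fun k => ?_
      rw [ev_pt_of_mem _ hτ, pair_sub_right, pair_smul_right]; rfl
    · refine tendsto_const_nhds.congr fun k => ?_
      rw [ev_pt_of_notMem _ hτ]

/-- The closure of `O_σ(𝕋)` is the union of the orbits of the cones that contain `σ`. -/
theorem mem_orbitClosure_iff {σ : 𝓕.cones} {x : ToricVar 𝓕 TT} :
    x ∈ orbitClosure 𝓕 TT σ ↔ σ ≤ typ x := by
  constructor
  · intro h
    obtain ⟨y, hy, hy'⟩ := mem_closure_iff.1 h _ (isOpen_typ_le (typ x)) (le_refl (typ x))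
    rw [mem_orbit_iff] at hy'
    rw [← hy']; exact hy
  · intro h
    obtain ⟨X, hX⟩ := exists_eq_pt x
    obtain ⟨w, hw, hw'⟩ := exists_interior_vector hU.out (typ x).2
    rw [hX]
    exact mem_closure_of_tendsto (tendsto_pt h X hw hw')
      (Filter.Eventually.of_forall fun k => mem_orbit_iff.2 (typ_pt _ _))

end

/-! ### Heights of the tropical monomials -/

section

variable {n : ℕ} {𝓕 : Fan n} {F : LPoly n}

open Classical in
/-- The exponents of `F` on the face of the Newton polytope that is selected by the cone `σ`. -/
def faceExpts (F : LPoly n) (σ : PointedCone ℝ (RSp n)) : Finset (Lat n) :=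
  (expts F).filter fun m => ∀ m' ∈ expts F, m' - m ∈ dualMonoid σ

theorem mem_faceExpts {σ : PointedCone ℝ (RSp n)} {m : Lat n} :
    m ∈ faceExpts F σ ↔ m ∈ expts F ∧ ∀ m' ∈ expts F, m' - m ∈ dualMonoid σ := by
  classical
  exact Finset.mem_filter

/-- Every cone of the fan selects a non-empty set of exponents of `F`, so that the fan refines the
normal fan of the Newton polytope. -/
def IsCompatible (𝓕 : Fan n) (F : LPoly n) : Prop := ∀ σ ∈ 𝓕.cones, (faceExpts F σ).Nonempty

/-- A generator of the polytope with positive weight in a convex combination for `y` lies on the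
face selected by any cone inside the normal cone at `y`. -/
theorem isCompatible_of_subdivides {Δ : Set (RSp n)} (hΔ : IsLatticePolytope Δ)
    (hsupp : ∀ m, F.coeff m ≠ 0 ↔ toReal m ∈ Δ) (hsub : 𝓕.Subdivides (normalFan Δ)) :
    IsCompatible 𝓕 F := by
  classical
  intro σ hσ
  obtain ⟨_, ⟨y, hy, rfl⟩, hle⟩ := hsub.1 σ hσ
  obtain ⟨V, -, rfl⟩ := hΔ
  have hy' := hy
  rw [← Finset.coe_image, Finset.mem_convexHull'] at hy'
  obtain ⟨c, hc, hc1, rfl⟩ := hy'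
  obtain ⟨v, hv, hcv⟩ : ∃ v ∈ V.image toReal, c v ≠ 0 := by
    by_contra h
    push Not at h
    rw [Finset.sum_eq_zero h] at hc1
    exact zero_ne_one hc1
  obtain ⟨m₀, hm₀, rfl⟩ := Finset.mem_image.1 hv
  have hexp : ∀ m, m ∈ expts F ↔ toReal m ∈ convexHull ℝ (toReal '' (V : Set (Lat n))) :=
    fun m => Finsupp.mem_support_iff.trans (hsupp m)
  refine ⟨m₀, mem_faceExpts.2 ⟨(hexp m₀).2 (subset_convexHull ℝ _ ⟨m₀, hm₀, rfl⟩), ?_⟩⟩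
  intro m hm w hw
  have hw' := hle hw
  -- the minimum over the polytope is attained at every vertex of positive weight
  have h0 : ∑ u ∈ V.image toReal,
      c u * (pair u w - pair (∑ y ∈ V.image toReal, c y • y) w) = 0 := by
    simp only [mul_sub, Finset.sum_sub_distrib]
    rw [← Finset.sum_mul, hc1, one_mul, pair_sum_left]
    simp [pair_smul_left]
  rw [Finset.sum_eq_zero_iff_of_nonneg] at h0
  · have h1 := (mul_eq_zero.1 (h0 _ hv)).resolve_left hcv
    have h2 := hw' (toReal m) ((hexp m).1 hm)
    rw [toReal_sub, pair_sub_left]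
    linarith
  · intro u hu
    refine mul_nonneg (hc u hu) (sub_nonneg.2 (hw' u (subset_convexHull ℝ _ ?_)))
    rw [← Finset.coe_image]; exact hu

theorem faceExpts_anti {σ τ : PointedCone ℝ (RSp n)} (h : τ ≤ σ) :
    faceExpts F σ ⊆ faceExpts F τ := fun m hm => by
  rw [mem_faceExpts] at hm ⊢
  exact ⟨hm.1, fun m' hm' => dualMonoid_anti h (hm.2 m' hm')⟩

theorem sub_mem_perp_of_mem_faceExpts {σ : PointedCone ℝ (RSp n)} {m m' : Lat n}
    (hm : m ∈ faceExpts F σ) (hm' : m' ∈ faceExpts F σ) : m - m' ∈ perp σ := by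
  rw [mem_faceExpts] at hm hm'
  intro w hw
  have h1 := hm.2 m' hm'.1 w hw
  have h2 := hm'.2 m hm.1 w hw
  rw [toReal_sub, pair_sub_left] at h1 h2 ⊢
  linarith

theorem mem_faceExpts_iff_sub_mem_perp {σ : PointedCone ℝ (RSp n)} {m m₀ : Lat n}
    (hm : m ∈ expts F) (h₀ : m₀ ∈ faceExpts F σ) : m ∈ faceExpts F σ ↔ m - m₀ ∈ perp σ := by
  refine ⟨fun h => sub_mem_perp_of_mem_faceExpts h h₀, fun h => mem_faceExpts.2 ⟨hm, ?_⟩⟩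
  intro m' hm' w hw
  have h1 := h w hw
  have h2 := (mem_faceExpts.1 h₀).2 m' hm' w hw
  rw [toReal_sub, pair_sub_left] at h1 h2 ⊢
  linarith

/-- The tropical polynomial of the terms of `F` on the face selected by `σ`. -/
def ftrop (F : LPoly n) (σ : PointedCone ℝ (RSp n)) (X : RSp n) : ℝ :=
  ⨆ m : faceExpts F σ, tmon F (m : Lat n) X

theorem tmon_le_ftrop {σ : PointedCone ℝ (RSp n)} {m : Lat n} (hm : m ∈ faceExpts F σ)
    (X : RSp n) : tmon F m X ≤ ftrop F σ X :=
  le_ciSup (f := fun m : faceExpts F σ => tmon F (m : Lat n) X) (Set.finite_range _).bddAbove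
    ⟨m, hm⟩

theorem exists_tmon_eq_ftrop {σ : PointedCone ℝ (RSp n)} (h : (faceExpts F σ).Nonempty)
    (X : RSp n) : ∃ m ∈ faceExpts F σ, tmon F m X = ftrop F σ X := by
  have : Nonempty (faceExpts F σ) := h.to_subtype
  obtain ⟨m, hm⟩ := exists_eq_ciSup_of_finite (f := fun m : faceExpts F σ => tmon F (m : Lat n) X)
  exact ⟨m, m.2, hm⟩

theorem tmon_sub (F : LPoly n) (m m' : Lat n) (X : RSp n) :
    tmon F m X - tmon F m' X = (vv F m - vv F m' : ℝ) + pair (toReal (m - m')) X := by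
  rw [toReal_sub, pair_sub_left]; unfold tmon; ring

variable [hU : Fact 𝓕.IsUnimodular]

/-- A real vector that projects to the given point of an orbit. -/
def lift (x : ToricVar 𝓕 TT) : RSp n := (exists_eq_pt x).choose

theorem pt_lift (x : ToricVar 𝓕 TT) : pt (typ x) (lift x) = x := (exists_eq_pt x).choose_spec.symm

open Classical in
/-- The height `exp (ℓ_m - max_i ℓ_i)` of the `m`-th tropical monomial, extended continuously to the
toric variety: on the orbit `O_σ(𝕋)` it vanishes for the `m` outside the face selected by `σ`. -/
def hgt (F : LPoly n) (x : ToricVar 𝓕 TT) (m : Lat n) : ℝ :=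
  if m ∈ faceExpts F (typ x : PointedCone ℝ (RSp n)) then
    Real.exp (tmon F m (lift x) - ftrop F (typ x : PointedCone ℝ (RSp n)) (lift x)) else 0

theorem pair_eq_of_pt_eq {σ : 𝓕.cones} {X Y : RSp n} (h : pt σ X = pt σ Y) {m : Lat n}
    (hm : m ∈ perp (σ : PointedCone ℝ (RSp n))) : pair (toReal m) X = pair (toReal m) Y := by
  have h1 := congrArg (fun x => ev x m) h
  rwa [ev_pt_of_mem X hm, ev_pt_of_mem Y hm, Real.exp_eq_exp] at h1

/-- The height does not depend on the choice of real coordinates. -/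
theorem hgt_pt_of_mem {σ : 𝓕.cones} (X : RSp n) {m : Lat n}
    (hm : m ∈ faceExpts F (σ : PointedCone ℝ (RSp n))) :
    hgt F (pt σ X) m = Real.exp (tmon F m X - ftrop F (σ : PointedCone ℝ (RSp n)) X) := by
  have hσ : typ (pt σ X) = σ := typ_pt σ X
  have hl : pt σ X = pt σ (lift (pt σ X)) := by
    have := (pt_lift (pt σ X)).symm
    rwa [hσ] at this
  have hdiff : ∀ m₁ ∈ faceExpts F (σ : PointedCone ℝ (RSp n)),
      ∀ m₂ ∈ faceExpts F (σ : PointedCone ℝ (RSp n)),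
      tmon F m₁ X - tmon F m₂ X = tmon F m₁ (lift (pt σ X)) - tmon F m₂ (lift (pt σ X)) := by
    intro m₁ h₁ m₂ h₂
    rw [tmon_sub, tmon_sub, pair_eq_of_pt_eq hl (sub_mem_perp_of_mem_faceExpts h₁ h₂)]
  rw [hgt, hσ, if_pos hm]
  obtain ⟨m₁, h₁, e₁⟩ := exists_tmon_eq_ftrop ⟨m, hm⟩ X
  obtain ⟨m₂, h₂, e₂⟩ := exists_tmon_eq_ftrop ⟨m, hm⟩ (lift (pt σ X))
  have h3 := hdiff m₁ h₁ m₂ h₂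
  have h4 := tmon_le_ftrop h₂ X
  have h5 := tmon_le_ftrop h₁ (lift (pt σ X))
  have h6 := hdiff m hm m₁ h₁
  congr 1
  linarith

theorem hgt_eq_zero {x : ToricVar 𝓕 TT} {m : Lat n}
    (hm : m ∉ faceExpts F (typ x : PointedCone ℝ (RSp n))) : hgt F x m = 0 := if_neg hm

theorem hgt_pos_iff {x : ToricVar 𝓕 TT} {m : Lat n} :
    0 < hgt F x m ↔ m ∈ faceExpts F (typ x : PointedCone ℝ (RSp n)) := by
  constructor
  · intro h
    by_contra h'
    rw [hgt_eq_zero h'] at h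
    exact lt_irrefl _ h
  · intro h
    rw [hgt, if_pos h]
    exact Real.exp_pos _

theorem hgt_le_one (x : ToricVar 𝓕 TT) (m : Lat n) : hgt F x m ≤ 1 := by
  unfold hgt
  split_ifs with h
  · exact Real.exp_le_one_iff.2 (sub_nonpos.2 (tmon_le_ftrop h _))
  · exact zero_le_one

variable [hC : Fact (IsCompatible 𝓕 F)]

theorem exists_hgt_eq_one (x : ToricVar 𝓕 TT) : ∃ m ∈ expts F, hgt F x m = 1 := by
  obtain ⟨m, hm, h⟩ := exists_tmon_eq_ftrop (hC.out _ (typ x).2) (lift x)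
  refine ⟨m, (mem_faceExpts.1 hm).1, ?_⟩
  rw [hgt, if_pos hm, h, sub_self, Real.exp_zero]

/-- On the chart of `σ` the heights are quotients of the values at `m - m₀ ∈ σ^∨`, where `m₀` lies
on the face selected by `σ`, by the maximum of these values. -/
theorem continuous_hgt {m : Lat n} (hm : m ∈ expts F) :
    Continuous fun x : ToricVar 𝓕 TT => hgt F x m := by
  rw [continuous_iff_continuousAt]
  intro x₀
  obtain ⟨m₀, hm₀⟩ := hC.out _ (typ x₀).2
  have hm₀A := (mem_faceExpts.1 hm₀).1
  let c : Lat n → ToricVar 𝓕 TT → ℝ := fun m' x => Real.exp (vv F m') * ev x (m' - m₀)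
  have hc : ∀ m' ∈ expts F, ContinuousOn (c m') {x | typ x ≤ typ x₀} := fun m' hm' =>
    continuousOn_const.mul (continuousOn_ev ((mem_faceExpts.1 hm₀).2 m' hm'))
  let s : ToricVar 𝓕 TT → ℝ := fun x => (expts F).sup' ⟨m₀, hm₀A⟩ fun m' => c m' x
  have hs : ContinuousOn s {x | typ x ≤ typ x₀} :=
    ContinuousOn.finset_sup'_apply ⟨m₀, hm₀A⟩ hc
  -- on the chart, the height is `c m` divided by the maximum of the `c m'`
  have key : ∀ x : ToricVar 𝓕 TT, typ x ≤ typ x₀ → s x ≠ 0 ∧ hgt F x m = c m x / s x := by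
    intro x hx
    obtain ⟨X, hX⟩ := exists_eq_pt x
    have h₀ : m₀ ∈ faceExpts F (typ x : PointedCone ℝ (RSp n)) := faceExpts_anti hx hm₀
    have hc1 : ∀ m' ∈ faceExpts F (typ x : PointedCone ℝ (RSp n)),
        c m' x = Real.exp (tmon F m' X - pair (toReal m₀) X) := by
      intro m' hm'
      have h1 : ev x (m' - m₀) = Real.exp (pair (toReal (m' - m₀)) X) := by
        conv_lhs => rw [hX]
        exact ev_pt_of_mem X (sub_mem_perp_of_mem_faceExpts hm' h₀)
      simp only [c]
      rw [h1, ← Real.exp_add, toReal_sub, pair_sub_left]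
      congr 1
      unfold tmon; ring
    have hc0 : ∀ m' ∈ expts F, m' ∉ faceExpts F (typ x : PointedCone ℝ (RSp n)) → c m' x = 0 := by
      intro m' hm' hn
      rw [mem_faceExpts_iff_sub_mem_perp hm' h₀] at hn
      simp only [c]
      rw [ev_eq_zero x hn, mul_zero]
    have hsx : s x = Real.exp (ftrop F (typ x : PointedCone ℝ (RSp n)) X - pair (toReal m₀) X) := by
      apply le_antisymm
      · refine Finset.sup'_le _ _ fun m' hm' => ?_
        by_cases h : m' ∈ faceExpts F (typ x : PointedCone ℝ (RSp n))
        · rw [hc1 m' h]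
          exact Real.exp_le_exp.2 (sub_le_sub_right (tmon_le_ftrop h X) _)
        · rw [hc0 m' hm' h]; exact (Real.exp_pos _).le
      · obtain ⟨m₁, h₁, e₁⟩ := exists_tmon_eq_ftrop ⟨m₀, h₀⟩ X
        rw [← e₁, ← hc1 m₁ h₁]
        exact Finset.le_sup' (fun m' => c m' x) (mem_faceExpts.1 h₁).1
    refine ⟨by rw [hsx]; exact (Real.exp_pos _).ne', ?_⟩
    by_cases h : m ∈ faceExpts F (typ x : PointedCone ℝ (RSp n))
    · have h1 : hgt F x m = Real.exp (tmon F m X - ftrop F (typ x : PointedCone ℝ (RSp n)) X) := by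
        conv_lhs => rw [hX]
        exact hgt_pt_of_mem X h
      rw [h1, hc1 m h, hsx, ← Real.exp_sub]
      congr 1; ring
    · rw [hgt_eq_zero h, hc0 m hm h, zero_div]
  have hcont : ContinuousOn (fun x => c m x / s x) {x | typ x ≤ typ x₀} :=
    (hc m hm).div hs fun x hx => (key x hx).1
  exact (hcont.congr fun x hx => (key x hx).2).continuousAt
    ((isOpen_typ_le (typ x₀)).mem_nhds (le_refl (typ x₀)))

omit hU hC in
theorem faceExpts_zeroCone : faceExpts F ((𝓕.zeroCone : 𝓕.cones) : PointedCone ℝ (RSp n)) =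
    expts F := by
  ext m
  rw [mem_faceExpts]
  exact ⟨fun h => h.1, fun h => ⟨h, fun m' _ => perp_subset_dualMonoid (mem_perp_zeroCone _)⟩⟩

omit hU hC in
theorem ftrop_zeroCone (X : RSp n) :
    ftrop F ((𝓕.zeroCone : 𝓕.cones) : PointedCone ℝ (RSp n)) X = trop F X := by
  unfold ftrop
  rw [faceExpts_zeroCone]
  rfl

omit hC in
theorem hgt_realPoint (X : RSp n) {m : Lat n} (hm : m ∈ expts F) :
    hgt F (realPoint 𝓕 X) m = Real.exp (tmon F m X - trop F X) := by
  rw [realPoint_eq_pt, hgt_pt_of_mem X (by rwa [faceExpts_zeroCone]), ftrop_zeroCone]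

omit hC in
theorem hgt_realPoint_eq_one_iff (X : RSp n) {m : Lat n} (hm : m ∈ expts F) :
    hgt F (realPoint 𝓕 X) m = 1 ↔ tmon F m X = trop F X := by
  rw [hgt_realPoint X hm, Real.exp_eq_one_iff, sub_eq_zero]

/-! ### Dominant exponents -/

open Classical in
/-- The exponents whose tropical monomials are dominant at a point. -/
def dom (F : LPoly n) (x : ToricVar 𝓕 TT) : Finset (Lat n) :=
  (expts F).filter fun m => hgt F x m = 1

omit hC in
theorem mem_dom {x : ToricVar 𝓕 TT} {m : Lat n} : m ∈ dom F x ↔ m ∈ expts F ∧ hgt F x m = 1 := by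
  classical
  exact Finset.mem_filter

theorem dom_nonempty (x : ToricVar 𝓕 TT) : (dom F x).Nonempty := by
  obtain ⟨m, hm, h⟩ := exists_hgt_eq_one (F := F) x
  exact ⟨m, mem_dom.2 ⟨hm, h⟩⟩

omit hC in
theorem mem_dom_pt_iff {σ : 𝓕.cones} {X : RSp n} {m : Lat n} :
    m ∈ dom F (pt σ X) ↔ m ∈ faceExpts F (σ : PointedCone ℝ (RSp n)) ∧
      ∀ m' ∈ faceExpts F (σ : PointedCone ℝ (RSp n)), tmon F m' X ≤ tmon F m X := by
  rw [mem_dom]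
  constructor
  · rintro ⟨-, h⟩
    have h1 : m ∈ faceExpts F (σ : PointedCone ℝ (RSp n)) := by
      have : 0 < hgt F (pt σ X) m := by rw [h]; exact zero_lt_one
      rwa [hgt_pos_iff, typ_pt] at this
    rw [hgt_pt_of_mem X h1, Real.exp_eq_one_iff, sub_eq_zero] at h
    exact ⟨h1, fun m' hm' => h ▸ tmon_le_ftrop hm' X⟩
  · rintro ⟨h1, h2⟩
    refine ⟨(mem_faceExpts.1 h1).1, ?_⟩
    rw [hgt_pt_of_mem X h1, Real.exp_eq_one_iff, sub_eq_zero]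
    obtain ⟨m₁, h₁, e₁⟩ := exists_tmon_eq_ftrop ⟨m, h1⟩ X
    exact le_antisymm (tmon_le_ftrop h1 X) (e₁ ▸ h2 m₁ h₁)

omit hC in
theorem mem_dom_realPoint_iff {X : RSp n} {m : Lat n} :
    m ∈ dom F (realPoint 𝓕 X) ↔ m ∈ expts F ∧ tmon F m X = trop F X := by
  rw [mem_dom]
  exact and_congr_right fun h => hgt_realPoint_eq_one_iff X h

/-- Every point is a limit of points of any larger orbit with the same dominant exponents. -/
theorem exists_tendsto_dom_eq (x : ToricVar 𝓕 TT) {τ : 𝓕.cones} (h : τ ≤ typ x) :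
    ∃ Y : ℕ → RSp n, Filter.Tendsto (fun k => pt τ (Y k)) Filter.atTop (nhds x) ∧
      ∀ᶠ k in Filter.atTop, dom F (pt τ (Y k)) = dom F x := by
  obtain ⟨X, hX⟩ := exists_eq_pt x
  obtain ⟨w, hw, hw'⟩ := exists_interior_vector hU.out (typ x).2
  -- translations along `w` do not change the order of the monomials on the face selected by `typ x`
  have ht := tendsto_pt h X hw hw'
  rw [← hX] at ht
  refine ⟨_, ht, ?_⟩
  have h1 : ∀ m ∈ expts F, m ∉ dom F x → ∀ᶠ k : ℕ in Filter.atTop,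
      m ∉ dom F (pt τ (X - (k : ℝ) • w)) := by
    intro m hm hmx
    have hlt : hgt F x m < 1 :=
      lt_of_le_of_ne (hgt_le_one x m) fun h => hmx (mem_dom.2 ⟨hm, h⟩)
    filter_upwards [((continuous_hgt hm).tendsto x).comp ht |>.eventually_lt_const hlt] with k hk
    exact fun hk' => ne_of_lt hk (mem_dom.1 hk').2
  have h2 : ∀ᶠ k : ℕ in Filter.atTop, ∀ m ∈ expts F, m ∉ dom F x →
      m ∉ dom F (pt τ (X - (k : ℝ) • w)) := by
    rw [Filter.eventually_all_finset]
    intro m hm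
    by_cases h : m ∈ dom F x
    · simp [h]
    · filter_upwards [h1 m hm h] with k hk _ using hk
  filter_upwards [h2] with k hk
  have hsub : dom F (pt τ (X - (k : ℝ) • w)) ⊆ dom F x := by
    intro m hm
    by_contra h'
    exact hk m (mem_dom.1 hm).1 h' hm
  refine hsub.antisymm fun m hm => ?_
  obtain ⟨m₁, h₁⟩ := dom_nonempty (F := F) (pt τ (X - (k : ℝ) • w))
  have h₁' := hsub h₁
  rw [hX, mem_dom_pt_iff] at hm h₁'
  rw [mem_dom_pt_iff] at h₁ ⊢
  refine ⟨faceExpts_anti h hm.1, fun m' hm' => (h₁.2 m' hm').trans ?_⟩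
  have h3 := sub_mem_perp_of_mem_faceExpts h₁'.1 hm.1 w hw
  have h4 := hm.2 m₁ h₁'.1
  rw [toReal_sub, pair_sub_left] at h3
  unfold tmon at *
  rw [pair_sub_right, pair_sub_right, pair_smul_right, pair_smul_right]
  have h5 : pair (toReal m₁) w = pair (toReal m) w := by linarith
  rw [h5]
  linarith

/-- The locus where all exponents in `S` are dominant is the closure of its part in `ℝ^(n+1)`. -/
theorem closure_realPoint_dom (S : Finset (Lat n)) :
    closure (realPoint 𝓕 '' {X | S ⊆ dom F (realPoint 𝓕 X)}) = {x | S ⊆ dom F x} := by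
  apply Set.Subset.antisymm
  · refine closure_minimal ?_ ?_
    · rintro _ ⟨X, hX, rfl⟩
      exact hX
    · by_cases hS : S ⊆ expts F
      · have : {x : ToricVar 𝓕 TT | S ⊆ dom F x} = ⋂ m ∈ S, {x | hgt F x m = 1} := by
          ext x
          simp only [Set.mem_iInter, Set.mem_ofPred_eq]
          exact ⟨fun h m hm => (mem_dom.1 (h hm)).2, fun h m hm => mem_dom.2 ⟨hS hm, h m hm⟩⟩
        rw [this]
        exact isClosed_biInter fun m hm => isClosed_eq (continuous_hgt (hS hm)) continuous_const
      · convert isClosed_empty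
        ext x
        simp only [Set.mem_ofPred_eq, Set.mem_empty_iff_false, iff_false]
        exact fun h => hS fun m hm => (mem_dom.1 (h hm)).1
  · intro x hx
    obtain ⟨Y, hY, hY'⟩ := exists_tendsto_dom_eq (F := F) x (zeroCone_le _)
    refine mem_closure_of_tendsto hY (hY'.mono fun k hk => ?_)
    rw [← realPoint_eq_pt] at hk ⊢
    exact ⟨Y k, by change S ⊆ _; rw [hk]; exact hx, rfl⟩

/-! ### Translations and segments in the orbits -/

omit hC

/-- The translation of a point by a real vector. -/
def act (d : RSp n) (x : ToricVar 𝓕 TT) : ToricVar 𝓕 TT := pt (typ x) (lift x + d)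

@[simp] theorem typ_act (d : RSp n) (x : ToricVar 𝓕 TT) : typ (act d x) = typ x := typ_pt _ _

theorem ev_act (d : RSp n) (x : ToricVar 𝓕 TT) (m : Lat n) :
    ev (act d x) m = ev x m * Real.exp (pair (toReal m) d) := by
  by_cases h : m ∈ perp (typ x : PointedCone ℝ (RSp n))
  · have h1 : ev x m = Real.exp (pair (toReal m) (lift x)) := by
      conv_lhs => rw [← pt_lift x]
      exact ev_pt_of_mem _ h
    rw [act, ev_pt_of_mem _ h, h1, pair_add_right, Real.exp_add]
  · rw [ev_eq_zero x h, zero_mul, act, ev_pt_of_notMem _ h]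

theorem tendsto_act {ι : Type*} {l : Filter ι} {f : ι → ToricVar 𝓕 TT} {d : ι → RSp n}
    {x : ToricVar 𝓕 TT} {e : RSp n} (hf : Filter.Tendsto f l (nhds x))
    (hd : Filter.Tendsto d l (nhds e)) :
    Filter.Tendsto (fun i => act (d i) (f i)) l (nhds (act e x)) := by
  refine tendsto_of_tendsto_ev (σ := typ x) (by simp)
    ((eventually_typ_le le_rfl hf).mono fun i hi => by simpa using hi) fun m hm => ?_
  simp only [ev_act]
  exact (tendsto_ev le_rfl hf hm).mul
    ((Real.continuous_exp.comp (continuous_pair (toReal m))).continuousAt.tendsto.comp hd)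

/-- The point that divides the segment between two points of the same orbit in the ratio
`t : 1 - t`. -/
def comb (t : ℝ) (x y : ToricVar 𝓕 TT) : ToricVar 𝓕 TT :=
  pt (typ x) ((1 - t) • lift x + t • lift y)

@[simp] theorem typ_comb (t : ℝ) (x y : ToricVar 𝓕 TT) : typ (comb t x y) = typ x := typ_pt _ _

theorem ev_comb {x y : ToricVar 𝓕 TT} (hxy : typ x = typ y) {t : ℝ} (m : Lat n) :
    ev (comb t x y) m = ev x m ^ (1 - t) * ev y m ^ t := by
  by_cases h : m ∈ perp (typ x : PointedCone ℝ (RSp n))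
  · have h1 : ev x m = Real.exp (pair (toReal m) (lift x)) := by
      conv_lhs => rw [← pt_lift x]
      exact ev_pt_of_mem _ h
    have h2 : ev y m = Real.exp (pair (toReal m) (lift y)) := by
      conv_lhs => rw [← pt_lift y]
      exact ev_pt_of_mem _ (hxy ▸ h)
    rw [comb, ev_pt_of_mem _ h, h1, h2, ← Real.exp_mul, ← Real.exp_mul, ← Real.exp_add,
      pair_add_right, pair_smul_right, pair_smul_right]
    congr 1; ring
  · rw [ev_eq_zero x h, ev_eq_zero y (hxy ▸ h), comb, ev_pt_of_notMem _ h]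
    -- `0 ^ 0 = 1` for real powers, but the exponents `1 - t` and `t` are not both zero
    by_cases ht : t = 0
    · subst ht; simp
    · rw [Real.zero_rpow ht, mul_zero]

/-- Segments in the orbits vary continuously even across orbits: at the boundary the values of both
end points tend to zero, and with them their weighted geometric mean, uniformly in the weights. -/
theorem tendsto_comb {ι : Type*} {l : Filter ι} {f g : ι → ToricVar 𝓕 TT} {t : ι → ℝ}
    {x y : ToricVar 𝓕 TT} {s : ℝ} (hxy : typ x = typ y) (hfg : ∀ i, typ (f i) = typ (g i))
    (hf : Filter.Tendsto f l (nhds x)) (hg : Filter.Tendsto g l (nhds y))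
    (ht : Filter.Tendsto t l (nhds s)) (ht01 : ∀ i, t i ∈ Set.Icc (0 : ℝ) 1) :
    Filter.Tendsto (fun i => comb (t i) (f i) (g i)) l (nhds (comb s x y)) := by
  refine tendsto_of_tendsto_ev (σ := typ x) (by simp)
    ((eventually_typ_le le_rfl hf).mono fun i hi => by simpa using hi) fun m hm => ?_
  have h1 := tendsto_ev le_rfl hf hm
  have h2 := tendsto_ev hxy.ge hg hm
  have h3 : ∀ i, ev (comb (t i) (f i) (g i)) m = ev (f i) m ^ (1 - t i) * ev (g i) m ^ t i :=
    fun i => ev_comb (hfg i) m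
  by_cases h : m ∈ perp (typ x : PointedCone ℝ (RSp n))
  · rw [ev_comb hxy]
    simp only [h3]
    exact (h1.rpow (tendsto_const_nhds.sub ht) (Or.inl ((ev_ne_zero_iff x m).2 h))).mul
      (h2.rpow ht (Or.inl ((ev_ne_zero_iff y m).2 (hxy ▸ h))))
  · rw [ev_eq_zero x h] at h1
    rw [ev_eq_zero y (hxy ▸ h)] at h2
    rw [ev_eq_zero (comb s x y) (by rwa [typ_comb])]
    have h4 : Filter.Tendsto (fun i => (1 - t i) * ev (f i) m + t i * ev (g i) m) l (nhds 0) := by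
      have := ((tendsto_const_nhds (x := (1 : ℝ))).sub ht |>.mul h1).add (ht.mul h2)
      simpa using this
    refine squeeze_zero (fun i => ev_nonneg _ _) (fun i => ?_) h4
    rw [h3 i]
    exact Real.geom_mean_le_arith_mean2_weighted (sub_nonneg.2 (ht01 i).2) (ht01 i).1
      (ev_nonneg _ _) (ev_nonneg _ _) (by ring)

theorem comb_zero (x y : ToricVar 𝓕 TT) : comb 0 x y = x := by
  rw [comb, sub_zero, one_smul, zero_smul, add_zero, pt_lift]

theorem comb_one {x y : ToricVar 𝓕 TT} (h : typ x = typ y) : comb 1 x y = y := by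
  rw [comb, sub_self, zero_smul, one_smul, zero_add, h, pt_lift]

theorem mem_dom_iff_lift {x : ToricVar 𝓕 TT} {m : Lat n} :
    m ∈ dom F x ↔ m ∈ faceExpts F (typ x : PointedCone ℝ (RSp n)) ∧
      ∀ m' ∈ faceExpts F (typ x : PointedCone ℝ (RSp n)),
        tmon F m' (lift x) ≤ tmon F m (lift x) := by
  have := mem_dom_pt_iff (F := F) (σ := typ x) (X := lift x) (m := m)
  rwa [pt_lift] at this

theorem tmon_comb (F : LPoly n) (m : Lat n) (t : ℝ) (X Y : RSp n) :
    tmon F m ((1 - t) • X + t • Y) = (1 - t) * tmon F m X + t * tmon F m Y := by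
  unfold tmon
  rw [pair_add_right, pair_smul_right, pair_smul_right]
  ring

theorem inter_dom_subset_dom_comb {x y : ToricVar 𝓕 TT} (hxy : typ x = typ y) {t : ℝ}
    (ht : t ∈ Set.Icc (0 : ℝ) 1) {m : Lat n} (hx : m ∈ dom F x) (hy : m ∈ dom F y) :
    m ∈ dom F (comb t x y) := by
  rw [mem_dom_iff_lift] at hx hy
  rw [comb, mem_dom_pt_iff]
  refine ⟨hx.1, fun m' hm' => ?_⟩
  rw [tmon_comb, tmon_comb]
  exact add_le_add (mul_le_mul_of_nonneg_left (hx.2 m' hm') (sub_nonneg.2 ht.2))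
    (mul_le_mul_of_nonneg_left (hy.2 m' (hxy ▸ hm')) ht.1)

/-- If two points have a common dominant exponent, then in the interior of the segment between them
only common dominant exponents are dominant. -/
theorem dom_comb_subset {x y : ToricVar 𝓕 TT} (hxy : typ x = typ y) {t : ℝ}
    (ht : t ∈ Set.Ioo (0 : ℝ) 1) {m₀ : Lat n} (hx : m₀ ∈ dom F x) (hy : m₀ ∈ dom F y) {m : Lat n}
    (hm : m ∈ dom F (comb t x y)) : m ∈ dom F x ∧ m ∈ dom F y := by
  rw [mem_dom_iff_lift] at hx hy
  rw [comb, mem_dom_pt_iff] at hm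
  have h1 := hm.2 m₀ hx.1
  rw [tmon_comb, tmon_comb] at h1
  have h2 := hx.2 m hm.1
  have h3 := hy.2 m (hxy ▸ hm.1)
  have h4 := mul_le_mul_of_nonneg_left h2 (sub_nonneg.2 ht.2.le)
  have h5 := mul_le_mul_of_nonneg_left h3 ht.1.le
  have h6 : tmon F m₀ (lift x) ≤ tmon F m (lift x) :=
    le_of_mul_le_mul_left (by linarith) (sub_pos.2 ht.2)
  have h7 : tmon F m₀ (lift y) ≤ tmon F m (lift y) := le_of_mul_le_mul_left (by linarith) ht.1
  rw [mem_dom_iff_lift, mem_dom_iff_lift]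
  exact ⟨⟨hm.1, fun m' hm' => (hx.2 m' hm').trans h6⟩,
    ⟨hxy ▸ hm.1, fun m' hm' => (hy.2 m' hm').trans h7⟩⟩

end

/-! ### Systems of linear inequalities -/

section

/-- **Farkas' lemma** for finitely many linear functionals. -/
theorem exists_nonneg_combination {V ι : Type*} [AddCommGroup V] [Module ℝ V] (s : Finset ι)
    (a : ι → Module.Dual ℝ V) (b : Module.Dual ℝ V)
    (h : ∀ x, (∀ i ∈ s, a i x ≤ 0) → b x ≤ 0) :
    ∃ c : ι → ℝ, (∀ i ∈ s, 0 ≤ c i) ∧ b = ∑ i ∈ s, c i • a i := by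
  classical
  induction s using Finset.induction_on generalizing a b with
  | empty =>
    refine ⟨0, by simp, LinearMap.ext fun x => ?_⟩
    have h1 := h x (by simp)
    have h2 := h (-x) (by simp)
    rw [map_neg] at h2
    simp only [Finset.sum_empty, LinearMap.zero_apply]
    linarith
  | insert j s hj ih =>
    by_cases hs : ∀ x, (∀ i ∈ s, a i x ≤ 0) → b x ≤ 0
    · obtain ⟨c, hc, rfl⟩ := ih a b hs
      refine ⟨fun i => if i = j then 0 else c i, fun i hi => ?_, ?_⟩
      · dsimp only
        split_ifs with hij
        · exact le_rfl
        · exact hc i ((Finset.mem_insert.1 hi).resolve_left hij)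
      · rw [Finset.sum_insert hj]
        dsimp only
        rw [if_pos rfl, zero_smul, zero_add]
        refine Finset.sum_congr rfl fun i hi => ?_
        rw [if_neg fun hij : i = j => hj (hij ▸ hi)]
    · push Not at hs
      obtain ⟨y, hy, hby⟩ := hs
      have hjy : 0 < a j y := by
        by_contra hn
        refine absurd (h y fun i hi => ?_) (not_le.2 hby)
        rcases Finset.mem_insert.1 hi with rfl | hi
        · exact not_lt.1 hn
        · exact hy i hi
      -- project along `y` to the kernel of `a j`
      obtain ⟨c, hc, e⟩ := ih (fun i => a i - (a i y / a j y) • a j) (b - (b y / a j y) • a j) (by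
        intro x hx
        have h1 := h (x - (a j x / a j y) • y) (by
          intro i hi
          rcases Finset.mem_insert.1 hi with rfl | hi
          · rw [map_sub, map_smul, smul_eq_mul, div_mul_cancel₀ _ hjy.ne', sub_self]
          · have := hx i hi
            simp only [LinearMap.sub_apply, LinearMap.smul_apply, smul_eq_mul] at this
            rw [map_sub, map_smul, smul_eq_mul]
            calc _ = a i x - a i y / a j y * a j x := by ring
              _ ≤ 0 := this)
        rw [map_sub, map_smul, smul_eq_mul] at h1
        simp only [LinearMap.sub_apply, LinearMap.smul_apply, smul_eq_mul]
        calc _ = b x - a j x / a j y * b y := by ring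
          _ ≤ 0 := h1)
      refine ⟨fun i => if i = j then b y / a j y - ∑ i ∈ s, c i * (a i y / a j y) else c i,
        fun i hi => ?_, ?_⟩
      · dsimp only
        split_ifs with hij
        · have h1 : ∑ i ∈ s, c i * (a i y / a j y) ≤ 0 := Finset.sum_nonpos fun i hi =>
            mul_nonpos_of_nonneg_of_nonpos (hc i hi)
              (div_nonpos_of_nonpos_of_nonneg (hy i hi) hjy.le)
          have h2 : 0 ≤ b y / a j y := (div_pos hby hjy).le
          linarith
        · exact hc i ((Finset.mem_insert.1 hi).resolve_left hij)
      · rw [Finset.sum_insert hj]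
        dsimp only
        rw [if_pos rfl]
        have h1 : ∑ i ∈ s, (if i = j then b y / a j y - ∑ i ∈ s, c i * (a i y / a j y) else c i) •
            a i = ∑ i ∈ s, c i • a i := Finset.sum_congr rfl fun i hi => by
          rw [if_neg fun hij : i = j => hj (hij ▸ hi)]
        rw [h1]
        refine LinearMap.ext fun x => ?_
        have e1 := congrArg (fun f => f x) e
        simp only [LinearMap.sub_apply, LinearMap.smul_apply, LinearMap.sum_apply,
          LinearMap.add_apply, smul_eq_mul, mul_sub, Finset.sum_sub_distrib] at e1 ⊢
        rw [sub_mul, Finset.sum_mul]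
        simp only [mul_assoc] at e1 ⊢
        linarith

variable {n : ℕ} {F : LPoly n}

theorem tmon_le_trop {m : Lat n} (hm : m ∈ expts F) (X : RSp n) : tmon F m X ≤ trop F X :=
  le_ciSup (f := fun m : expts F => tmon F (m : Lat n) X) (Set.finite_range _).bddAbove ⟨m, hm⟩

theorem exists_tmon_eq_trop (h : (expts F).Nonempty) (X : RSp n) :
    ∃ m ∈ expts F, tmon F m X = trop F X := by
  have : Nonempty (expts F) := h.to_subtype
  obtain ⟨m, hm⟩ := exists_eq_ciSup_of_finite (f := fun m : expts F => tmon F (m : Lat n) X)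
  exact ⟨m, m.2, hm⟩

/-- If the tropical monomials in `S` are nowhere simultaneously dominant, then everywhere one of
them is below the maximum by a definite amount. -/
theorem exists_gap_of_not_dominant (hF : (expts F).Nonempty) {S : Finset (Lat n)}
    (hS : S ⊆ expts F) (h : ¬ ∃ Y, ∀ s ∈ S, tmon F s Y = trop F Y) :
    ∃ ε > 0, ∀ X, ∃ s ∈ S, ε ≤ trop F X - tmon F s X := by
  classical
  -- `a (m, s)` is the homogenization of `ℓ_m - ℓ_s`
  let a : Lat n × Lat n → Module.Dual ℝ (RSp n × ℝ) := fun q =>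
    { toFun := fun p => pair (toReal (q.1 - q.2)) p.1 + (vv F q.1 - vv F q.2 : ℝ) * p.2
      map_add' := fun x y => by
        simp only [Prod.fst_add, Prod.snd_add, pair_add_right]; ring
      map_smul' := fun c x => by
        simp only [Prod.smul_fst, Prod.smul_snd, pair_smul_right, smul_eq_mul, RingHom.id_apply]
        ring }
  have ha : ∀ q X c, a q (X, c) = pair (toReal (q.1 - q.2)) X + (vv F q.1 - vv F q.2 : ℝ) * c :=
    fun _ _ _ => rfl
  have ha1 : ∀ q X, a q (X, 1) = tmon F q.1 X - tmon F q.2 X := by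
    intro q X
    rw [ha, tmon_sub]; ring
  by_cases hcone : ∀ x, (∀ q ∈ expts F ×ˢ S, a q x ≤ 0) → LinearMap.snd ℝ (RSp n) ℝ x ≤ 0
  · -- a non-negative combination of the differences `ℓ_m - ℓ_s` is identically one
    obtain ⟨c, hc, e⟩ := exists_nonneg_combination _ a _ hcone
    have hsum : 0 ≤ ∑ q ∈ expts F ×ˢ S, c q := Finset.sum_nonneg hc
    refine ⟨1 / (1 + ∑ q ∈ expts F ×ˢ S, c q), by positivity, fun X => ?_⟩
    by_contra hcon
    push Not at hcon
    have h1 := congrArg (fun f => f (X, (1 : ℝ))) e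
    simp only [LinearMap.snd_apply, LinearMap.sum_apply, LinearMap.smul_apply, smul_eq_mul,
      ha1] at h1
    have h2 : ∑ q ∈ expts F ×ˢ S, c q * (tmon F q.1 X - tmon F q.2 X) ≤
        ∑ q ∈ expts F ×ˢ S, c q * (1 / (1 + ∑ q ∈ expts F ×ˢ S, c q)) := by
      refine Finset.sum_le_sum fun q hq => mul_le_mul_of_nonneg_left ?_ (hc q hq)
      obtain ⟨hq1, hq2⟩ := Finset.mem_product.1 hq
      linarith [hcon q.2 hq2, tmon_le_trop hq1 X]
    rw [← h1, ← Finset.sum_mul, mul_one_div, le_div_iff₀ (by positivity)] at h2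
    linarith
  · exfalso
    push Not at hcone
    obtain ⟨⟨Y, c⟩, hY, hc⟩ := hcone
    change 0 < c at hc
    refine h ⟨c⁻¹ • Y, fun s hs => le_antisymm (tmon_le_trop (hS hs) _) ?_⟩
    obtain ⟨m, hm, e⟩ := exists_tmon_eq_trop hF (c⁻¹ • Y)
    rw [← e]
    have h1 := hY (m, s) (Finset.mem_product.2 ⟨hm, hs⟩)
    rw [ha] at h1
    have h2 := mul_nonpos_of_nonneg_of_nonpos (inv_nonneg.2 hc.le) h1
    rw [← sub_nonpos, tmon_sub, pair_smul_right]
    calc _ = c⁻¹ * (pair (toReal (m - s)) Y + (vv F m - vv F s : ℝ) * c) := by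
          field_simp; ring
      _ ≤ 0 := h2

/-- Tropical monomials that are nearly dominant at some point are simultaneously dominant at
another point. -/
theorem exists_uniform_gap (hF : (expts F).Nonempty) :
    ∃ ε > 0, ∀ X, ∃ Y, ∀ m ∈ expts F, trop F X - tmon F m X < ε → tmon F m Y = trop F Y := by
  classical
  have h1 : ∀ S : Finset (Lat n), ∃ ε > 0, S ⊆ expts F →
      (¬ ∃ Y, ∀ s ∈ S, tmon F s Y = trop F Y) → ∀ X, ∃ s ∈ S, ε ≤ trop F X - tmon F s X := by
    intro S
    by_cases hS : S ⊆ expts F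
    · by_cases h : ∃ Y, ∀ s ∈ S, tmon F s Y = trop F Y
      · exact ⟨1, one_pos, fun _ h' => absurd h h'⟩
      · obtain ⟨ε, hε, h'⟩ := exists_gap_of_not_dominant hF hS h
        exact ⟨ε, hε, fun _ _ => h'⟩
    · exact ⟨1, one_pos, fun h => absurd h hS⟩
  choose ε hε hgap using h1
  have hne : (expts F).powerset.Nonempty := Finset.powerset_nonempty _
  refine ⟨(expts F).powerset.inf' hne ε, (Finset.lt_inf'_iff hne).2 fun S _ => hε S, fun X => ?_⟩
  set S := (expts F).filter fun m => trop F X - tmon F m X < (expts F).powerset.inf' hne ε with hS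
  have hSA : S ⊆ expts F := Finset.filter_subset _ _
  by_contra hcon
  push Not at hcon
  obtain ⟨s, hs, h2⟩ := hgap S hSA (by
    rintro ⟨Y, hY⟩
    obtain ⟨m, hm, h3, h4⟩ := hcon Y
    exact h4 (hY m (Finset.mem_filter.2 ⟨hm, h3⟩))) X
  have h3 := (Finset.mem_filter.1 hs).2
  have h4 := Finset.inf'_le ε (Finset.mem_powerset.2 hSA)
  linarith

/-- The tropical monomials that are simultaneously dominant have affinely independent exponents:
for each of them there is an affine function that is one at its exponent and zero at the others. -/
def IsSimplicial (F : LPoly n) : Prop :=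
  ∀ X, ∀ j ∈ expts F, tmon F j X = trop F X → ∃ (w : RSp n) (c : ℝ),
    ∀ m ∈ expts F, tmon F m X = trop F X → pair (toReal m) w + c = if m = j then 1 else 0

/-- Every non-empty subset of a set of simultaneously dominant exponents is the set of dominant
exponents at some point. -/
theorem IsSimplicial.exists_dominant_iff (hsimp : IsSimplicial F) {S : Finset (Lat n)}
    (hS : S ⊆ expts F) (hne : S.Nonempty) {Y : RSp n} (hY : ∀ m ∈ S, tmon F m Y = trop F Y) :
    ∃ Z, ∀ m ∈ expts F, tmon F m Z = trop F Z ↔ m ∈ S := by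
  classical
  -- moving along `W` raises the monomials in `S` above the other dominant ones at equal speed
  choose! w c hwc using fun j (hj : j ∈ S) => hsimp Y j (hS hj) (hY j hj)
  have hW : ∀ m ∈ expts F, tmon F m Y = trop F Y →
      pair (toReal m) (∑ j ∈ S, w j) + ∑ j ∈ S, c j = if m ∈ S then 1 else 0 := by
    intro m hm hmY
    rw [pair_sum_right, ← Finset.sum_add_distrib,
      Finset.sum_congr rfl fun j hj => hwc j hj m hm hmY]
    simp
  set W := ∑ j ∈ S, w j
  set d := ∑ j ∈ S, c j
  have htm : ∀ m (t : ℝ), tmon F m (Y + t • W) = tmon F m Y + t * pair (toReal m) W := by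
    intro m t
    unfold tmon; rw [pair_add_right, pair_smul_right]; ring
  have hev : ∀ᶠ t in nhdsWithin (0 : ℝ) (Set.Ioi 0), ∀ m ∈ expts F, m ∉ S →
      tmon F m (Y + t • W) < trop F Y + t * (1 - d) := by
    rw [Filter.eventually_all_finset]
    intro m hm
    by_cases hmY : tmon F m Y = trop F Y
    · filter_upwards [self_mem_nhdsWithin] with t ht hmS
      have h1 := hW m hm hmY
      rw [if_neg hmS] at h1
      have ht' : 0 < t := ht
      rw [htm, hmY, show pair (toReal m) W = -d by linarith]
      nlinarith
    · have hlt : tmon F m Y < trop F Y := lt_of_le_of_ne (tmon_le_trop hm Y) hmY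
      have hc1 : Continuous fun t : ℝ =>
          trop F Y + t * (1 - d) - (tmon F m Y + t * pair (toReal m) W) := by
        fun_prop
      have h2 := hc1.tendsto 0
      simp only [zero_mul, add_zero] at h2
      filter_upwards [(h2.mono_left nhdsWithin_le_nhds).eventually_const_lt
        (sub_pos.2 hlt)] with t ht _
      rw [htm]
      linarith
  obtain ⟨t, ht, ht0⟩ := (hev.and self_mem_nhdsWithin).exists
  have hin : ∀ m ∈ S, tmon F m (Y + t • W) = trop F Y + t * (1 - d) := by
    intro m hm
    have h1 := hW m (hS hm) (hY m hm)
    rw [if_pos hm] at h1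
    rw [htm, hY m hm, show pair (toReal m) W = 1 - d by linarith]
  have htrop : trop F (Y + t • W) = trop F Y + t * (1 - d) := by
    obtain ⟨s, hs⟩ := hne
    obtain ⟨m, hm, e⟩ := exists_tmon_eq_trop ⟨s, hS hs⟩ (Y + t • W)
    have h1 := tmon_le_trop (hS hs) (Y + t • W)
    rw [hin s hs] at h1
    by_cases hmS : m ∈ S
    · rw [← e, hin m hmS]
    · have := ht m hm hmS
      linarith
  refine ⟨Y + t • W, fun m hm => ⟨fun h => ?_, fun h => by rw [hin m h, htrop]⟩⟩
  by_contra hmS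
  have := ht m hm hmS
  linarith

/-- Where two monomials are dominant, the derivative of the tropical polynomial would have to be the
slope of both. -/
theorem mem_tropV0_of_ne {X : RSp n} {m m' : Lat n} (hm : m ∈ expts F) (hm' : m' ∈ expts F)
    (hne : m ≠ m') (h : tmon F m X = trop F X) (h' : tmon F m' X = trop F X) : X ∈ tropV0 F := by
  intro hd
  have key : ∀ k ∈ expts F, tmon F k X = trop F X → ∀ v, fderiv ℝ (trop F) X v =
      pair (toReal k) v := by
    intro k hk hkX
    let L : RSp n →L[ℝ] ℝ := LinearMap.toContinuousLinearMap
      { toFun := fun v => pair (toReal k) v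
        map_add' := fun x y => pair_add_right _ _ _
        map_smul' := fun c x => pair_smul_right _ _ _ }
    have h1 : HasFDerivAt (fun Z => tmon F k Z) L X := by
      have : HasFDerivAt (fun Z => (vv F k : ℝ) + L Z) L X := L.hasFDerivAt.const_add _
      exact this
    have h2 := hd.hasFDerivAt.sub h1
    have h3 : IsLocalMin (trop F - fun Z => tmon F k Z) X := by
      refine Filter.Eventually.of_forall fun Z => ?_
      simp only [Pi.sub_apply]
      rw [hkX, sub_self]
      exact sub_nonneg.2 (tmon_le_trop hk Z)
    have h4 := h3.hasFDerivAt_eq_zero h2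
    intro v
    have := congrArg (fun f => f v) (sub_eq_zero.1 h4)
    exact this
  apply hne
  ext i
  have h1 := (key m hm h (Pi.single i 1)).symm.trans (key m' hm' h' (Pi.single i 1))
  simpa [pair, toReal, Pi.single_apply] using h1

end

/-! ### Unimodular simplices -/

section

/-- The standard corner simplex `{x | 0 ≤ x, ∑ x_i ≤ 1}`. -/
def corner (ι : Type*) [Fintype ι] : Set (ι → ℝ) := {x | (∀ i, 0 ≤ x i) ∧ ∑ i, x i ≤ 1}

/-- The volume of the corner simplex is at least `1 / N!`: the reflections of the simplex in the
coordinate hyperplanes cover the unit ball of the `ℓ¹` norm. -/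
theorem le_volume_corner (ι : Type*) [Fintype ι] :
    ENNReal.ofReal (1 / ((Fintype.card ι).factorial : ℝ)) ≤ MeasureTheory.volume (corner ι) := by
  classical
  let L : (ι → Bool) → (ι → ℝ) →ₗ[ℝ] (ι → ℝ) := fun s =>
    Matrix.toLin' (Matrix.diagonal fun i => if s i then (1 : ℝ) else -1)
  have hL : ∀ s x i, L s x i = (if s i then (1 : ℝ) else -1) * x i := by
    intro s x i
    simp [L, Matrix.mulVec_diagonal]
  have hvol : ∀ s, MeasureTheory.volume (L s '' corner ι) = MeasureTheory.volume (corner ι) := by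
    intro s
    rw [MeasureTheory.Measure.addHaar_image_linearMap, LinearMap.det_toLin', Matrix.det_diagonal,
      Finset.abs_prod]
    have : ∀ i, |if s i then (1 : ℝ) else -1| = 1 := by
      intro i; split_ifs <;> simp
    simp [this]
  have hsub : {x : ι → ℝ | ∑ i, |x i| ^ (1 : ℝ) < 1} ⊆ ⋃ s : ι → Bool, L s '' corner ι := by
    intro x hx
    have hx' : ∑ i, |x i| ^ (1 : ℝ) < 1 := hx
    simp only [Real.rpow_one] at hx'
    refine Set.mem_iUnion.2 ⟨fun i => decide (0 ≤ x i), fun i => |x i|,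
      ⟨fun i => abs_nonneg _, hx'.le⟩, ?_⟩
    ext i
    rw [hL]
    by_cases h : 0 ≤ x i
    · simp [h, abs_of_nonneg h]
    · simp [h, abs_of_neg (not_le.1 h)]
  have h1 := MeasureTheory.volume_sum_rpow_lt_one ι (p := 1) le_rfl
  have h2 : (2 * Real.Gamma (1 / 1 + 1)) ^ Fintype.card ι / Real.Gamma (Fintype.card ι / 1 + 1) =
      2 ^ Fintype.card ι * (1 / ((Fintype.card ι).factorial : ℝ)) := by
    rw [div_one, div_one, Real.Gamma_nat_eq_factorial, one_add_one_eq_two, Real.Gamma_two, mul_one,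
      mul_one_div]
  rw [h2, ENNReal.ofReal_mul (by positivity)] at h1
  have h3 : MeasureTheory.volume {x : ι → ℝ | ∑ i, |x i| ^ (1 : ℝ) < 1} ≤
      ENNReal.ofReal (2 ^ Fintype.card ι) * MeasureTheory.volume (corner ι) := by
    refine (MeasureTheory.measure_mono hsub).trans ((MeasureTheory.measure_iUnion_le _).trans ?_)
    rw [tsum_fintype]
    simp only [hvol]
    rw [Finset.sum_const, Finset.card_univ, Fintype.card_fun, Fintype.card_bool, nsmul_eq_mul]
    apply le_of_eq
    congr 1
    rw [ENNReal.ofReal_pow (by norm_num)]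
    simp
  rw [h1] at h3
  exact (ENNReal.mul_le_mul_iff_right (by positivity) ENNReal.ofReal_ne_top).1 h3

variable {n : ℕ}

/-- The edge matrix of a simplex with vertices `p`. -/
def edgeMatrix (p : Fin (n + 2) → RSp n) : Matrix (Fin (n + 1)) (Fin (n + 1)) ℝ :=
  Matrix.of fun r i => p i.succ r - p 0 r

theorem edgeMatrix_mulVec (p : Fin (n + 2) → RSp n) (x : Fin (n + 1) → ℝ) :
    (edgeMatrix p).mulVec x = ∑ i, x i • (p i.succ - p 0) := by
  ext r
  simp [edgeMatrix, Matrix.mulVec, dotProduct, mul_comm]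

theorem convexHull_range_eq_image_corner (p : Fin (n + 2) → RSp n) :
    convexHull ℝ (Set.range p) =
      (fun x => p 0 + (edgeMatrix p).mulVec x) '' corner (Fin (n + 1)) := by
  have h1 : convexHull ℝ (Set.range p) =
      (Fintype.linearCombination ℝ p) '' stdSimplex ℝ (Fin (n + 2)) := by
    rw [← convexHull_rangle_single_eq_stdSimplex, LinearMap.image_convexHull, ← Set.range_comp]
    congr 2
    ext i
    simp [Fintype.linearCombination_apply_single]
  rw [h1]
  ext x
  constructor
  · rintro ⟨w, ⟨hw0, hw1⟩, rfl⟩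
    rw [Fin.sum_univ_succ] at hw1
    refine ⟨fun i => w i.succ, ⟨fun i => hw0 _, by linarith [hw0 0]⟩, ?_⟩
    dsimp only
    rw [edgeMatrix_mulVec, Fintype.linearCombination_apply,
      Fin.sum_univ_succ (fun i => w i • p i)]
    simp only [smul_sub, Finset.sum_sub_distrib]
    rw [← Finset.sum_smul, eq_sub_of_add_eq hw1, sub_smul, one_smul]
    abel
  · rintro ⟨y, ⟨hy0, hy1⟩, rfl⟩
    refine ⟨Fin.cons (1 - ∑ i, y i) y, ⟨fun i => ?_, ?_⟩, ?_⟩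
    · refine Fin.cases ?_ (fun i => ?_) i
      · simpa using hy1
      · simpa using hy0 i
    · simp [Fin.sum_univ_succ]
    · dsimp only
      rw [edgeMatrix_mulVec, Fintype.linearCombination_apply, Fin.sum_univ_succ]
      simp only [Fin.cons_zero, Fin.cons_succ, smul_sub, Finset.sum_sub_distrib]
      rw [← Finset.sum_smul, sub_smul, one_smul]
      abel

/-- The edge matrix of a simplex of volume `1 / (n+1)!` has non-zero determinant of absolute value
at most one. -/
theorem det_edgeMatrix_of_volume {p : Fin (n + 2) → RSp n}
    (hvol : MeasureTheory.volume (convexHull ℝ (Set.range p)) =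
      ENNReal.ofReal (1 / ((n + 1).factorial : ℝ))) :
    (edgeMatrix p).det ≠ 0 ∧ |(edgeMatrix p).det| ≤ 1 := by
  have h1 : MeasureTheory.volume (convexHull ℝ (Set.range p)) =
      ENNReal.ofReal |(edgeMatrix p).det| * MeasureTheory.volume (corner (Fin (n + 1))) := by
    rw [convexHull_range_eq_image_corner, ← LinearMap.det_toLin',
      ← MeasureTheory.Measure.addHaar_image_linearMap, ← MeasureTheory.measure_preimage_add
        MeasureTheory.volume (p 0)]
    congr 1
    ext x
    simp only [Set.mem_preimage, Set.mem_image, Matrix.toLin'_apply]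
    constructor
    · rintro ⟨y, hy, h⟩
      exact ⟨y, hy, add_left_cancel h⟩
    · rintro ⟨y, hy, rfl⟩
      exact ⟨y, hy, rfl⟩
  rw [hvol] at h1
  have hpos : (0 : ℝ) < 1 / ((n + 1).factorial : ℝ) := by positivity
  have h2 := le_volume_corner (Fin (n + 1))
  rw [Fintype.card_fin] at h2
  constructor
  · intro h0
    rw [h0, abs_zero, ENNReal.ofReal_zero, zero_mul, ENNReal.ofReal_eq_zero] at h1
    exact absurd hpos (not_lt.2 h1)
  · have h3 : ENNReal.ofReal |(edgeMatrix p).det| * ENNReal.ofReal (1 / ((n + 1).factorial : ℝ)) ≤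
        ENNReal.ofReal (1 / ((n + 1).factorial : ℝ)) := by
      conv_rhs => rw [h1]
      exact mul_le_mul_right h2 _
    rw [← ENNReal.ofReal_mul (abs_nonneg _), ENNReal.ofReal_le_ofReal_iff hpos.le] at h3
    exact le_of_mul_le_mul_right (by linarith) hpos

/-- A simplex of volume `1 / (n+1)!` with lattice vertices contains no other lattice points, so
that its lattice points are separated by affine functions. -/
theorem exists_affine_of_unimodular {p : Fin (n + 2) → RSp n} {B : Set (Lat n)}
    (hvol : MeasureTheory.volume (convexHull ℝ (Set.range p)) =
      ENNReal.ofReal (1 / ((n + 1).factorial : ℝ)))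
    (hB : convexHull ℝ (Set.range p) = convexHull ℝ (toReal '' B)) (j : Lat n)
    (hj : toReal j ∈ convexHull ℝ (Set.range p)) :
    ∃ (w : RSp n) (c : ℝ), ∀ m : Lat n, toReal m ∈ convexHull ℝ (Set.range p) →
      pair (toReal m) w + c = if m = j then 1 else 0 := by
  classical
  obtain ⟨hdet, hdet1⟩ := det_edgeMatrix_of_volume hvol
  set M := edgeMatrix p with hM
  have hinv : M⁻¹ * M = 1 := Matrix.nonsing_inv_mul _ (isUnit_iff_ne_zero.2 hdet)
  -- the affine coordinates on the simplex
  let f : RSp n → RSp n := fun x => M⁻¹.mulVec (x - p 0)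
  have hf : ∀ x y, x = p 0 + M.mulVec y → f x = y := by
    rintro x y rfl
    simp only [f, add_sub_cancel_left, Matrix.mulVec_mulVec, hinv, Matrix.one_mulVec]
  have hfτ : ∀ x ∈ convexHull ℝ (Set.range p), x = p 0 + M.mulVec (f x) ∧ f x ∈ corner _ := by
    intro x hx
    rw [convexHull_range_eq_image_corner] at hx
    obtain ⟨y, hy, rfl⟩ := hx
    have := hf _ y rfl
    rw [this]
    exact ⟨rfl, hy⟩
  have hp : ∀ i : Fin (n + 1), f (p i.succ) = Pi.single i 1 := by
    intro i
    refine hf _ _ ?_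
    rw [edgeMatrix_mulVec, Finset.sum_eq_single i]
    · simp
    · intro k _ hk; simp [hk]
    · simp
  have hp0 : f (p 0) = 0 := by simp [f]
  have haff : ∀ (ι : Type) [Fintype ι] (w : ι → ℝ) (z : ι → RSp n), ∑ i, w i = 1 →
      f (∑ i, w i • z i) = ∑ i, w i • f (z i) := by
    intro ι _ w z hw
    simp only [f, ← Matrix.mulVec_smul, ← Matrix.mulVec_sum]
    congr 1
    simp only [smul_sub, Finset.sum_sub_distrib]
    rw [← Finset.sum_smul, hw, one_smul]
  -- the vertices are lattice points
  have hlat : ∀ i, ∃ m : Lat n, toReal m = p i := by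
    intro i
    have hi : p i ∈ convexHull ℝ (toReal '' B) := hB ▸ subset_convexHull ℝ _ ⟨i, rfl⟩
    obtain ⟨ι, _, w, z, hw0, hw1, hz, hsum⟩ := mem_convexHull_iff_exists_fintype.1 hi
    have hzτ : ∀ k, z k = p 0 + M.mulVec (f (z k)) ∧ f (z k) ∈ corner _ := fun k =>
      hfτ _ (hB ▸ subset_convexHull ℝ _ (hz k))
    have hsum' : f (p i) = ∑ k, w k • f (z k) := by rw [← hsum, haff ι w z hw1]
    obtain ⟨k, hk⟩ : ∃ k, 0 < w k := by
      by_contra hcon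
      push Not at hcon
      have : ∑ k, w k ≤ 0 := Finset.sum_nonpos fun k _ => hcon k
      linarith
    obtain ⟨m, -, hm⟩ := hz k
    refine ⟨m, hm.trans ?_⟩
    have hnn : ∀ i k, 0 ≤ f (z k) i := fun i k => (hzτ k).2.1 i
    have hle1 : ∀ k, ∑ i, f (z k) i ≤ 1 := fun k => (hzτ k).2.2
    rw [(hzτ k).1]
    have h0i : ∀ i', f (p i) i' = 0 → f (z k) i' = 0 := by
      intro i' h0
      rw [hsum', Finset.sum_apply] at h0
      have := (Finset.sum_eq_zero_iff_of_nonneg fun k _ => by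
        simp only [Pi.smul_apply, smul_eq_mul]
        exact mul_nonneg (hw0 k) (hnn i' k)).1 h0 k (Finset.mem_univ k)
      simp only [Pi.smul_apply, smul_eq_mul] at this
      exact (mul_eq_zero.1 this).resolve_left hk.ne'
    have key : f (z k) = f (p i) := by
      revert hsum' h0i
      refine Fin.cases ?_ (fun i => ?_) i
      · intro _ h0i
        rw [hp0] at h0i ⊢
        exact funext fun i' => h0i i' rfl
      · intro hsum' h0i
        rw [hp] at h0i hsum' ⊢
        have hi1 : ∀ k, f (z k) i ≤ 1 := fun k =>
          (Finset.single_le_sum (fun i' _ => hnn i' k) (Finset.mem_univ i)).trans (hle1 k)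
        have h3 := congrFun hsum' i
        rw [Finset.sum_apply, Pi.single_eq_same] at h3
        have h4 : ∑ k, w k * (1 - f (z k) i) = 0 := by
          simp only [mul_sub, mul_one, Finset.sum_sub_distrib, hw1]
          simp only [Pi.smul_apply, smul_eq_mul] at h3
          linarith
        have h5 := (Finset.sum_eq_zero_iff_of_nonneg fun k _ =>
          mul_nonneg (hw0 k) (sub_nonneg.2 (hi1 k))).1 h4 k (Finset.mem_univ k)
        have h6 := (mul_eq_zero.1 h5).resolve_left hk.ne'
        ext i'
        by_cases h : i' = i
        · subst h; rw [Pi.single_eq_same]; linarith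
        · rw [Pi.single_eq_of_ne h]; exact h0i i' (Pi.single_eq_of_ne h _)
    rw [key]
    revert key
    refine Fin.cases ?_ (fun i => ?_) i
    · intro _; rw [hp0]; simp
    · intro _
      rw [hp, edgeMatrix_mulVec, Finset.sum_eq_single i]
      · simp
      · intro k _ hk; simp [hk]
      · simp
  choose q hq using hlat
  -- the edge matrix is integral and unimodular, so lattice points have integral coordinates
  let MZ : Matrix (Fin (n + 1)) (Fin (n + 1)) ℤ := Matrix.of fun r i => q i.succ r - q 0 r
  have hMZ : M = MZ.map (Int.castRingHom ℝ) := by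
    ext r i
    simp [hM, edgeMatrix, MZ, ← hq, toReal]
  have hdetZ : M.det = ((MZ.det : ℤ) : ℝ) := by
    have := (Int.castRingHom ℝ).map_det MZ
    rw [hMZ]
    exact this.symm
  have hunit : IsUnit MZ.det := by
    rw [Int.isUnit_iff_abs_eq]
    rw [hdetZ] at hdet hdet1
    have h1 : |MZ.det| ≤ 1 := by exact_mod_cast hdet1
    have h2 : MZ.det ≠ 0 := by exact_mod_cast hdet
    have h3 := abs_pos.2 h2
    omega
  have hint : ∀ m : Lat n, ∃ z : Lat n, f (toReal m) = toReal z := by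
    intro m
    refine ⟨MZ⁻¹.mulVec (m - q 0), hf _ _ ?_⟩
    have h1 : MZ.mulVec (MZ⁻¹.mulVec (m - q 0)) = m - q 0 := by
      rw [Matrix.mulVec_mulVec, Matrix.mul_nonsing_inv _ hunit, Matrix.one_mulVec]
    ext r
    have h2 := congrArg (Int.castRingHom ℝ) (congrFun h1 r)
    rw [RingHom.map_mulVec, ← hMZ] at h2
    rw [← hq 0, Pi.add_apply]
    have h3 : toReal (MZ⁻¹.mulVec (m - q 0)) =
        (Int.castRingHom ℝ) ∘ (MZ⁻¹.mulVec (m - q 0)) := rfl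
    rw [h3, h2]
    simp [toReal]
  -- the lattice points of the simplex have coordinates `0` or a basis vector
  have hvert : ∀ m : Lat n, toReal m ∈ convexHull ℝ (Set.range p) →
      f (toReal m) = 0 ∨ ∃ i, f (toReal m) = Pi.single i 1 := by
    intro m hm
    obtain ⟨z, hz⟩ := hint m
    obtain ⟨-, h0, h1⟩ := hfτ _ hm
    rw [hz] at h0 h1 ⊢
    have h0' : ∀ i, 0 ≤ z i := fun i => by have := h0 i; simpa [toReal] using this
    have h1' : ∑ i, z i ≤ 1 := by
      have : ((∑ i, z i : ℤ) : ℝ) ≤ 1 := by push_cast; exact h1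
      exact_mod_cast this
    by_cases hz0 : ∀ i, z i = 0
    · left; ext i; simp [toReal, hz0 i]
    · right
      push Not at hz0
      obtain ⟨i, hi⟩ := hz0
      refine ⟨i, ?_⟩
      have h2 : 1 ≤ z i := by have := h0' i; omega
      have h3 : ∑ k ∈ Finset.univ.erase i, z k = 0 := by
        have h4 := Finset.add_sum_erase Finset.univ z (Finset.mem_univ i)
        have h5 : 0 ≤ ∑ k ∈ Finset.univ.erase i, z k := Finset.sum_nonneg fun k _ => h0' k
        omega
      have h4 := Finset.add_sum_erase Finset.univ z (Finset.mem_univ i)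
      have h6 : z i = 1 := by omega
      ext k
      by_cases hk : k = i
      · subst hk; simp [toReal, h6]
      · rw [Pi.single_eq_of_ne hk]
        have := (Finset.sum_eq_zero_iff_of_nonneg fun k _ => h0' k).1 h3 k (by simp [hk])
        simp [toReal, this]
  have hfinj : ∀ m m' : Lat n, toReal m ∈ convexHull ℝ (Set.range p) →
      toReal m' ∈ convexHull ℝ (Set.range p) → f (toReal m) = f (toReal m') → m = m' := by
    intro m m' hm hm' h
    apply toReal_injective
    rw [(hfτ _ hm).1, (hfτ _ hm').1, h]
  let row : Fin (n + 1) → RSp n := fun k r => M⁻¹ k r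
  have hpair : ∀ x k, pair x (row k) + -(pair (p 0) (row k)) = f x k := by
    intro x k
    rw [← sub_eq_add_neg, ← pair_sub_left]
    simp [f, row, pair, Matrix.mulVec, dotProduct, mul_comm]
  rcases hvert j hj with h | ⟨i, h⟩
  · refine ⟨-∑ k, row k, 1 + ∑ k, pair (p 0) (row k), fun m hm => ?_⟩
    have h1 : pair (toReal m) (-∑ k, row k) + (1 + ∑ k, pair (p 0) (row k)) =
        1 - ∑ k, f (toReal m) k := by
      simp only [← hpair, Finset.sum_add_distrib, Finset.sum_neg_distrib]
      rw [← neg_one_smul ℝ, pair_smul_right, pair_sum_right]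
      ring
    rw [h1]
    rcases hvert m hm with h' | ⟨i', h'⟩
    · rw [if_pos (hfinj m j hm hj (h'.trans h.symm)), h']; simp
    · rw [if_neg, h']
      · simp
      · rintro rfl
        have := congrFun (h'.symm.trans h) i'
        simp at this
  · refine ⟨row i, -(pair (p 0) (row i)), fun m hm => ?_⟩
    rw [hpair]
    rcases hvert m hm with h' | ⟨i', h'⟩
    · rw [if_neg, h']
      · simp
      · rintro rfl
        have := congrFun (h'.symm.trans h) i
        simp at this
    · by_cases hii : i' = i
      · subst hii
        rw [if_pos (hfinj m j hm hj (h'.trans h.symm)), h', Pi.single_eq_same]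
      · rw [if_neg, h', Pi.single_eq_of_ne (Ne.symm hii)]
        rintro rfl
        have := congrFun (h'.symm.trans h) i
        rw [Pi.single_eq_of_ne (Ne.symm hii), Pi.single_eq_same] at this
        exact zero_ne_one this

/-! ### Smoothness of the tropical hypersurface -/

/-- The face of a convex hull on which a linear functional attains its maximum `c` is the convex
hull of the generators in it. -/
theorem convexHull_inter_eq_of_le {E : Type*} [AddCommGroup E] [Module ℝ E] {T : Set E}
    (l : E →ₗ[ℝ] ℝ) {c : ℝ} (h : ∀ x ∈ T, l x ≤ c) :
    {x ∈ convexHull ℝ T | l x = c} = convexHull ℝ {x ∈ T | l x = c} := by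
  classical
  apply Set.Subset.antisymm
  · rintro x ⟨hx, hxc⟩
    obtain ⟨ι, _, w, z, hw0, hw1, hz, rfl⟩ := mem_convexHull_iff_exists_fintype.1 hx
    have h0 : ∑ i, w i * (c - l (z i)) = 0 := by
      simp only [mul_sub, Finset.sum_sub_distrib]
      rw [← Finset.sum_mul, hw1, one_mul, ← hxc, map_sum]
      simp
    rw [Finset.sum_eq_zero_iff_of_nonneg fun i _ =>
      mul_nonneg (hw0 i) (sub_nonneg.2 (h _ (hz i)))] at h0
    rw [← Finset.sum_filter_of_ne (p := fun i => w i ≠ 0)]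
    · refine (convex_convexHull ℝ _).sum_mem (fun i _ => hw0 i) ?_ ?_
      · rw [← hw1]
        exact Finset.sum_filter_ne_zero _
      · intro i hi
        refine subset_convexHull ℝ _ ⟨hz i, ?_⟩
        have := (mul_eq_zero.1 (h0 i (Finset.mem_univ i))).resolve_left (Finset.mem_filter.1 hi).2
        linarith
    · intro i _ hne h0
      rw [h0, zero_smul] at hne
      exact hne rfl
  · refine convexHull_min ?_ ?_
    · rintro x ⟨hx, hxc⟩
      exact ⟨subset_convexHull ℝ _ hx, hxc⟩
    · exact (convex_convexHull ℝ T).inter (convex_hyperplane l.isLinear c)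

variable {F : LPoly n}

theorem le_of_mem_convexHull {E : Type*} [AddCommGroup E] [Module ℝ E] {T : Set E}
    (l : E →ₗ[ℝ] ℝ) {c : ℝ} (h : ∀ x ∈ T, l x ≤ c) : ∀ x ∈ convexHull ℝ T, l x ≤ c :=
  fun _ hx => convexHull_min (s := T) (t := {x | l x ≤ c}) h (convex_halfSpace_le l.isLinear c) hx

/-- The polytopes of the subdivision have exponents of `F` as vertices. -/
theorem exists_eq_of_mem_subdivision {τ : Set (RSp n)} (hτ : τ ∈ subdivision F) :
    ∃ B : Set (Lat n), B ⊆ expts F ∧ τ = convexHull ℝ (toReal '' B) := by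
  obtain ⟨G, hG, hne, -, rfl⟩ := hτ
  obtain ⟨l, hl⟩ := hG hne
  obtain ⟨x₀, hx₀⟩ := hne
  rw [hl] at hx₀
  have h1 : G = {x ∈ convexHull ℝ (hypograph F) | l x = l x₀} := by
    rw [hl]
    ext x
    refine and_congr_right fun hx => ⟨fun h => le_antisymm (hx₀.2 x hx) (h _ hx₀.1), fun h => ?_⟩
    rw [h]; exact hx₀.2
  have h2 := convexHull_inter_eq_of_le (l : RSp n × ℝ →ₗ[ℝ] ℝ) (T := hypograph F) (c := l x₀)
    fun x hx => hx₀.2 x (subset_convexHull ℝ _ hx)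
  have h3 : G = convexHull ℝ {x ∈ hypograph F | l x = l x₀} := h1.trans h2
  refine ⟨{m | m ∈ expts F ∧ ∃ r, (toReal m, r) ∈ {x ∈ hypograph F | l x = l x₀}},
    fun m hm => hm.1, ?_⟩
  have h4 : Prod.fst '' G = (LinearMap.fst ℝ (RSp n) ℝ) '' G := rfl
  rw [h4, h3, LinearMap.image_convexHull]
  congr 1
  ext y
  constructor
  · rintro ⟨⟨_, r⟩, ⟨⟨m, hm, rfl, hr⟩, hxl⟩, rfl⟩
    exact ⟨m, ⟨hm, r, ⟨m, hm, rfl, hr⟩, hxl⟩, rfl⟩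
  · rintro ⟨m, ⟨hm, r, hr⟩, rfl⟩
    exact ⟨_, hr, rfl⟩

theorem finite_subdivision (F : LPoly n) : (subdivision F).Finite := by
  refine Set.Finite.subset (((expts F).finite_toSet.finite_subsets).image
    fun B => convexHull ℝ (toReal '' B)) fun τ hτ => ?_
  obtain ⟨B, hB, rfl⟩ := exists_eq_of_mem_subdivision hτ
  exact ⟨B, hB, rfl⟩

/-- The exponents that are dominant at `X` span a polytope of the subdivision: it is the projection
of the face on which `(y, r) ↦ ⟨y, X⟩ + r` is maximal. -/
theorem convexHull_dominant_mem_subdivision (hF : (expts F).Nonempty) (X : RSp n) :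
    convexHull ℝ (toReal '' {m | m ∈ expts F ∧ tmon F m X = trop F X}) ∈ subdivision F := by
  let l : RSp n × ℝ →L[ℝ] ℝ := LinearMap.toContinuousLinearMap
    { toFun := fun p => pair p.1 X + p.2
      map_add' := fun x y => by
        simp only [Prod.fst_add, Prod.snd_add, pair_add_left]; ring
      map_smul' := fun c x => by
        simp only [Prod.smul_fst, Prod.smul_snd, pair_smul_left, smul_eq_mul, RingHom.id_apply]
        ring }
  have hl : ∀ p, l p = pair p.1 X + p.2 := fun _ => rfl
  have hle : ∀ p ∈ hypograph F, (l : RSp n × ℝ →ₗ[ℝ] ℝ) p ≤ trop F X := by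
    rintro ⟨_, r⟩ ⟨m, hm, rfl, hr⟩
    have := tmon_le_trop hm X
    change pair (toReal m) X + r ≤ _
    unfold tmon at this
    dsimp only at hr
    linarith
  have hle' := le_of_mem_convexHull _ hle
  have hset : {x ∈ hypograph F | l x = trop F X} = (fun m => (toReal m, (vv F m : ℝ))) ''
      {m | m ∈ expts F ∧ tmon F m X = trop F X} := by
    ext ⟨y, r⟩
    constructor
    · rintro ⟨⟨m, hm, h1, hr⟩, hxl⟩
      dsimp only at h1 hr
      subst h1
      have h2 := tmon_le_trop hm X
      rw [hl] at hxl
      unfold tmon at h2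
      dsimp only at hxl
      have h3 : r = vv F m := by linarith
      refine ⟨m, ⟨hm, ?_⟩, by rw [h3]⟩
      unfold tmon
      linarith
    · rintro ⟨m, ⟨hm, h⟩, e⟩
      obtain ⟨rfl, rfl⟩ := Prod.mk.inj e
      refine ⟨⟨m, hm, rfl, le_rfl⟩, ?_⟩
      rw [hl, ← h]
      unfold tmon
      dsimp only
      ring
  obtain ⟨m₀, hm₀, e₀⟩ := exists_tmon_eq_trop hF X
  have hmem : (toReal m₀, (vv F m₀ : ℝ)) ∈ {x ∈ hypograph F | l x = trop F X} := by
    rw [hset]; exact ⟨m₀, ⟨hm₀, e₀⟩, rfl⟩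
  have hG : l.toExposed (convexHull ℝ (hypograph F)) =
      convexHull ℝ {x ∈ hypograph F | l x = trop F X} := by
    rw [← show _ = convexHull ℝ {x ∈ hypograph F | l x = trop F X} from
      convexHull_inter_eq_of_le (l : RSp n × ℝ →ₗ[ℝ] ℝ) hle]
    ext x
    refine and_congr_right fun hx => ⟨fun h => le_antisymm (hle' x hx) ?_, fun h y hy => ?_⟩
    · have := h _ (subset_convexHull ℝ _ hmem.1)
      rwa [hmem.2] at this
    · exact (hle' y hy).trans h.ge
  refine ⟨_, ContinuousLinearMap.toExposed.isExposed (l := l), ?_, ?_, ?_⟩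
  · rw [hG]; exact ⟨_, subset_convexHull ℝ _ hmem⟩
  · rw [hG, isBounded_convexHull, hset]
    refine Set.Finite.isBounded (Set.Finite.image _ ?_)
    exact (expts F).finite_toSet.subset fun m hm => hm.1
  · have h4 : ∀ G : Set (RSp n × ℝ), Prod.fst '' G = (LinearMap.fst ℝ (RSp n) ℝ) '' G :=
      fun _ => rfl
    rw [hG, hset, h4, LinearMap.image_convexHull, Set.image_image]
    rfl

/-- The exponents that are dominant at a point are lattice points of a maximal polytope of the
subdivision, which is a unimodular simplex. -/
theorem IsSmooth.isSimplicial (hF : (expts F).Nonempty) (h : IsSmooth F) : IsSimplicial F := by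
  intro X j hj hjX
  obtain ⟨τ, hle, hmax⟩ := (finite_subdivision F).exists_le_maximal
    (convexHull_dominant_mem_subdivision hF X)
  obtain ⟨⟨p, -, rfl⟩, hvol⟩ := h τ hmax
  obtain ⟨B, -, hB⟩ := exists_eq_of_mem_subdivision hmax.prop
  have hmem : ∀ m ∈ expts F, tmon F m X = trop F X → toReal m ∈ convexHull ℝ (Set.range p) :=
    fun m hm hmX => hle (subset_convexHull ℝ _ ⟨m, ⟨hm, hmX⟩, rfl⟩)
  obtain ⟨w, c, hwc⟩ := exists_affine_of_unimodular hvol hB j (hmem j hj hjX)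
  exact ⟨w, c, fun m hm hmX => hwc m (hmem m hm hmX)⟩

end

/-! ### Cells of the tropical hypersurface -/

section

variable {n : ℕ} {𝓕 : Fan n} {F : LPoly n} [hU : Fact 𝓕.IsUnimodular]

/-- The part in the orbit closure of `τ` of the locus where all exponents in `S` are dominant. -/
def cell (F : LPoly n) (S : Finset (Lat n)) (τ : 𝓕.cones) : Set (ToricVar 𝓕 TT) :=
  {x | S ⊆ dom F x ∧ τ ≤ typ x}

variable [hC : Fact (IsCompatible 𝓕 F)]

theorem closure_cellThrough (X : RSp n) :
    closure (realPoint 𝓕 '' cellThrough F X) =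
      cell F (dom F (realPoint 𝓕 X)) 𝓕.zeroCone := by
  have h1 : cellThrough F X = {Y | dom F (realPoint 𝓕 X) ⊆ dom F (realPoint 𝓕 Y)} := by
    ext Y
    simp only [cellThrough, Set.mem_ofPred_eq, Finset.subset_iff, mem_dom_realPoint_iff]
    exact ⟨fun h m hm => ⟨hm.1, h m hm.1 hm.2⟩, fun h m hm hmX => (h ⟨hm, hmX⟩).2⟩
  rw [h1, closure_realPoint_dom]
  ext x
  exact ⟨fun h => ⟨h, zeroCone_le _⟩, fun h => h.1⟩

/-- The cells are the non-empty sets `cell F S τ`, for the sets `S` of dominant exponents at the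
points of the real tropical hypersurface. -/
theorem mem_cells_iff {μ : Set (ToricVar 𝓕 TT)} :
    μ ∈ cells 𝓕 F ↔ μ.Nonempty ∧ ∃ X ∈ tropV0 F, ∃ τ : 𝓕.cones,
      μ = cell F (dom F (realPoint 𝓕 X)) τ := by
  have hinter : ∀ X (τ : 𝓕.cones), closure (realPoint 𝓕 '' cellThrough F X) ∩
      orbitClosure 𝓕 TT τ = cell F (dom F (realPoint 𝓕 X)) τ := by
    intro X τ
    rw [closure_cellThrough]
    ext x
    rw [Set.mem_inter_iff, mem_orbitClosure_iff]
    exact ⟨fun h => ⟨h.1.1, h.2⟩, fun h => ⟨⟨h.1, zeroCone_le _⟩, h.2⟩⟩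
  refine and_congr_right fun _ => ⟨?_, ?_⟩
  · rintro (⟨X, hX, rfl⟩ | ⟨_, ⟨X, hX, rfl⟩, τ, rfl⟩)
    · exact ⟨X, hX, 𝓕.zeroCone, closure_cellThrough X⟩
    · exact ⟨X, hX, τ, hinter X τ⟩
  · rintro ⟨X, hX, τ, rfl⟩
    exact Or.inr ⟨_, ⟨X, hX, rfl⟩, τ, (hinter X τ).symm⟩

theorem exists_typ_eq_dom_eq (x : ToricVar 𝓕 TT) {τ : 𝓕.cones} (h : τ ≤ typ x) :
    ∃ y : ToricVar 𝓕 TT, typ y = τ ∧ dom F y = dom F x := by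
  obtain ⟨Y, -, hY⟩ := exists_tendsto_dom_eq (F := F) x h
  obtain ⟨k, hk⟩ := hY.exists
  exact ⟨_, typ_pt _ _, hk⟩

/-- A non-empty cell at infinity has a point in the orbit of its cone that lies in no smaller
cell: a point with as few dominant exponents as possible. -/
theorem exists_mem_relint_typ_eq {S : Finset (Lat n)} (hS : S.Nonempty) {τ : 𝓕.cones}
    (hne : (cell (𝓕 := 𝓕) F S τ).Nonempty) :
    ∃ y ∈ relint 𝓕 F (cell F S τ), typ y = τ := by
  classical
  have hex : ∃ k, ∃ y : ToricVar 𝓕 TT, typ y = τ ∧ S ⊆ dom F y ∧ (dom F y).card = k := by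
    obtain ⟨x, hx, hx'⟩ := hne
    obtain ⟨y, hy, hy'⟩ := exists_typ_eq_dom_eq (F := F) x hx'
    exact ⟨_, y, hy, hy' ▸ hx, rfl⟩
  obtain ⟨y, hy, hSy, hcard⟩ := Nat.find_spec hex
  refine ⟨y, ⟨⟨hSy, hy.ge⟩, ?_⟩, hy⟩
  rintro ν hν hlt hyν
  obtain ⟨-, X, -, τ', rfl⟩ := mem_cells_iff.1 hν
  apply hlt.2
  intro z hz
  obtain ⟨z', hz', hdz'⟩ := exists_typ_eq_dom_eq (F := F) z hz.2
  obtain ⟨s, hs⟩ := hS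
  have hyz : typ y = typ z' := hy.trans hz'.symm
  -- the midpoint of two points has the common dominant exponents
  have h1 : dom F (comb (1 / 2) y z') ⊆ dom F y := fun m hm =>
    (dom_comb_subset hyz (by norm_num) (hSy hs) (hdz' ▸ hz.1 hs) hm).1
  have h2 : dom F (comb (1 / 2) y z') ⊆ dom F z' := fun m hm =>
    (dom_comb_subset hyz (by norm_num) (hSy hs) (hdz' ▸ hz.1 hs) hm).2
  have h3 : Nat.find hex ≤ (dom F (comb (1 / 2) y z')).card :=
    Nat.find_min' hex ⟨_, (typ_comb _ _ _).trans hy, fun m hm =>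
      inter_dom_subset_dom_comb hyz (by norm_num) (hSy hm) (hdz' ▸ hz.1 hm), rfl⟩
  have h4 : dom F (comb (1 / 2) y z') = dom F y :=
    Finset.eq_of_subset_of_card_le h1 (hcard.le.trans h3)
  refine ⟨hyν.1.trans (h4 ▸ h2.trans hdz'.le), hyν.2.trans (hy.le.trans hz.2)⟩

/-- The points of a cell in a smaller orbit lie in a proper face at infinity. -/
theorem relint_cell_subset_orbit {X : RSp n} (hX : X ∈ tropV0 F) (τ : 𝓕.cones) :
    relint 𝓕 F (cell F (dom F (realPoint 𝓕 X)) τ) ⊆ orbit 𝓕 TT τ := by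
  rintro x ⟨⟨hx, hx'⟩, hmin⟩
  rw [mem_orbit_iff]
  by_contra hne
  refine hmin (cell F (dom F (realPoint 𝓕 X)) (typ x))
    (mem_cells_iff.2 ⟨⟨x, hx, le_rfl⟩, X, hX, _, rfl⟩) ?_ ⟨hx, le_rfl⟩
  refine ⟨fun z hz => ⟨hz.1, hx'.trans hz.2⟩, fun hsub => ?_⟩
  obtain ⟨y, hy, hy'⟩ := exists_typ_eq_dom_eq (F := F) x hx'
  have : typ x ≤ typ y := (hsub ⟨hy' ▸ hx, hy.ge⟩).2
  exact hne (le_antisymm (hy ▸ this) hx')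

theorem cell_mem_cellsAt {X : RSp n} (hX : X ∈ tropV0 F) {τ : 𝓕.cones}
    (hne : (cell F (dom F (realPoint 𝓕 X)) τ).Nonempty) :
    cell F (dom F (realPoint 𝓕 X)) τ ∈ cellsAt 𝓕 F τ :=
  ⟨mem_cells_iff.2 ⟨hne, X, hX, τ, rfl⟩, relint_cell_subset_orbit hX τ⟩

theorem exists_eq_cell_of_mem_cellsAt_zeroCone {μ : Set (ToricVar 𝓕 TT)}
    (hμ : μ ∈ cellsAt 𝓕 F 𝓕.zeroCone) :
    ∃ X ∈ tropV0 F, μ = cell F (dom F (realPoint 𝓕 X)) 𝓕.zeroCone := by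
  obtain ⟨hc, hr⟩ := hμ
  obtain ⟨hne, X, hX, τ, rfl⟩ := mem_cells_iff.1 hc
  obtain ⟨y, hy, rfl⟩ := exists_mem_relint_typ_eq (dom_nonempty _) hne
  have := mem_orbit_iff.1 (hr hy)
  exact ⟨X, hX, by rw [this]⟩

omit hC in
theorem domExpts_cell (X : RSp n) :
    domExpts 𝓕 F (cell F (dom F (realPoint 𝓕 X)) 𝓕.zeroCone) =
      (dom F (realPoint 𝓕 X) : Set (Lat n)) := by
  ext m
  constructor
  · rintro ⟨hm, h⟩
    exact mem_dom_realPoint_iff.2 ⟨hm, h X ⟨subset_rfl, zeroCone_le _⟩⟩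
  · intro hm
    refine ⟨(mem_dom.1 hm).1, fun Y hY => (mem_dom_realPoint_iff.1 (hY.1 hm)).2⟩

/-- Two dominant monomials put a point, possibly at infinity, on the tropical hypersurface. -/
theorem mem_tropV_of_ne {x : ToricVar 𝓕 TT} {m m' : Lat n} (hne : m ≠ m') (hm : m ∈ dom F x)
    (hm' : m' ∈ dom F x) : x ∈ tropV 𝓕 F := by
  classical
  have h1 : x ∈ closure (realPoint 𝓕 '' {X | {m, m'} ⊆ dom F (realPoint 𝓕 X)}) := by
    rw [closure_realPoint_dom]
    intro k hk
    rcases Finset.mem_insert.1 hk with rfl | hk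
    · exact hm
    · rwa [Finset.mem_singleton.1 hk]
  refine closure_mono (Set.image_mono fun X hX => ?_) h1
  have h2 := mem_dom_realPoint_iff.1 (hX (Finset.mem_insert_self m _))
  have h3 := mem_dom_realPoint_iff.1 (hX (Finset.mem_insert_of_mem (Finset.mem_singleton_self m')))
  exact mem_tropV0_of_ne h2.1 h3.1 hne h2.2 h3.2

end

/-! ### The image of the tropical localization -/

section

variable {n : ℕ} {𝓕 : Fan n} {F : LPoly n}

/-- The exponents whose tropical monomials differ from the maximum by less than `C`. -/
def nearDom (F : LPoly n) (C : ℝ) (X : RSp n) : Finset (Lat n) :=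
  (expts F).filter fun m => trop F X - tmon F m X < C

theorem mem_nearDom {C : ℝ} {X : RSp n} {m : Lat n} :
    m ∈ nearDom F C X ↔ m ∈ expts F ∧ trop F X - tmon F m X < C := Finset.mem_filter

theorem texp_logT {R : ℝ} (hR : 1 < R) (c : ℂ) :
    texp (logT R c) = ‖c‖ ^ (1 / Real.log R) := by
  unfold logT
  split_ifs with h
  · rw [h, norm_zero, Real.zero_rpow (one_div_pos.2 (Real.log_pos hR)).ne', texp_bot]
  · rw [texp_coe, Real.rpow_def_of_pos (norm_pos_iff.2 h), Real.logb, mul_one_div]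

theorem continuous_logT {R : ℝ} (hR : 1 < R) : Continuous (logT R) := by
  rw [texp_isEmbedding.continuous_iff]
  have : texp ∘ logT R = fun c : ℂ => ‖c‖ ^ (1 / Real.log R) := funext (texp_logT hR)
  rw [this]
  exact continuous_norm.rpow_const fun _ => Or.inr (one_div_pos.2 (Real.log_pos hR)).le

theorem continuous_Log {R : ℝ} (hR : 1 < R) : Continuous (Log 𝓕 R) := by
  have h (σ : 𝓕.cones) :
      Continuous (Chart.log R : Chart (σ : PointedCone ℝ (RSp n)) ℂ → _) :=
    Continuous.subtype_mk (continuous_pi fun m =>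
      (continuous_logT hR).comp ((continuous_apply m).comp continuous_subtype_val)) _
  have h' : Continuous fun a : Σ σ : 𝓕.cones, Chart (σ : PointedCone ℝ (RSp n)) ℂ =>
      ToricVar.mk (𝓕 := 𝓕) a.1 (Chart.log R a.2) :=
    continuous_sigma fun σ => (continuous_mk σ).comp (h σ)
  exact continuous_quot_lift _ h'

theorem monomial_ne_zero (m : Lat n) (x : Fin (n + 1) → ℂˣ) : monomial m x ≠ 0 := Units.ne_zero _

theorem logb_zpow (R a : ℝ) (k : ℤ) : Real.logb R (a ^ k) = k * Real.logb R a := by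
  rw [Real.logb, Real.log_zpow, mul_div_assoc, Real.logb]

theorem logb_norm_monomial (R : ℝ) (m : Lat n) (x : Fin (n + 1) → ℂˣ) :
    Real.logb R ‖monomial m x‖ = pair (toReal m) fun i => Real.logb R ‖(x i : ℂ)‖ := by
  have h1 : monomial m x = ∏ i, (x i : ℂ) ^ m i := by
    simp [monomial]
  rw [h1, norm_prod, Real.logb_prod]
  · refine Finset.sum_congr rfl fun i _ => ?_
    rw [norm_zpow, logb_zpow]
    rfl
  · intro i _
    exact norm_ne_zero_iff.2 (zpow_ne_zero _ (x i).ne_zero)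

theorem Log_complexPoint (R : ℝ) (x : Fin (n + 1) → ℂˣ) :
    Log 𝓕 R (complexPoint 𝓕 x) = realPoint 𝓕 fun i => Real.logb R ‖(x i : ℂ)‖ := by
  change ToricVar.mk 𝓕.zeroCone _ = ToricVar.mk 𝓕.zeroCone _
  congr 1
  refine Subtype.ext (funext fun m => ?_)
  change logT R (monomial (m : Lat n) x) = _
  rw [logT, if_neg (monomial_ne_zero _ _), logb_norm_monomial]

theorem logb_norm_term {R : ℝ} (hR : 1 < R) (m : Lat n) (x : Fin (n + 1) → ℂˣ) :
    Real.logb R ‖(R : ℂ) ^ vv F m * monomial m x‖ =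
      tmon F m fun i => Real.logb R ‖(x i : ℂ)‖ := by
  have hR0 : (0 : ℝ) < R := one_pos.trans hR
  have h1 : (R : ℂ) ^ vv F m ≠ 0 := zpow_ne_zero _ (by exact_mod_cast hR0.ne')
  rw [norm_mul, Real.logb_mul (norm_ne_zero_iff.2 h1) (norm_ne_zero_iff.2 (monomial_ne_zero _ _)),
    logb_norm_monomial, norm_zpow, Complex.norm_real, Real.norm_of_nonneg hR0.le, logb_zpow,
    Real.logb_self_eq_one hR, mul_one]
  rfl

/-- At the logarithm of a zero of the localized polynomial at least two monomials are nearly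
dominant, as a single non-zero term cannot vanish. -/
theorem one_lt_card_nearDom {C₀ C₁ R : ℝ} {b : ℝ → ℝ} (hF : (expts F).Nonempty) (hC₀ : 0 < C₀)
    (hb : IsCutoff C₀ C₁ b) (hR : 1 < R) {x : Fin (n + 1) → ℂˣ}
    (hx : fTilde F b R (R : ℂ) x = 0) :
    1 < (nearDom F C₀ fun i => Real.logb R ‖(x i : ℂ)‖).card := by
  classical
  set X : RSp n := fun i => Real.logb R ‖(x i : ℂ)‖ with hX
  obtain ⟨m₀, hm₀, e₀⟩ := exists_tmon_eq_trop hF X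
  have hb0 : ∀ m ∈ expts F, bFun F b R (R : ℂ) m x = 0 ↔ m ∉ nearDom F C₀ X := by
    intro m hm
    rw [bFun, Finset.prod_eq_zero_iff]
    simp only [hb.eq_zero_iff, logb_norm_term hR, ← hX, mem_nearDom, not_and, not_lt]
    constructor
    · rintro ⟨i, hi, h⟩ _
      linarith [tmon_le_trop hi X]
    · intro h
      exact ⟨m₀, hm₀, by rw [e₀]; exact h hm⟩
  have hm₀' : m₀ ∈ nearDom F C₀ X := mem_nearDom.2 ⟨hm₀, by rw [e₀, sub_self]; exact hC₀⟩
  by_contra hcard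
  have hsub : ∀ m ∈ nearDom F C₀ X, m = m₀ := fun m hm =>
    Finset.card_le_one.1 (not_lt.1 hcard) m hm m₀ hm₀'
  rw [fTilde, Finset.sum_eq_single m₀] at hx
  · have h1 : (bFun F b R (R : ℂ) m₀ x : ℂ) ≠ 0 := by
      rw [Ne, Complex.ofReal_eq_zero, hb0 m₀ hm₀, not_not]
      exact hm₀'
    have h2 : (R : ℂ) ^ vv F m₀ ≠ 0 :=
      zpow_ne_zero _ (by exact_mod_cast (one_pos.trans hR).ne')
    exact mul_ne_zero h1 (mul_ne_zero h2 (monomial_ne_zero _ _)) hx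
  · intro m hm hne
    rw [(hb0 m hm).2 fun h => hne (hsub m h)]
    simp
  · exact fun h => absurd hm₀ h

/-- A point of `Log_R(W_R)` is a limit of points of `ℝ^(n+1)` that all have the same set of nearly
dominant exponents, as there are finitely many such sets. -/
theorem exists_mem_closure_nearDom_eq {C₀ C₁ R : ℝ} {b : ℝ → ℝ} (hF : (expts F).Nonempty)
    (hC₀ : 0 < C₀) (hb : IsCutoff C₀ C₁ b) (hR : 1 < R) {x : ToricVar 𝓕 TT}
    (hx : x ∈ logW 𝓕 F b R) :
    ∃ S : Finset (Lat n), 1 < S.card ∧ x ∈ closure (realPoint 𝓕 '' {X | nearDom F C₀ X = S}) := by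
  classical
  obtain ⟨y, hy, rfl⟩ := hx
  have h1 := image_closure_subset_closure_image (continuous_Log (𝓕 := 𝓕) hR) ⟨y, hy, rfl⟩
  let 𝒮 := (expts F).powerset.filter fun S => 1 < S.card
  have h2 : Log 𝓕 R '' (complexPoint 𝓕 '' {x | fTilde F b R (R : ℂ) x = 0}) ⊆
      ⋃ S ∈ 𝒮, realPoint 𝓕 '' {X | nearDom F C₀ X = S} := by
    rintro _ ⟨_, ⟨z, hz, rfl⟩, rfl⟩
    rw [Log_complexPoint]
    refine Set.mem_iUnion₂.2 ⟨_, Finset.mem_filter.2 ⟨Finset.mem_powerset.2 ?_,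
      one_lt_card_nearDom hF hC₀ hb hR hz⟩, _, rfl, rfl⟩
    exact Finset.filter_subset _ _
  have h3 := closure_mono h2 h1
  rw [Finset.closure_biUnion] at h3
  obtain ⟨S, hS, h4⟩ := Set.mem_iUnion₂.1 h3
  exact ⟨S, (Finset.mem_filter.1 hS).2, h4⟩

variable [hU : Fact 𝓕.IsUnimodular] [hC : Fact (IsCompatible 𝓕 F)]

/-- Closeness to the maximum on a set of real points passes to heights on its closure. -/
theorem exp_neg_le_hgt_of_mem_closure {C : ℝ} {s : Set (RSp n)} {m : Lat n} (hm : m ∈ expts F)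
    (hs : ∀ X ∈ s, trop F X - tmon F m X < C) {x : ToricVar 𝓕 TT}
    (hx : x ∈ closure (realPoint 𝓕 '' s)) : Real.exp (-C) ≤ hgt F x m := by
  refine closure_minimal (t := {x | Real.exp (-C) ≤ hgt F x m}) ?_
    (isClosed_le continuous_const (continuous_hgt hm)) hx
  rintro _ ⟨X, hX, rfl⟩
  change _ ≤ hgt F (realPoint 𝓕 X) m
  rw [hgt_realPoint X hm]
  exact Real.exp_le_exp.2 (by linarith [hs X hX])

/-! ### A continuous choice of translations -/

/-- The monomials that are nearly dominant at a point of the toric variety are exactly the dominant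
ones at some point of `ℝ^(n+1)`. -/
theorem exists_dominant_iff_exp_neg_le_hgt (hsimp : IsSimplicial F) {ε C₀ : ℝ}
    (hε : ∀ X, ∃ Y, ∀ m ∈ expts F, trop F X - tmon F m X < ε → tmon F m Y = trop F Y)
    (hC₀ : 0 < C₀) (hC₀ε : C₀ < ε) (x : ToricVar 𝓕 TT) :
    ∃ Y, ∀ m ∈ expts F, tmon F m Y = trop F Y ↔ Real.exp (-C₀) ≤ hgt F x m := by
  classical
  let S := (expts F).filter fun m => Real.exp (-C₀) ≤ hgt F x m
  have hne : S.Nonempty := by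
    obtain ⟨m, hm, h⟩ := exists_hgt_eq_one (F := F) x
    refine ⟨m, Finset.mem_filter.2 ⟨hm, ?_⟩⟩
    rw [h]
    exact Real.exp_le_one_iff.2 (by linarith)
  obtain ⟨Y, hY, -⟩ := exists_tendsto_dom_eq (F := F) x (zeroCone_le _)
  simp only [← realPoint_eq_pt] at hY
  have h1 : ∀ᶠ k in Filter.atTop, ∀ m ∈ S, Real.exp (-ε) < hgt F (realPoint 𝓕 (Y k)) m := by
    rw [Filter.eventually_all_finset]
    intro m hm
    obtain ⟨hmA, hmx⟩ := Finset.mem_filter.1 hm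
    exact (((continuous_hgt hmA).tendsto x).comp hY).eventually_const_lt
      ((Real.exp_lt_exp.2 (neg_lt_neg hC₀ε)).trans_le hmx)
  obtain ⟨k, hk⟩ := h1.exists
  obtain ⟨Z, hZ⟩ := hε (Y k)
  obtain ⟨W, hW⟩ := hsimp.exists_dominant_iff (Finset.filter_subset _ _) hne (Y := Z) fun m hm => by
    obtain ⟨hmA, -⟩ := Finset.mem_filter.1 hm
    have := hk m hm
    rw [hgt_realPoint _ hmA, Real.exp_lt_exp] at this
    exact hZ m hmA (by linarith)
  refine ⟨W, fun m hm => (hW m hm).trans ?_⟩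
  rw [Finset.mem_filter]
  exact and_iff_right hm

/-- The vector of heights of the tropical monomials at a point. -/
def heights (F : LPoly n) (x : ToricVar 𝓕 TT) : expts F → ℝ := fun m => hgt F x m

/-- The translations that make the monomials of height at least `exp (-C)` dominant, in terms of
the vector `z` of heights. -/
def goodTranslations (F : LPoly n) (C : ℝ) (z : expts F → ℝ) : Set (RSp n) :=
  {d | ∀ m m' : expts F, Real.exp (-C) ≤ z m → 0 < z m' →
    pair (toReal (m' : Lat n)) d + Real.log (z m') ≤ pair (toReal (m : Lat n)) d + Real.log (z m)}

omit hU hC in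
theorem convex_goodTranslations (C : ℝ) (z : expts F → ℝ) :
    Convex ℝ (goodTranslations F C z) := by
  intro d hd e he s t hs ht hst m m' hm hm'
  have h1 := mul_le_mul_of_nonneg_left (hd m m' hm hm') hs
  have h2 := mul_le_mul_of_nonneg_left (he m m' hm hm') ht
  simp only [pair_add_right, pair_smul_right]
  have h3 : ∀ r : ℝ, r = s * r + t * r := fun r => by rw [← add_mul, hst, one_mul]
  rw [h3 (Real.log (z m)), h3 (Real.log (z m'))]
  linarith

omit hC in
/-- The membership in `goodTranslations` compares the monomials of positive height, that is, those
on the face that is relevant in the orbit of `x`. -/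
theorem mem_dom_act_of_mem_goodTranslations {C : ℝ} {x : ToricVar 𝓕 TT} {d : RSp n}
    (hd : d ∈ goodTranslations F C (heights F x)) {m : Lat n} (hm : m ∈ expts F)
    (hmx : Real.exp (-C) ≤ hgt F x m) : m ∈ dom F (act d x) := by
  have hface := hgt_pos_iff.1 ((Real.exp_pos _).trans_le hmx)
  rw [act, mem_dom_pt_iff]
  refine ⟨hface, fun m' hm' => ?_⟩
  have h1 := hd ⟨m, hm⟩ ⟨m', (mem_faceExpts.1 hm').1⟩ hmx (hgt_pos_iff.2 hm')
  have h2 : ∀ k ∈ faceExpts F (typ x : PointedCone ℝ (RSp n)), Real.log (hgt F x k) =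
      tmon F k (lift x) - ftrop F (typ x : PointedCone ℝ (RSp n)) (lift x) := by
    intro k hk
    rw [hgt, if_pos hk, Real.log_exp]
  change pair (toReal m') d + Real.log (hgt F x m') ≤ pair (toReal m) d + Real.log (hgt F x m) at h1
  rw [h2 m hface, h2 m' hm'] at h1
  have h3 : ∀ k, tmon F k (lift x + d) = tmon F k (lift x) + pair (toReal k) d := by
    intro k; unfold tmon; rw [pair_add_right]; ring
  rw [h3, h3]
  linarith

/-- Near the heights of any given point the translations can be chosen continuously. -/
theorem exists_local_translation (hsimp : IsSimplicial F) {ε C₀ : ℝ}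
    (hε : ∀ X, ∃ Y, ∀ m ∈ expts F, trop F X - tmon F m X < ε → tmon F m Y = trop F Y)
    (hC₀ : 0 < C₀) (hC₀ε : C₀ < ε) (x : ToricVar 𝓕 TT) :
    ∃ U ∈ nhds (heights F x), ∃ g : (expts F → ℝ) → RSp n, ContinuousOn g U ∧
      ∀ z ∈ U, g z ∈ goodTranslations F C₀ z := by
  classical
  obtain ⟨Y, hY⟩ := exists_dominant_iff_exp_neg_le_hgt hsimp hε hC₀ hC₀ε x
  set z₀ := heights F x with hz₀
  have hS : ∀ m : expts F, tmon F m Y = trop F Y ↔ Real.exp (-C₀) ≤ z₀ m := fun m => hY m m.2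
  choose! w c hwc using fun (j : expts F) (hj : Real.exp (-C₀) ≤ z₀ j) =>
    hsimp Y j j.2 ((hS j).2 hj)
  -- the translation that is exact at `x`, corrected so that the monomials in question stay equal
  let d₀ : RSp n := Y - lift x
  let T : Finset (expts F) := Finset.univ.filter fun j => Real.exp (-C₀) ≤ z₀ j
  have hT : ∀ j, j ∈ T ↔ Real.exp (-C₀) ≤ z₀ j := fun j => by simp [T]
  let g : (expts F → ℝ) → RSp n := fun z =>
    d₀ + ∑ j ∈ T, (Real.log (z₀ j) - Real.log (z j)) • w j
  have hg₀ : g z₀ = d₀ := by simp [g]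
  have hpos : ∀ j ∈ T, 0 < z₀ j := fun j hj => (Real.exp_pos _).trans_le ((hT j).1 hj)
  have hgc : ∀ z : expts F → ℝ, (∀ j ∈ T, 0 < z j) → ContinuousAt g z := by
    intro z hz
    refine ContinuousAt.add (continuousAt_const (y := d₀)) (tendsto_finsetSum T fun j hj => ?_)
    exact ContinuousAt.smul (continuousAt_const.sub
      ((continuousAt_apply j z).log (hz j hj).ne')) (continuousAt_const (y := w j))
  have hface : ∀ m : expts F, (m : Lat n) ∈ faceExpts F (typ x : PointedCone ℝ (RSp n)) →
      Real.exp (pair (toReal (m : Lat n)) d₀) * z₀ m =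
        Real.exp (tmon F m Y - ftrop F (typ x : PointedCone ℝ (RSp n)) (lift x)) := by
    intro m hm
    rw [hz₀, heights, hgt, if_pos hm, ← Real.exp_add, pair_sub_right]
    congr 1
    unfold tmon; ring
  have hTface : ∀ m ∈ T, (m : Lat n) ∈ faceExpts F (typ x : PointedCone ℝ (RSp n)) :=
    fun m hm => hgt_pos_iff.1 (hpos m hm)
  have hstrict : ∀ m ∈ T, ∀ m' ∉ T, Real.exp (pair (toReal (m' : Lat n)) d₀) * z₀ m' <
      Real.exp (pair (toReal (m : Lat n)) d₀) * z₀ m := by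
    intro m hm m' hm'
    rw [hface m (hTface m hm)]
    by_cases h : (m' : Lat n) ∈ faceExpts F (typ x : PointedCone ℝ (RSp n))
    · rw [hface m' h, Real.exp_lt_exp]
      have h1 := (hS m).2 ((hT m).1 hm)
      have h2 : tmon F m' Y < trop F Y := lt_of_le_of_ne (tmon_le_trop m'.2 Y) fun e =>
        hm' ((hT m').2 ((hS m').1 e))
      linarith
    · -- a monomial outside the face has height zero at `x`
      have : z₀ m' = 0 := hgt_eq_zero h
      rw [this, mul_zero]
      exact Real.exp_pos _
  let U : Set (expts F → ℝ) := {z | (∀ j ∈ T, 0 < z j) ∧ (∀ m ∉ T, z m < Real.exp (-C₀)) ∧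
    ∀ m ∈ T, ∀ m' ∉ T, Real.exp (pair (toReal (m' : Lat n)) (g z)) * z m' <
      Real.exp (pair (toReal (m : Lat n)) (g z)) * z m}
  refine ⟨U, ?_, g, fun z hz => (hgc z hz.1).continuousWithinAt, ?_⟩
  · have hval : ∀ m : expts F, Filter.Tendsto
        (fun z => Real.exp (pair (toReal (m : Lat n)) (g z)) * z m) (nhds z₀)
        (nhds (Real.exp (pair (toReal (m : Lat n)) d₀) * z₀ m)) := by
      intro m
      have h1 := hgc z₀ hpos
      rw [ContinuousAt, hg₀] at h1
      exact (((Real.continuous_exp.comp (continuous_pair (toReal (m : Lat n)))).tendsto d₀).comp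
        h1).mul (continuousAt_apply m z₀)
    refine Filter.inter_mem ?_ (Filter.inter_mem ?_ ?_)
    · exact (Filter.eventually_all_finset T).2 fun j hj =>
        (continuousAt_apply j z₀).eventually_const_lt (hpos j hj)
    · refine Filter.eventually_all.2 fun m => ?_
      by_cases hm : m ∈ T
      · simp [hm]
      · filter_upwards [(continuousAt_apply m z₀).eventually_lt_const
          (not_le.1 fun h => hm ((hT m).2 h))] with z hz _ using hz
    · refine (Filter.eventually_all_finset T).2 fun m hm => Filter.eventually_all.2 fun m' => ?_
      by_cases hm' : m' ∈ T
      · simp [hm']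
      · filter_upwards [(hval m').eventually_lt (hval m) (hstrict m hm m' hm')] with z hz _ using hz
  · rintro z ⟨hz1, hz2, hz3⟩ m m' hm hm'
    have hmT : m ∈ T := by
      by_contra h
      exact absurd hm (not_le.2 (hz2 m h))
    by_cases hm'T : m' ∈ T
    · have key : ∀ k ∈ T, pair (toReal (k : Lat n)) (g z) + Real.log (z k) =
          trop F Y - ftrop F (typ x : PointedCone ℝ (RSp n)) (lift x) -
            ∑ j ∈ T, (Real.log (z₀ j) - Real.log (z j)) * c j := by
        intro k hk
        have h1 : ∀ j ∈ T, (Real.log (z₀ j) - Real.log (z j)) * pair (toReal (k : Lat n)) (w j) =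
            (if k = j then Real.log (z₀ j) - Real.log (z j) else 0) -
              (Real.log (z₀ j) - Real.log (z j)) * c j := by
          intro j hj
          have h2 := hwc j ((hT j).1 hj) k k.2 ((hS k).2 ((hT k).1 hk))
          rw [eq_sub_of_add_eq h2]
          simp only [Subtype.coe_inj]
          split_ifs <;> ring
        have h3 := congrArg Real.log (hface k (hTface k hk))
        rw [Real.log_exp, Real.log_mul (Real.exp_pos _).ne' (hpos k hk).ne', Real.log_exp,
          (hS k).2 ((hT k).1 hk)] at h3
        simp only [g, pair_add_right, pair_sum_right, pair_smul_right]
        rw [Finset.sum_congr rfl h1, Finset.sum_sub_distrib, Finset.sum_ite_eq, if_pos hk]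
        linarith
      rw [key m hmT, key m' hm'T]
    · have h1 := hz3 m hmT m' hm'T
      have h2 := Real.log_le_log (mul_pos (Real.exp_pos _) hm') h1.le
      rwa [Real.log_mul (Real.exp_pos _).ne' hm'.ne', Real.log_mul (Real.exp_pos _).ne'
        (hz1 m hmT).ne', Real.log_exp, Real.log_exp] at h2

/-- There is a continuous family of translations that make all nearly dominant monomials
dominant. -/
theorem exists_continuous_translation (hsimp : IsSimplicial F) {ε C₀ : ℝ}
    (hε : ∀ X, ∃ Y, ∀ m ∈ expts F, trop F X - tmon F m X < ε → tmon F m Y = trop F Y)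
    (hC₀ : 0 < C₀) (hC₀ε : C₀ < ε) :
    ∃ d : ToricVar 𝓕 TT → RSp n, Continuous d ∧ ∀ x, ∀ m ∈ expts F,
      Real.exp (-C₀) ≤ hgt F x m → m ∈ dom F (act (d x) x) := by
  obtain ⟨d, hd⟩ := exists_continuous_forall_mem_convex_of_local
    (X := Set.range (heights F : ToricVar 𝓕 TT → expts F → ℝ))
    (t := fun z => goodTranslations F C₀ z.1) (fun z => convex_goodTranslations C₀ z.1) (by
      rintro ⟨_, x, rfl⟩
      obtain ⟨U, hU, g, hg, hgU⟩ := exists_local_translation hsimp hε hC₀ hC₀ε x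
      exact ⟨Subtype.val ⁻¹' U, continuous_subtype_val.continuousAt.preimage_mem_nhds hU,
        g ∘ Subtype.val, hg.comp continuous_subtype_val.continuousOn fun z hz => hz,
        fun z hz => hgU z.1 hz⟩)
  have hcont : Continuous (heights F : ToricVar 𝓕 TT → expts F → ℝ) :=
    continuous_pi fun m => continuous_hgt m.2
  refine ⟨fun x => d ⟨heights F x, x, rfl⟩, d.continuous.comp (hcont.subtype_mk _), ?_⟩
  intro x m hm hmx
  exact mem_dom_act_of_mem_goodTranslations (hd ⟨heights F x, x, rfl⟩) hm hmx

/-! ### Existence and uniqueness up to homotopy -/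

/-- The map `φ` moves `x` inside its orbit by a translation that makes all nearly dominant monomials
dominant. -/
theorem exists_preservesCells (hsimp : IsSimplicial F) {ε C₀ C₁ R : ℝ} {b : ℝ → ℝ}
    (hF : (expts F).Nonempty)
    (hε : ∀ X, ∃ Y, ∀ m ∈ expts F, trop F X - tmon F m X < ε → tmon F m Y = trop F Y)
    (hC₀ : 0 < C₀) (hC₀ε : C₀ < ε) (hb : IsCutoff C₀ C₁ b) (hR : 1 < R) :
    ∃ φ : C(logW 𝓕 F b R, tropV 𝓕 F), PreservesCells 𝓕 F C₀ b R φ := by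
  obtain ⟨d, hd, hdom⟩ := exists_continuous_translation (𝓕 := 𝓕) hsimp hε hC₀ hC₀ε
  have hmem : ∀ x ∈ logW 𝓕 F b R, act (d x) x ∈ tropV 𝓕 F := by
    intro x hx
    obtain ⟨S, hS, hxS⟩ := exists_mem_closure_nearDom_eq hF hC₀ hb hR hx
    obtain ⟨m, hm, m', hm', hne⟩ := Finset.one_lt_card.1 hS
    have hSne : ({X | nearDom F C₀ X = S} : Set (RSp n)).Nonempty := by
      have : (closure (realPoint 𝓕 '' {X | nearDom F C₀ X = S})).Nonempty := ⟨x, hxS⟩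
      exact (closure_nonempty_iff.1 this).of_image
    obtain ⟨X, hX⟩ := hSne
    have key : ∀ k ∈ S, k ∈ dom F (act (d x) x) := by
      intro k hk
      have hkA : k ∈ expts F := by
        have : k ∈ nearDom F C₀ X := hX.symm ▸ hk
        exact (mem_nearDom.1 this).1
      refine hdom x k hkA (exp_neg_le_hgt_of_mem_closure hkA (fun Z hZ => ?_) hxS)
      have : k ∈ nearDom F C₀ Z := (show nearDom F C₀ Z = S from hZ).symm ▸ hk
      exact (mem_nearDom.1 this).2
    exact mem_tropV_of_ne hne (key m hm) (key m' hm')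
  refine ⟨⟨fun x => ⟨act (d x) x, hmem x x.2⟩, Continuous.subtype_mk ?_ _⟩, ?_⟩
  · rw [continuous_iff_continuousAt]
    intro x
    exact tendsto_act continuous_subtype_val.continuousAt
      (hd.comp continuous_subtype_val).continuousAt
  · rintro σ ρ hρ x ⟨μ, hμ, rfl, hxD, hxσ⟩ hxo
    have htyp := mem_orbit_iff.1 hxo
    obtain ⟨X, hX, rfl⟩ := exists_eq_cell_of_mem_cellsAt_zeroCone hμ
    refine ⟨⟨⟨fun m hm => ?_, zeroCone_le _⟩, ?_⟩, ?_⟩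
    · have hmA := (mem_dom.1 hm).1
      refine hdom x m hmA ?_
      unfold DhatZero at hxD
      rw [domExpts_cell] at hxD
      refine exp_neg_le_hgt_of_mem_closure hmA (fun Z hZ => ?_) hxD
      obtain ⟨m₁, hm₁, e₁⟩ := exists_tmon_eq_trop hF Z
      by_cases h : m₁ ∈ dom F (realPoint 𝓕 X)
      · rw [← e₁]
        exact (abs_lt.1 (hZ.1 m hm m₁ h)).2
      · obtain ⟨m', hm', hge⟩ := hZ.2 m₁ hm₁ h
        have := tmon_le_trop (mem_dom.1 hm').1 Z
        linarith
    · rw [mem_orbitClosure_iff]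
      change σ ≤ typ (act _ _)
      rw [typ_act, htyp]
    · rw [mem_orbit_iff]
      change typ (act _ _) = σ
      rw [typ_act, htyp]

/-- Every point of the image of the tropical localization lies in a region `D̂_ρ`, so that the
values of two maps that preserve cells lie in the same orbit and in a common cell. -/
theorem exists_common_dom (hsimp : IsSimplicial F) {ε C₀ C₁ R : ℝ} {b : ℝ → ℝ}
    (hF : (expts F).Nonempty)
    (hε : ∀ X, ∃ Y, ∀ m ∈ expts F, trop F X - tmon F m X < ε → tmon F m Y = trop F Y)
    (hC₀ : 0 < C₀) (hC₀ε : C₀ < ε) (hb : IsCutoff C₀ C₁ b) (hR : 1 < R) (x : logW 𝓕 F b R) :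
    ∃ S : Finset (Lat n), 1 < S.card ∧ ∀ φ : logW 𝓕 F b R → tropV 𝓕 F,
      PreservesCells 𝓕 F C₀ b R φ →
        S ⊆ dom F (φ x : ToricVar 𝓕 TT) ∧ typ (φ x : ToricVar 𝓕 TT) = typ (x : ToricVar 𝓕 TT) := by
  obtain ⟨S, hS, hxS⟩ := exists_mem_closure_nearDom_eq hF hC₀ hb hR x.2
  have hSne : ({X | nearDom F C₀ X = S} : Set (RSp n)).Nonempty := by
    have : (closure (realPoint 𝓕 '' {X | nearDom F C₀ X = S})).Nonempty := ⟨x, hxS⟩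
    exact (closure_nonempty_iff.1 this).of_image
  obtain ⟨X, hX⟩ := hSne
  have hSA : ∀ m ∈ S, m ∈ expts F ∧ trop F X - tmon F m X < C₀ := fun m hm =>
    mem_nearDom.1 ((show nearDom F C₀ X = S from hX).symm ▸ hm)
  obtain ⟨Y, hY⟩ := hε X
  obtain ⟨Z, hZ⟩ := hsimp.exists_dominant_iff (fun m hm => (hSA m hm).1)
    (Finset.card_pos.1 (zero_lt_one.trans hS)) (Y := Y)
    fun m hm => hY m (hSA m hm).1 ((hSA m hm).2.trans hC₀ε)
  have hdomZ : dom F (realPoint 𝓕 Z) = S := by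
    ext m
    rw [mem_dom_realPoint_iff]
    exact ⟨fun h => (hZ m h.1).1 h.2, fun h => ⟨(hSA m h).1, (hZ m (hSA m h).1).2 h⟩⟩
  obtain ⟨m, hm, m', hm', hne⟩ := Finset.one_lt_card.1 hS
  have hZV : Z ∈ tropV0 F := mem_tropV0_of_ne (hSA m hm).1 (hSA m' hm').1 hne
    ((hZ m (hSA m hm).1).2 hm) ((hZ m' (hSA m' hm').1).2 hm')
  -- the cell of `S` reaches the orbit of `x`
  have hmeet : (cell F (dom F (realPoint 𝓕 Z)) (typ (x : ToricVar 𝓕 TT))).Nonempty := by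
    refine ⟨pt (typ (x : ToricVar 𝓕 TT)) Z, fun k hk => ?_, by rw [typ_pt]⟩
    rw [hdomZ] at hk
    have hkx : Real.exp (-C₀) ≤ hgt F (x : ToricVar 𝓕 TT) k :=
      exp_neg_le_hgt_of_mem_closure (hSA k hk).1 (fun W hW => (mem_nearDom.1
        ((show nearDom F C₀ W = S from hW).symm ▸ hk : k ∈ nearDom F C₀ W)).2) hxS
    refine mem_dom_pt_iff.2 ⟨hgt_pos_iff.1 ((Real.exp_pos _).trans_le hkx), fun k' hk' => ?_⟩
    rw [(hZ k (hSA k hk).1).2 hk]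
    exact tmon_le_trop (mem_faceExpts.1 hk').1 Z
  have hmeet0 : (cell F (dom F (realPoint 𝓕 Z)) 𝓕.zeroCone).Nonempty :=
    ⟨realPoint 𝓕 Z, subset_rfl, zeroCone_le _⟩
  have hcell : cell F (dom F (realPoint 𝓕 Z)) (typ (x : ToricVar 𝓕 TT)) =
      cell F (dom F (realPoint 𝓕 Z)) 𝓕.zeroCone ∩
        orbitClosure 𝓕 TT (typ (x : ToricVar 𝓕 TT)) := by
    ext y
    rw [Set.mem_inter_iff, mem_orbitClosure_iff]
    exact ⟨fun h => ⟨⟨h.1, zeroCone_le _⟩, h.2⟩, fun h => ⟨h.1.1, h.2⟩⟩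
  refine ⟨S, hS, fun φ hφ => ?_⟩
  have h1 := hφ (typ (x : ToricVar 𝓕 TT)) _ (cell_mem_cellsAt hZV hmeet) x
    ⟨_, cell_mem_cellsAt hZV hmeet0, hcell, ?_, mem_orbitClosure_iff.2 le_rfl⟩
    (mem_orbit_iff.2 rfl)
  · exact ⟨hdomZ ▸ h1.1.1, mem_orbit_iff.1 h1.2⟩
  · unfold DhatZero
    rw [domExpts_cell, hdomZ]
    refine closure_mono (Set.image_mono fun W hW => ?_) hxS
    have hW' : ∀ k, k ∈ S ↔ k ∈ expts F ∧ trop F W - tmon F k W < C₀ := fun k => by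
      rw [← show nearDom F C₀ W = S from hW, mem_nearDom]
    refine ⟨fun k hk k' hk' => ?_, fun k hk hkS => ?_⟩
    · obtain ⟨hkA, hk2⟩ := (hW' k).1 hk
      obtain ⟨hkA', hk2'⟩ := (hW' k').1 hk'
      have := tmon_le_trop hkA W
      have := tmon_le_trop hkA' W
      exact abs_lt.2 ⟨by linarith, by linarith⟩
    · obtain ⟨k₁, hk₁, e₁⟩ := exists_tmon_eq_trop hF W
      refine ⟨k₁, (hW' k₁).2 ⟨hk₁, by rw [e₁, sub_self]; exact hC₀⟩, ?_⟩
      by_contra hlt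
      exact hkS ((hW' k).2 ⟨hk, by rw [← e₁]; exact not_le.1 hlt⟩)

/-- Two maps that preserve cells are homotopic along the segments between their values, as both
values lie in the same orbit and in a common cell, which is convex. -/
theorem homotopic_of_preservesCells (hsimp : IsSimplicial F) {ε C₀ C₁ R : ℝ} {b : ℝ → ℝ}
    (hF : (expts F).Nonempty)
    (hε : ∀ X, ∃ Y, ∀ m ∈ expts F, trop F X - tmon F m X < ε → tmon F m Y = trop F Y)
    (hC₀ : 0 < C₀) (hC₀ε : C₀ < ε) (hb : IsCutoff C₀ C₁ b) (hR : 1 < R)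
    (φ₀ φ₁ : C(logW 𝓕 F b R, tropV 𝓕 F)) (h₀ : PreservesCells 𝓕 F C₀ b R φ₀)
    (h₁ : PreservesCells 𝓕 F C₀ b R φ₁) : φ₀.Homotopic φ₁ := by
  have htyp : ∀ x, typ (φ₀ x : ToricVar 𝓕 TT) = typ (φ₁ x : ToricVar 𝓕 TT) := by
    intro x
    obtain ⟨S, -, hS⟩ := exists_common_dom hsimp hF hε hC₀ hC₀ε hb hR x
    rw [(hS φ₀ h₀).2, (hS φ₁ h₁).2]
  refine ⟨⟨⟨fun p => ⟨comb (p.1 : ℝ) (φ₀ p.2 : ToricVar 𝓕 TT) (φ₁ p.2), ?_⟩, ?_⟩, ?_, ?_⟩⟩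
  · obtain ⟨S, hcard, hS⟩ := exists_common_dom hsimp hF hε hC₀ hC₀ε hb hR p.2
    obtain ⟨m, hm, m', hm', hne⟩ := Finset.one_lt_card.1 hcard
    exact mem_tropV_of_ne hne
      (inter_dom_subset_dom_comb (htyp p.2) p.1.2 ((hS φ₀ h₀).1 hm) ((hS φ₁ h₁).1 hm))
      (inter_dom_subset_dom_comb (htyp p.2) p.1.2 ((hS φ₀ h₀).1 hm') ((hS φ₁ h₁).1 hm'))
  · refine Continuous.subtype_mk (continuous_iff_continuousAt.2 fun p => ?_) _
    refine tendsto_comb (htyp p.2) (fun q => htyp q.2) ?_ ?_ ?_ fun q => q.1.2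
    · exact (continuous_subtype_val.comp (φ₀.continuous.comp continuous_snd)).continuousAt
    · exact (continuous_subtype_val.comp (φ₁.continuous.comp continuous_snd)).continuousAt
    · exact (continuous_subtype_val.comp continuous_fst).continuousAt
  · intro x
    exact Subtype.ext (comb_zero _ _)
  · intro x
    exact Subtype.ext (comb_one (htyp x))

end

end TropLoc

end

theorem proposition4p1 (n : ℕ) (Δ : Set (TropLoc.RSp n)) (hΔ : TropLoc.IsLatticePolytope Δ)
    (F : TropLoc.LPoly n) (hconv : ∀ m, TropLoc.IsConvergent (F.coeff m))
    (hsupp : ∀ m, F.coeff m ≠ 0 ↔ TropLoc.toReal m ∈ Δ)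
    (𝓕 : TropLoc.Fan n) (hunim : 𝓕.IsUnimodular) (hsub : 𝓕.Subdivides (TropLoc.normalFan Δ))
    (hsmooth : TropLoc.IsSmooth F) :
    ∃ ε > (0 : ℝ), ∀ C₀ C₁ : ℝ, 0 < C₁ → C₁ < C₀ → C₀ < ε →
      ∀ b : ℝ → ℝ, TropLoc.IsCutoff C₀ C₁ b →
        ∃ R₀ > (1 : ℝ), ∀ R ≥ R₀, (∀ m, ∃ r > 1 / R, TropLoc.ConvergesAt (F.coeff m) r) →
          (∃ φ : C(TropLoc.logW 𝓕 F b R, TropLoc.tropV 𝓕 F),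
              TropLoc.PreservesCells 𝓕 F C₀ b R φ) ∧
            ∀ φ₀ φ₁ : C(TropLoc.logW 𝓕 F b R, TropLoc.tropV 𝓕 F),
              TropLoc.PreservesCells 𝓕 F C₀ b R φ₀ → TropLoc.PreservesCells 𝓕 F C₀ b R φ₁ →
                φ₀.Homotopic φ₁ := by
  have : Fact 𝓕.IsUnimodular := ⟨hunim⟩
  have hcomp := TropLoc.isCompatible_of_subdivides hΔ hsupp hsub
  have : Fact (TropLoc.IsCompatible 𝓕 F) := ⟨hcomp⟩
  have hF : (TropLoc.expts F).Nonempty :=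
    (hcomp _ 𝓕.bot_mem).mono fun m hm => (TropLoc.mem_faceExpts.1 hm).1
  have hsimp := hsmooth.isSimplicial hF
  obtain ⟨ε, hε, hgap⟩ := TropLoc.exists_uniform_gap hF
  refine ⟨ε, hε, fun C₀ C₁ hC₁ hC₁₀ hC₀ε b hb => ⟨2, one_lt_two, fun R hR _ => ?_⟩⟩
  have hR1 : 1 < R := lt_of_lt_of_le one_lt_two hR
  have hC₀ : 0 < C₀ := hC₁.trans hC₁₀
  exact ⟨TropLoc.exists_preservesCells hsimp hF hgap hC₀ hC₀ε hb hR1,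
    TropLoc.homotopic_of_preservesCells hsimp hF hgap hC₀ hC₀ε hb hR1⟩
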